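/- Let $(X_n,Y_n)$, $n\ge 1$, be i.i.d. data points with covariates $X_n\in\mathbb R^p$ and outcomes $Y_n\in\mathbb R^d$, where, conditionally on $X_n=x$, $Y_n$ has density $f(\cdot;x,\theta_\star)$ with respect to a $\sigma$-finite measure $\nu$ on $\mathbb R^d$. Here $\{f(\cdot;x,\theta):\theta\in\mathbb R^p\}$ is a family of probability densities (jointly measurable in $(x,y)$ for each $\theta$) whose support does not depend on $\theta$. Let $I(\theta_\star)=\mathbb E\big[\nabla\log f(Y;X,\theta_\star)\,\nabla\log f(Y;X,\theta_\star)^{\intercal}\big]$ be the Fisher information matrix (gradients and Hessians are in $\theta$). Assume that: (i) almost surely, $\theta\mapsto\log f(Y_n;X_n,\theta)$ is concave and twice differentiable on $\mathbb R^p$, and its gradient is Lipschitz continuous with a constant $L_0$; (ii) almost surely, $-\nabla^2\log f(Y_n;X_n,\theta)\succeq\underline{\lambda_f}\,I$ for all $\theta\in\mathbb R^p$, where $\underline{\lambda_f}>0$ is a constant; (iii) $\gamma_n=\gamma_1/n$ with $\gamma_1>0$, and the condition matrices $C_n$, $n\ge1$, are fixed positive-definite $p\times p$ matrices with eigenvalues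 in an interval $[\underline{\lambda_c},\overline{\lambda_c}]$, $\underline{\lambda_c}>0$, such that $C_n=C+O(\gamma_n)$, where $C$ is symmetric positive-definite and commutes with $I(\theta_\star)$; (iv) $2\gamma_1 C I(\theta_\star)-I$ is positive-definite. Let $\theta_n^{\mathrm{sgd}}$ be the explicit SGD iterates $$\theta_n^{\mathrm{sgd}}=\theta_{n-1}^{\mathrm{sgd}}+\gamma_nC_n\nabla\log f(Y_n;X_n,\theta_{n-1}^{\mathrm{sgd}}),\qquad n\ge1,$$ and let $\theta_n^{\mathrm{im}}$ be implicit SGD iterates, that is, almost surely, $$\theta_n^{\mathrm{im}}=\theta_{n-1}^{\mathrm{im}}+\gamma_nC_n\nabla\log f(Y_n;X_n,\theta_n^{\mathrm{im}}),\qquad n\ge1,$$ each started at an arbitrary fixed point of $\mathbb R^p$. Then all iterates have finite second moments, and, as $n\to\infty$, their covariance matrices satisfy $$n\,\mathrm{Var}(\theta_n^{\mathrm{sgd}})\to\gamma_1^2\,(2\gamma_1CI(\theta_\star)-I)^{-1}CI(\theta_\star)C,$$ $$n\,\mathrm{Var}(\theta_n^{\mathrm{im}})\to\gamma_1^2\,(2\gamma_1CI(\theta_\star)-I)^{-1}CI(\theta_\star)C.$$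 In particular the two procedures have the same asymptotic variance. -/

import Mathlib

open MeasureTheory ProbabilityTheory Filter Topology

noncomputable section

/-- A parametric family of conditional densities `y ↦ f y x θ` of an outcome `Y ∈ ℝᵈ` given a
covariate `X ∈ ℝᵖ`, with parameter `θ ∈ ℝᵖ`, with respect to a dominating measure `ν` on `ℝᵈ`. -/
structure IsDensityFamily {p d : ℕ} (ν : Measure (EuclideanSpace ℝ (Fin d)))
    (f : EuclideanSpace ℝ (Fin d) → EuclideanSpace ℝ (Fin p) → EuclideanSpace ℝ (Fin p) → ℝ) :
    Prop where
  /-- joint measurability in the data point, for every parameter value -/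
  measurable : ∀ θ, Measurable
    (fun z : EuclideanSpace ℝ (Fin p) × EuclideanSpace ℝ (Fin d) => f z.2 z.1 θ)
  nonneg : ∀ y x θ, 0 ≤ f y x θ
  lintegral_eq_one : ∀ x θ, ∫⁻ y, ENNReal.ofReal (f y x θ) ∂ν = 1

/-- The law of a data point `(X, Y)`: `X` has law `μ` and, given `X = x`, the outcome `Y` has
density `f · x θ` with respect to `ν`. -/
def dataLaw {p d : ℕ} (μ : Measure (EuclideanSpace ℝ (Fin p)))
    (ν : Measure (EuclideanSpace ℝ (Fin d)))
    (f : EuclideanSpace ℝ (Fin d) → EuclideanSpace ℝ (Fin p) → EuclideanSpace ℝ (Fin p) → ℝ)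
    (θ : EuclideanSpace ℝ (Fin p)) :
    Measure (EuclideanSpace ℝ (Fin p) × EuclideanSpace ℝ (Fin d)) :=
  (μ.prod ν).withDensity (fun z => ENNReal.ofReal (f z.2 z.1 θ))

/-- The log-likelihood `θ ↦ log f(y; x, θ)` of a data point. -/
def logLik {p d : ℕ}
    (f : EuclideanSpace ℝ (Fin d) → EuclideanSpace ℝ (Fin p) → EuclideanSpace ℝ (Fin p) → ℝ)
    (y : EuclideanSpace ℝ (Fin d)) (x θ : EuclideanSpace ℝ (Fin p)) : ℝ :=
  Real.log (f y x θ)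

/-- The score `∇ log f(y; x, θ)`, the gradient being taken in `θ`. -/
def score {p d : ℕ}
    (f : EuclideanSpace ℝ (Fin d) → EuclideanSpace ℝ (Fin p) → EuclideanSpace ℝ (Fin p) → ℝ)
    (y : EuclideanSpace ℝ (Fin d)) (x θ : EuclideanSpace ℝ (Fin p)) : EuclideanSpace ℝ (Fin p) :=
  gradient (logLik f y x) θ

/-- The observed Fisher information `-∇² log f(y; x, θ)`, as a linear map. -/
def observedFisher {p d : ℕ}
    (f : EuclideanSpace ℝ (Fin d) → EuclideanSpace ℝ (Fin p) → EuclideanSpace ℝ (Fin p) → ℝ)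
    (y : EuclideanSpace ℝ (Fin d)) (x θ : EuclideanSpace ℝ (Fin p)) :
    EuclideanSpace ℝ (Fin p) →L[ℝ] EuclideanSpace ℝ (Fin p) :=
  -fderiv ℝ (score f y x) θ

/-- The expected Fisher information matrix
`I(θ) = E[∇ log f(Y; X, θ) ∇ log f(Y; X, θ)ᵀ]`, `(X, Y)` being a data point with parameter `θ`. -/
def fisherInformation {p d : ℕ} (μ : Measure (EuclideanSpace ℝ (Fin p)))
    (ν : Measure (EuclideanSpace ℝ (Fin d)))
    (f : EuclideanSpace ℝ (Fin d) → EuclideanSpace ℝ (Fin p) → EuclideanSpace ℝ (Fin p) → ℝ)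
    (θ : EuclideanSpace ℝ (Fin p)) : Matrix (Fin p) (Fin p) ℝ :=
  Matrix.of fun i j => ∫ z, score f z.2 z.1 θ i * score f z.2 z.1 θ j ∂(dataLaw μ ν f θ)

/-- The assumptions on the likelihood: the support does not depend on the parameter and, for almost
every data point under the true parameter `θstar`, the log-likelihood is a concave, twice
differentiable function of `θ` whose gradient is Lipschitz with constant `L₀`, and the observed
Fisher information is bounded below by `lamf • 1` at every `θ`. -/
structure LikelihoodAssumptions {p d : ℕ} (μ : Measure (EuclideanSpace ℝ (Fin p)))
    (ν : Measure (EuclideanSpace ℝ (Fin d)))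
    (f : EuclideanSpace ℝ (Fin d) → EuclideanSpace ℝ (Fin p) → EuclideanSpace ℝ (Fin p) → ℝ)
    (θstar : EuclideanSpace ℝ (Fin p)) (L₀ : NNReal) (lamf : ℝ) : Prop where
  common_support : ∀ y x θ θ', 0 < f y x θ → 0 < f y x θ'
  concave : ∀ᵐ z ∂(dataLaw μ ν f θstar), ConcaveOn ℝ Set.univ (logLik f z.2 z.1)
  differentiable : ∀ᵐ z ∂(dataLaw μ ν f θstar), Differentiable ℝ (logLik f z.2 z.1)
  differentiable_score : ∀ᵐ z ∂(dataLaw μ ν f θstar), Differentiable ℝ (score f z.2 z.1)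
  lipschitz_score : ∀ᵐ z ∂(dataLaw μ ν f θstar), LipschitzWith L₀ (score f z.2 z.1)
  lamf_pos : 0 < lamf
  observedFisher_ge : ∀ᵐ z ∂(dataLaw μ ν f θstar), ∀ θ v : EuclideanSpace ℝ (Fin p),
    lamf * ‖v‖ ^ 2 ≤ inner ℝ (observedFisher f z.2 z.1 θ v) v

/-- The learning rate `γ_n = γ₁ / n`, for `n ≥ 1`. -/
def learningRate (γ₁ : ℝ) (n : ℕ) : ℝ := γ₁ / n

/-- The assumptions on the condition matrices `C_n`, `n ≥ 1`: each is positive-definite (and not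
necessarily symmetric), with eigenvalues in `[lamc, Lamc]`, `lamc > 0`, and `C_n = C + O(γ_n)`,
where `C` is symmetric positive-definite and commutes with the matrix `I`. -/
structure ConditionMatrixAssumptions {p : ℕ} (γ₁ : ℝ) (Cn : ℕ → Matrix (Fin p) (Fin p) ℝ)
    (C I : Matrix (Fin p) (Fin p) ℝ) (lamc Lamc : ℝ) : Prop where
  pos : ∀ n, 1 ≤ n → ∀ v : Fin p → ℝ, v ≠ 0 → 0 < v ⬝ᵥ (Cn n).mulVec v
  bigO : ∃ K : ℝ, ∀ n, 1 ≤ n → ∀ i j, |Cn n i j - C i j| ≤ K * learningRate γ₁ n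
  posDef_limit : C.PosDef
  commute : Commute C I
  lamc_pos : 0 < lamc
  eig : ∀ n, 1 ≤ n → ∀ lam ∈ spectrum ℝ (Cn n), lamc ≤ lam ∧ lam ≤ Lamc

/-- The explicit SGD procedure started at `θ₀`:
`θ_n = θ_{n-1} + γ_n C_n ∇ log f(Y_n; X_n, θ_{n-1})`, `n ≥ 1`. -/
def explicitSGD {p d : ℕ} {Ω : Type*}
    (f : EuclideanSpace ℝ (Fin d) → EuclideanSpace ℝ (Fin p) → EuclideanSpace ℝ (Fin p) → ℝ)
    (X : ℕ → Ω → EuclideanSpace ℝ (Fin p)) (Y : ℕ → Ω → EuclideanSpace ℝ (Fin d))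
    (γ₁ : ℝ) (Cn : ℕ → Matrix (Fin p) (Fin p) ℝ) (θ₀ : EuclideanSpace ℝ (Fin p)) :
    ℕ → Ω → EuclideanSpace ℝ (Fin p)
  | 0, _ => θ₀
  | n + 1, ω => explicitSGD f X Y γ₁ Cn θ₀ n ω + learningRate γ₁ (n + 1) •
      Matrix.toEuclideanLin (Cn (n + 1))
        (score f (Y (n + 1) ω) (X (n + 1) ω) (explicitSGD f X Y γ₁ Cn θ₀ n ω))

/-- `θ` is an implicit SGD procedure started at `θ₀`: almost surely,
`θ_n = θ_{n-1} + γ_n C_n ∇ log f(Y_n; X_n, θ_n)` for all `n ≥ 1`. -/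
structure IsImplicitSGD {p d : ℕ} {Ω : Type*} [MeasurableSpace Ω] (P : Measure Ω)
    (f : EuclideanSpace ℝ (Fin d) → EuclideanSpace ℝ (Fin p) → EuclideanSpace ℝ (Fin p) → ℝ)
    (X : ℕ → Ω → EuclideanSpace ℝ (Fin p)) (Y : ℕ → Ω → EuclideanSpace ℝ (Fin d))
    (γ₁ : ℝ) (Cn : ℕ → Matrix (Fin p) (Fin p) ℝ) (θ₀ : EuclideanSpace ℝ (Fin p))
    (θ : ℕ → Ω → EuclideanSpace ℝ (Fin p)) : Prop where
  init : ∀ᵐ ω ∂P, θ 0 ω = θ₀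
  step : ∀ n, ∀ᵐ ω ∂P, θ (n + 1) ω = θ n ω + learningRate γ₁ (n + 1) •
    Matrix.toEuclideanLin (Cn (n + 1)) (score f (Y (n + 1) ω) (X (n + 1) ω) (θ (n + 1) ω))

/-- The variance (covariance matrix) of a random vector. -/
def varianceMatrix {p : ℕ} {Ω : Type*} [MeasurableSpace Ω] (P : Measure Ω)
    (T : Ω → EuclideanSpace ℝ (Fin p)) : Matrix (Fin p) (Fin p) ℝ :=
  Matrix.of fun i j => cov[fun ω => T ω i, fun ω => T ω j; P]

/-- The matrix `γ₁² (2 γ₁ C I - 1)⁻¹ C I C`. -/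
def asymptoticVariance {p : ℕ} (γ₁ : ℝ) (C I : Matrix (Fin p) (Fin p) ℝ) :
    Matrix (Fin p) (Fin p) ℝ :=
  γ₁ ^ 2 • (((2 * γ₁) • (C * I) - 1)⁻¹ * C * I * C)

end

/-!
Write `θ n = θstar + √C (e n)`. In these coordinates both procedures are, up to a perturbation of
order `1 / n²`, the stochastic gradient recursion `e (n + 1) = e n + γ / (n + 1) • S (ζ n) (e n)`,
where `S z u = √C (score (θstar + √C u))` and the condition matrices have been turned into `1`. The
covariance of `S z 0` is `H = √C I √C`, which equals `C I` because `C` and `I` commute. For the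
implicit procedure this needs that its defining equation has a unique solution, depending measurably
on the data: the equation is the zero of a strongly monotone Lipschitz field
(`IsScoreField.exists_implicit_update`, `IsScoreField.implicit_unique`,
`IsScoreField.exists_isPerturbedSGD_implicit`).

The moments of the score come from its Lipschitz continuity: the density ratio is at least
`exp (⟨S z 0, u⟩ - L ‖u‖²)` and integrates to one, so that `S z 0` is sub-Gaussian
(`IsLogLikelihood.isSubGaussian`). Sub-Gaussian tails also dominate the differentiation under the
integral that yields the score identity and the Fisher information identity, so the mean field
`u ↦ E S z u` vanishes at the origin with derivative `-H` (`IsLogLikelihood.isScoreField`).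

The recursion is compared with its linearization at the origin, `linearSGD`, driven by the same
noise `S (ζ n) 0`. The covariance operators of the latter satisfy an exact recursion, and
`n • linearCov n` tends to the solution `V` of the Lyapunov equation `2 γ H V - V = γ² H`, since
`2 γ H - 1` is positive-definite (`tendsto_smul_linearCov`).

The difference of the two recursions contracts at rate `a / n` with `a > 1`, and is forced by the
nonlinear remainder of the mean field at `e n`. The remainder is `o(‖u‖)` near the origin but only
`O(‖u‖)` globally, so its square is at most `ε ‖u‖² + K_ε ‖u‖ ^ m`, and some moment of order `m > 2`
has to decay faster than `1 / n`. A direct recursion for the moments of `e n` would only contract at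
a rate governed by the strong monotonicity constant `lamf`, which may be too small compared with
`1 / γ₁`. Instead `e n` is compared with the scaled sample mean of the noise (`noiseMean`), whose
moments of order `2 j` are `O(n ^ (-j))` by sub-Gaussianity. The distance to it contracts pathwise
at rate `κ / n` with a possibly small `κ`, hence its `2 j`-th power contracts at rate of order
`j κ / n`, which is as large as needed for large `j` (`IsScoreField.exists_tendsto_moment`). The
difference of the recursions is then `o(1 / n)` in mean square
(`IsScoreField.tendsto_norm_sub_linearSGD`), and the covariances have the same limit after
multiplication by `n` (`IsScoreField.tendsto_covariance`).
-/

set_option linter.unusedSectionVars false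

/-! ### Real recursions -/

/-- A contraction rate `c / n` forces the positive part to zero, the harmonic series being
divergent. -/
theorem eventually_le_of_le_one_sub_div_mul {y : ℕ → ℝ} {c : ℝ} (hc : 0 < c)
    (h : ∀ᶠ n : ℕ in atTop, y (n + 1) ≤ (1 - c / n) * y n) {η : ℝ} (hη : 0 < η) :
    ∀ᶠ n in atTop, y n ≤ η := by
  have hcn : ∀ᶠ n : ℕ in atTop, c / n ≤ 1 := by
    have := tendsto_const_div_atTop_nhds_zero_nat c
    filter_upwards [this.eventually_le_const (by norm_num : (0 : ℝ) < 1)] with n hn using hn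
  obtain ⟨N, hN⟩ := eventually_atTop.1 (h.and hcn)
  set S : ℕ → ℝ := fun n => ∑ k ∈ Finset.range n, 1 / (k : ℝ) with hS
  have hStop : Tendsto S atTop atTop :=
    (not_summable_iff_tendsto_nat_atTop_of_nonneg (fun k => by positivity)).1
      Real.not_summable_one_div_natCast
  set z : ℕ → ℝ := fun n => max (y n) 0 with hz
  have hz0 : ∀ n, 0 ≤ z n := fun n => le_max_right _ _
  have hzrec : ∀ n, N ≤ n → z (n + 1) ≤ Real.exp (-(c / n)) * z n := by
    intro n hn
    obtain ⟨h1, h2⟩ := hN n hn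
    have h3 : 1 - c / n ≤ Real.exp (-(c / n)) := by
      have := Real.add_one_le_exp (-(c / n)); linarith
    refine max_le ?_ (by have := hz0 n; positivity)
    calc y (n + 1) ≤ (1 - c / n) * y n := h1
      _ ≤ (1 - c / n) * z n := mul_le_mul_of_nonneg_left (le_max_left _ _) (by linarith)
      _ ≤ _ := mul_le_mul_of_nonneg_right h3 (hz0 n)
  have hmono : ∀ n, N ≤ n → z n ≤ z N * Real.exp (c * S N) * Real.exp (-(c * S n)) := by
    intro n hn
    induction n, hn using Nat.le_induction with
    | base => rw [mul_assoc, ← Real.exp_add]; simp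
    | succ n hn ih =>
      refine (hzrec n hn).trans ((mul_le_mul_of_nonneg_left ih (Real.exp_pos _).le).trans ?_)
      have : S (n + 1) = S n + 1 / n := Finset.sum_range_succ _ _
      rw [this, show -(c * (S n + 1 / n)) = -(c / n) + -(c * S n) by ring, Real.exp_add]
      exact le_of_eq (by ring)
  have hlim : Tendsto (fun n => z N * Real.exp (c * S N) * Real.exp (-(c * S n))) atTop (𝓝 0) := by
    have h1 : Tendsto (fun n => Real.exp (-(c * S n))) atTop (𝓝 0) :=
      Real.tendsto_exp_neg_atTop_nhds_zero.comp (hStop.const_mul_atTop hc)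
    simpa using h1.const_mul (z N * Real.exp (c * S N))
  filter_upwards [hlim.eventually_le_const hη, eventually_ge_atTop N] with n h1 h2
  exact (le_max_left _ _).trans ((hmono n h2).trans h1)

/-- A Chung-type lemma: a contraction rate `a / n` with `a > 1` beats a forcing term `o(1 / n²)`,
and gives the decay `o(1 / n)`. -/
theorem tendsto_natCast_mul_of_contraction {D : ℕ → ℝ} (hD : ∀ n, 0 ≤ D n) {a : ℝ} (ha : 1 < a)
    (h : ∀ ε > 0, ∀ᶠ n : ℕ in atTop,
      D (n + 1) ≤ (1 - a / (n + 1)) * D n + ε / ((n : ℝ) + 1) ^ 2) :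
    Tendsto (fun n : ℕ => n * D n) atTop (𝓝 0) := by
  have hc : 0 < a - 1 := by linarith
  refine tendsto_order.2 ⟨fun x hx => Eventually.of_forall fun n => lt_of_lt_of_le hx
    (mul_nonneg (Nat.cast_nonneg n) (hD n)), fun x hx => ?_⟩
  set ε : ℝ := (a - 1) * x / 4 with hε
  have hεpos : 0 < ε := by positivity
  have hεc : ε / (a - 1) = x / 4 := by rw [hε]; field_simp
  have key : ∀ᶠ n : ℕ in atTop, ((n + 1 : ℕ) * D (n + 1) - x / 4)
      ≤ (1 - (a - 1) / n) * (n * D n - x / 4) := by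
    filter_upwards [h ε hεpos, eventually_ge_atTop 1] with n hn hn1
    have hn0 : (1 : ℝ) ≤ n := by exact_mod_cast hn1
    have hn0' : (0 : ℝ) < n := by linarith
    have h1 : ((n : ℝ) + 1) * D (n + 1) ≤ (n + 1 - a) * D n + ε / (n + 1) := by
      calc ((n : ℝ) + 1) * D (n + 1)
          ≤ (n + 1) * ((1 - a / (n + 1)) * D n + ε / ((n : ℝ) + 1) ^ 2) := by gcongr
        _ = _ := by field_simp; try ring
    have h2 : ε / ((n : ℝ) + 1) ≤ ε / n := by gcongr; linarith
    have h3 : (1 - (a - 1) / n) * (n * D n - x / 4) = (n + 1 - a) * D n - x / 4 + ε / n := by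
      rw [hε]; field_simp; ring
    push_cast
    linarith
  have := eventually_le_of_le_one_sub_div_mul (y := fun n : ℕ => n * D n - x / 4) hc key
    (η := x / 4) (by positivity)
  filter_upwards [this] with n hn
  linarith

/-! ### Sub-Gaussian random vectors and their moments -/

section SubGaussian

variable {E : Type*} [NormedAddCommGroup E] [InnerProductSpace ℝ E]

/-- `W` is a sub-Gaussian random vector with variance proxy `2 c`: its exponential moments are
finite and `E exp ⟨a, W⟩ ≤ exp (c ‖a‖²)` for all `a`. -/
def IsSubGaussian {Ω : Type*} [MeasurableSpace Ω] (P : Measure Ω) (W : Ω → E) (c : ℝ) : Prop :=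
  ∀ a : E, Integrable (fun ω => Real.exp (inner ℝ a (W ω))) P ∧
    ∫ ω, Real.exp (inner ℝ a (W ω)) ∂P ≤ Real.exp (c * ‖a‖ ^ 2)

theorem abs_pow_le_factorial_mul_exp_add_exp (x : ℝ) (m : ℕ) :
    |x| ^ m ≤ m.factorial * (Real.exp x + Real.exp (-x)) := by
  have h1 := Real.pow_div_factorial_le_exp |x| (abs_nonneg x) m
  rw [div_le_iff₀ (by positivity)] at h1
  have h2 : Real.exp |x| ≤ Real.exp x + Real.exp (-x) := by
    rcases abs_cases x with ⟨h, _⟩ | ⟨h, _⟩ <;> rw [h] <;>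
      linarith [Real.exp_pos x, Real.exp_pos (-x)]
  calc |x| ^ m ≤ Real.exp |x| * m.factorial := h1
    _ ≤ (Real.exp x + Real.exp (-x)) * m.factorial := by gcongr
    _ = _ := mul_comm _ _

theorem norm_pow_le_sum_exp [FiniteDimensional ℝ E] {m : ℕ} (hm : m ≠ 0) (v : E) :
    ‖v‖ ^ m ≤ ((Module.finrank ℝ E : ℝ) ^ (m - 1) * m.factorial) *
      ∑ i, (Real.exp (inner ℝ (stdOrthonormalBasis ℝ E i) v)
        + Real.exp (inner ℝ (-stdOrthonormalBasis ℝ E i) v)) := by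
  set b := stdOrthonormalBasis ℝ E
  obtain ⟨k, rfl⟩ := Nat.exists_eq_succ_of_ne_zero hm
  have h1 : ‖v‖ ≤ ∑ i, |inner ℝ (b i) v| := by
    refine le_of_sq_le_sq ?_ (Finset.sum_nonneg fun i _ => abs_nonneg _)
    rw [← b.sum_sq_inner_right v]
    simp_rw [← sq_abs (inner ℝ (b _) v)]
    exact Finset.sum_sq_le_sq_sum_of_nonneg fun i _ => abs_nonneg _
  have h2 := pow_sum_div_card_le_sum_pow (s := Finset.univ) (f := fun i => |inner ℝ (b i) v|)
    (fun i _ => abs_nonneg _) k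
  have h3 : (∑ i, |inner ℝ (b i) v|) ^ (k + 1)
      ≤ (Module.finrank ℝ E : ℝ) ^ k * ∑ i, |inner ℝ (b i) v| ^ (k + 1) := by
    rcases Nat.eq_zero_or_pos (Module.finrank ℝ E) with h0 | h0
    · have : IsEmpty (Fin (Module.finrank ℝ E)) := by rw [h0]; infer_instance
      simp
    · rw [Finset.card_univ, Fintype.card_fin, div_le_iff₀' (by positivity)] at h2
      exact h2
  calc ‖v‖ ^ (k + 1) ≤ (∑ i, |inner ℝ (b i) v|) ^ (k + 1) := by gcongr
    _ ≤ _ := h3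
    _ ≤ (Module.finrank ℝ E : ℝ) ^ k * ∑ i, ((k + 1).factorial *
        (Real.exp (inner ℝ (b i) v) + Real.exp (-inner ℝ (b i) v))) := by
      gcongr with i
      exact abs_pow_le_factorial_mul_exp_add_exp _ _
    _ = _ := by
      rw [← Finset.mul_sum, ← mul_assoc]
      simp [inner_neg_left]

/-- The moments of a sub-Gaussian vector are bounded in terms of its variance proxy only. -/
theorem IsSubGaussian.exists_moment_bound [FiniteDimensional ℝ E] [MeasurableSpace E]
    [BorelSpace E] (c : ℝ) {m : ℕ} (hm : m ≠ 0) :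
    ∃ K : ℝ, 0 ≤ K ∧ ∀ {Ω : Type*} [MeasurableSpace Ω] (P : Measure Ω) (W : Ω → E),
      Measurable W → IsSubGaussian P W c →
      Integrable (fun ω => ‖W ω‖ ^ m) P ∧ ∫ ω, ‖W ω‖ ^ m ∂P ≤ K := by
  set b := stdOrthonormalBasis ℝ E
  set K₀ : ℝ := (Module.finrank ℝ E : ℝ) ^ (m - 1) * m.factorial
  have hK₀ : 0 ≤ K₀ := by positivity
  refine ⟨K₀ * ∑ i : Fin (Module.finrank ℝ E), (Real.exp c + Real.exp c), by positivity,
    fun {Ω} _ P W hW h => ?_⟩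
  have hi : ∀ i ∈ Finset.univ, Integrable (fun ω => Real.exp (inner ℝ (b i) (W ω))
      + Real.exp (inner ℝ (-b i) (W ω))) P := fun i _ => (h (b i)).1.add (h (-b i)).1
  have hint : Integrable (fun ω => K₀ * ∑ i, (Real.exp (inner ℝ (b i) (W ω))
      + Real.exp (inner ℝ (-b i) (W ω)))) P := (integrable_finsetSum _ hi).const_mul _
  have hint' : Integrable (fun ω => ‖W ω‖ ^ m) P := by
    refine hint.mono' (by fun_prop) (Eventually.of_forall fun ω => ?_)
    rw [Real.norm_of_nonneg (by positivity)]
    exact norm_pow_le_sum_exp hm _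
  refine ⟨hint', (integral_mono hint' hint fun ω => norm_pow_le_sum_exp hm _).trans ?_⟩
  rw [integral_const_mul, integral_finsetSum _ hi]
  gcongr with i
  rw [integral_add (h (b i)).1 (h (-b i)).1]
  have h1 := (h (b i)).2
  have h2 := (h (-b i)).2
  simp only [norm_neg, b.norm_eq_one, one_pow, mul_one] at h1 h2
  exact add_le_add h1 h2

/-- Normalized sums of independent sub-Gaussian vectors are sub-Gaussian, with the same proxy. -/
theorem IsSubGaussian.normalized_sum [MeasurableSpace E] [BorelSpace E]
    {Ω : Type*} [MeasurableSpace Ω] {P : Measure Ω} [IsProbabilityMeasure P]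
    [SecondCountableTopology E]
    {ξ : ℕ → Ω → E} (hm : ∀ n, Measurable (ξ n)) (hind : iIndepFun ξ P) {c : ℝ}
    (h : ∀ n, IsSubGaussian P (ξ n) c) {n : ℕ} (hn : n ≠ 0) :
    IsSubGaussian P (fun ω => (1 / √(n : ℝ)) • ∑ k ∈ Finset.range n, ξ k ω) c := by
  intro a
  set t : ℝ := 1 / √(n : ℝ)
  have hX : ∀ k, Measurable fun ω => inner ℝ (t • a) (ξ k ω) := fun k => by
    have := hm k; fun_prop
  have hind' : iIndepFun (fun k ω => inner ℝ (t • a) (ξ k ω)) P :=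
    hind.comp (fun _ x => inner ℝ (t • a) x) (fun _ => by fun_prop)
  have heq : (fun ω => Real.exp (inner ℝ a (t • ∑ k ∈ Finset.range n, ξ k ω))) =
      fun ω => Real.exp (1 * (∑ k ∈ Finset.range n, fun ω => inner ℝ (t • a) (ξ k ω)) ω) := by
    ext ω
    simp [inner_sum, real_inner_smul_left, real_inner_smul_right, Finset.mul_sum]
  rw [heq]
  refine ⟨hind'.integrable_exp_mul_sum hX fun k _ => by simpa using (h k (t • a)).1, ?_⟩
  have := hind'.mgf_sum (t := 1) hX (Finset.range n)
  rw [mgf] at this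
  rw [this]
  calc ∏ k ∈ Finset.range n, mgf (fun ω => inner ℝ (t • a) (ξ k ω)) P 1
      ≤ ∏ k ∈ Finset.range n, Real.exp (c * ‖t • a‖ ^ 2) := by
        refine Finset.prod_le_prod (fun k _ => mgf_nonneg) fun k _ => ?_
        have := (h k (t • a)).2
        simpa [mgf] using this
    _ = Real.exp (c * ‖a‖ ^ 2) := by
        rw [Finset.prod_const, Finset.card_range, ← Real.exp_nat_mul]
        congr 1
        rw [norm_smul, mul_pow, Real.norm_eq_abs, sq_abs, div_pow, Real.sq_sqrt (by positivity)]
        have : (n : ℝ) ≠ 0 := by exact_mod_cast hn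
        field_simp

end SubGaussian

/-! ### Random vectors with moments of all orders -/

section Moments

variable {E F : Type*} [NormedAddCommGroup E] [NormedAddCommGroup F]
  {Ω : Type*} [MeasurableSpace Ω] {P : Measure Ω}

/-- All absolute moments of `f` are finite. -/
def HasMoments (f : Ω → E) (P : Measure Ω) : Prop := ∀ m : ℕ, MemLp f m P

theorem HasMoments.add {f g : Ω → E} (hf : HasMoments f P) (hg : HasMoments g P) :
    HasMoments (fun ω => f ω + g ω) P := fun m => (hf m).add (hg m)

theorem HasMoments.sub {f g : Ω → E} (hf : HasMoments f P) (hg : HasMoments g P) :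
    HasMoments (fun ω => f ω - g ω) P := fun m => (hf m).sub (hg m)

theorem HasMoments.norm {f : Ω → E} (hf : HasMoments f P) :
    HasMoments (fun ω => ‖f ω‖) P := fun m => (hf m).norm

theorem HasMoments.of_le {f : Ω → E} {g : Ω → F} (hg : HasMoments g P)
    (hf : AEStronglyMeasurable f P) {K : ℝ} (h : ∀ ω, ‖f ω‖ ≤ K * ‖g ω‖) : HasMoments f P :=
  fun m => (hg m).of_le_mul hf (Eventually.of_forall h)

theorem HasMoments.integrable_pow [IsFiniteMeasure P] {f : Ω → E} (hf : HasMoments f P) (m : ℕ) :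
    Integrable (fun ω => ‖f ω‖ ^ m) P := (hf m).integrable_norm_pow'

theorem HasMoments.integrable_mul {f g : Ω → ℝ} (hf : HasMoments f P)
    (hg : HasMoments g P) : Integrable (fun ω => f ω * g ω) P :=
  MemLp.integrable_mul (by simpa using hf 2) (by simpa using hg 2)

theorem HasMoments.integrable {f : Ω → E} (hf : HasMoments f P) : Integrable f P :=
  memLp_one_iff_integrable.1 (by simpa using hf 1)

theorem hasMoments_const [IsFiniteMeasure P] (a : E) : HasMoments (fun _ : Ω => a) P :=
  fun _ => memLp_const a

theorem hasMoments_of_integrable_pow [IsFiniteMeasure P] {f : Ω → E}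
    (hf : AEStronglyMeasurable f P)
    (h : ∀ m : ℕ, m ≠ 0 → Integrable (fun ω => ‖f ω‖ ^ m) P) : HasMoments f P := by
  intro m
  rcases eq_or_ne m 0 with rfl | hm
  · simpa using hf
  · rw [← integrable_norm_rpow_iff hf (by exact_mod_cast hm) (by simp)]
    simpa using h m hm

end Moments

/-! ### Independent data streams -/

section Stream

variable {𝒵 Ω : Type*} [MeasurableSpace 𝒵] [MeasurableSpace Ω]

/-- An i.i.d. sequence of data points with law `ρ`. -/
structure IsDataStream (P : Measure Ω) (ρ : Measure 𝒵) (ζ : ℕ → Ω → 𝒵) : Prop where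
  measurable : ∀ n, Measurable (ζ n)
  indep : iIndepFun ζ P
  law : ∀ n, P.map (ζ n) = ρ

/-- The σ-algebra generated by the data points `ζ 0, …, ζ (n - 1)`. -/
@[reducible] def past (ζ : ℕ → Ω → 𝒵) (n : ℕ) : MeasurableSpace Ω :=
  ⨆ i ∈ Set.Iio n, MeasurableSpace.comap (ζ i) inferInstance

theorem past_mono (ζ : ℕ → Ω → 𝒵) {m n : ℕ} (h : m ≤ n) : past ζ m ≤ past ζ n :=
  biSup_mono fun _ hi => lt_of_lt_of_le hi h

theorem measurable_past_succ (ζ : ℕ → Ω → 𝒵) (n : ℕ) : Measurable[past ζ (n + 1)] (ζ n) :=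
  measurable_iff_comap_le.2 <|
    le_biSup (fun i => MeasurableSpace.comap (ζ i) inferInstance) (Set.mem_Iio.2 n.lt_succ_self)

variable {P : Measure Ω} {ρ : Measure 𝒵} {ζ : ℕ → Ω → 𝒵}

theorem IsDataStream.past_le (h : IsDataStream P ρ ζ) (n : ℕ) : past ζ n ≤ ‹MeasurableSpace Ω› :=
  iSup₂_le fun i _ => (h.measurable i).comap_le

theorem IsDataStream.indepFun_past (h : IsDataStream P ρ ζ) {α : Type*} [MeasurableSpace α]
    {n : ℕ} {g : Ω → α} (hg : Measurable[past ζ n] g) : IndepFun g (ζ n) P := by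
  have h1 := indep_iSup_of_disjoint (fun i => (h.measurable i).comap_le) h.indep
    (S := Set.Iio n) (T := {n}) (by simp)
  rw [IndepFun_iff_Indep]
  refine indep_of_indep_of_le_left (indep_of_indep_of_le_right h1 ?_) hg.comap_le
  simp

/-- Freezing lemma: given the past, the data point `ζ n` can be integrated out first. -/
theorem IsDataStream.integral_freeze [IsProbabilityMeasure P] [SFinite ρ]
    (h : IsDataStream P ρ ζ) {α : Type*}
    [MeasurableSpace α] {n : ℕ} {g : Ω → α} (hg : Measurable[past ζ n] g) {φ : α → 𝒵 → ℝ}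
    (hφ : Measurable (Function.uncurry φ)) (hint : Integrable (fun ω => φ (g ω) (ζ n ω)) P) :
    ∫ ω, φ (g ω) (ζ n ω) ∂P = ∫ ω, ∫ z, φ (g ω) z ∂ρ ∂P := by
  have hgm : Measurable g := hg.mono (h.past_le n) le_rfl
  have hpair : Measurable fun ω => (g ω, ζ n ω) := hgm.prodMk (h.measurable n)
  have hmap := (indepFun_iff_map_prod_eq_prod_map_map hgm.aemeasurable
    (h.measurable n).aemeasurable).1 (h.indepFun_past hg)
  rw [h.law n] at hmap
  have hint' : Integrable (Function.uncurry φ) ((P.map g).prod ρ) := by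
    rw [← hmap, integrable_map_measure hφ.aestronglyMeasurable hpair.aemeasurable]
    exact hint
  calc ∫ ω, φ (g ω) (ζ n ω) ∂P
      = ∫ q, Function.uncurry φ q ∂(P.map fun ω => (g ω, ζ n ω)) :=
        (integral_map hpair.aemeasurable hφ.aestronglyMeasurable).symm
    _ = ∫ a, ∫ z, φ a z ∂ρ ∂(P.map g) := by rw [hmap, integral_prod _ hint']; rfl
    _ = ∫ ω, ∫ z, φ (g ω) z ∂ρ ∂P :=
        integral_map hgm.aemeasurable hint'.aestronglyMeasurable.integral_prod_right'

theorem IsDataStream.integral_comp (h : IsDataStream P ρ ζ) {φ : 𝒵 → ℝ} (hφ : Measurable φ)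
    (n : ℕ) : ∫ ω, φ (ζ n ω) ∂P = ∫ z, φ z ∂ρ := by
  rw [← h.law n, integral_map (h.measurable n).aemeasurable hφ.aestronglyMeasurable]

end Stream

/-! ### Random score fields and perturbed stochastic gradient recursions -/

section Field

variable {E 𝒵 Ω : Type*} [NormedAddCommGroup E] [InnerProductSpace ℝ E] [FiniteDimensional ℝ E]
  [MeasurableSpace E] [BorelSpace E] [MeasurableSpace 𝒵] [MeasurableSpace Ω]

/-- A random field `s z`, Lipschitz and strongly decreasing in the parameter, whose value at the
origin is sub-Gaussian and centred, with covariance operator `H`, and whose mean field has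
derivative `-H` at the origin. Scores of regular models in coordinates centred at the true
parameter are of this form: the equality of the two `H` is the Fisher information identity. -/
structure IsScoreField (ρ : Measure 𝒵) (s : 𝒵 → E → E) (H : E →L[ℝ] E) (L lam : ℝ) : Prop where
  measurable : Measurable (Function.uncurry s)
  L_nonneg : 0 ≤ L
  lam_pos : 0 < lam
  lipschitz : ∀ z u v, ‖s z u - s z v‖ ≤ L * ‖u - v‖
  monotone : ∀ z u v, inner ℝ (s z u - s z v) (u - v) ≤ -lam * ‖u - v‖ ^ 2
  subGaussian : ∃ c, IsSubGaussian ρ (fun z => s z 0) c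
  mean_zero : ∀ a, ∫ z, inner ℝ a (s z 0) ∂ρ = 0
  second_moment : ∀ a b, ∫ z, inner ℝ a (s z 0) * inner ℝ b (s z 0) ∂ρ = inner ℝ a (H b)
  drift : (fun u => (∫ z, s z u ∂ρ) + H u) =o[𝓝 0] fun u => u

/-- A stochastic gradient recursion `e (n + 1) = e n + γ / (n + 1) • s (ζ n) (e n)`, up to a
perturbation of order `1 / n²`. Both the explicit and the implicit procedures are of this form. -/
structure IsPerturbedSGD (P : Measure Ω) (ζ : ℕ → Ω → 𝒵) (s : 𝒵 → E → E) (γ : ℝ)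
    (e : ℕ → Ω → E) : Prop where
  adapted : ∀ n, Measurable[past ζ n] (e n)
  moments : ∀ n, HasMoments (e n) P
  step : ∃ K : ℝ, 0 ≤ K ∧ ∀ᶠ n : ℕ in atTop, ∀ ω,
    ‖e (n + 1) ω - e n ω - (γ / (n + 1)) • s (ζ n ω) (e n ω)‖
      ≤ K / ((n : ℝ) + 1) ^ 2 * (‖s (ζ n ω) 0‖ + ‖e n ω‖)

variable {P : Measure Ω} {ρ : Measure 𝒵} {ζ : ℕ → Ω → 𝒵} {s : 𝒵 → E → E} {H : E →L[ℝ] E}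
  {L lam γ : ℝ} {e : ℕ → Ω → E}

theorem IsScoreField.measurable_zero (hs : IsScoreField ρ s H L lam) :
    Measurable fun z => s z 0 := hs.measurable.comp (by fun_prop : Measurable fun z => (z, (0 : E)))

theorem IsScoreField.measurable_noise (hs : IsScoreField ρ s H L lam) (hζ : IsDataStream P ρ ζ)
    (n : ℕ) : Measurable fun ω => s (ζ n ω) 0 := hs.measurable_zero.comp (hζ.measurable n)

theorem IsScoreField.exists_isSubGaussian_noise (hs : IsScoreField ρ s H L lam)
    (hζ : IsDataStream P ρ ζ) : ∃ c, ∀ n, IsSubGaussian P (fun ω => s (ζ n ω) 0) c := by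
  obtain ⟨c, hc⟩ := hs.subGaussian
  refine ⟨c, fun n a => ?_⟩
  obtain ⟨h1, h2⟩ := hc a
  have hm : Measurable fun z => Real.exp (inner ℝ a (s z 0)) := by
    have := hs.measurable_zero; fun_prop
  rw [← hζ.integral_comp hm n] at h2
  refine ⟨?_, h2⟩
  rw [← hζ.law n, integrable_map_measure hm.aestronglyMeasurable (hζ.measurable n).aemeasurable]
    at h1
  exact h1

theorem IsScoreField.exists_noise_moment_bound (hs : IsScoreField ρ s H L lam)
    (hζ : IsDataStream P ρ ζ) {m : ℕ} (hm : m ≠ 0) : ∃ K : ℝ, 0 ≤ K ∧ ∀ n,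
      Integrable (fun ω => ‖s (ζ n ω) 0‖ ^ m) P ∧ ∫ ω, ‖s (ζ n ω) 0‖ ^ m ∂P ≤ K := by
  obtain ⟨c, hc⟩ := hs.exists_isSubGaussian_noise hζ
  obtain ⟨K, hK0, hK⟩ := IsSubGaussian.exists_moment_bound (E := E) c hm
  exact ⟨K, hK0, fun n => hK P _ (hs.measurable_noise hζ n) (hc n)⟩

theorem IsScoreField.hasMoments_noise [IsProbabilityMeasure P] (hs : IsScoreField ρ s H L lam)
    (hζ : IsDataStream P ρ ζ) (n : ℕ) : HasMoments (fun ω => s (ζ n ω) 0) P := by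
  refine hasMoments_of_integrable_pow (hs.measurable_noise hζ n).aestronglyMeasurable
    fun m hm => ?_
  obtain ⟨K, -, hK⟩ := hs.exists_noise_moment_bound hζ hm
  exact (hK n).1

/-- The scaled sample mean `γ / n • ∑ k < n, s (ζ k) 0` of the noise. It obeys the linear recursion
`noiseMean_succ` with the identity in the place of `γ H`. -/
noncomputable def noiseMean (s : 𝒵 → E → E) (ζ : ℕ → Ω → 𝒵) (γ : ℝ) (n : ℕ) (ω : Ω) : E :=
  (γ / n) • ∑ k ∈ Finset.range n, s (ζ k ω) 0

theorem noiseMean_succ (n : ℕ) (ω : Ω) : noiseMean s ζ γ (n + 1) ω =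
    noiseMean s ζ γ n ω - (1 / ((n : ℝ) + 1)) • noiseMean s ζ γ n ω
      + (γ / (n + 1)) • s (ζ n ω) 0 := by
  simp only [noiseMean, Finset.sum_range_succ, smul_add, smul_smul, ← sub_smul]
  push_cast
  rcases eq_or_ne n 0 with rfl | hn
  · simp
  · have : (n : ℝ) ≠ 0 := by exact_mod_cast hn
    congr 2
    field_simp
    ring

theorem IsScoreField.hasMoments_noiseMean [IsProbabilityMeasure P]
    (hs : IsScoreField ρ s H L lam) (hζ : IsDataStream P ρ ζ) (n : ℕ) :
    HasMoments (noiseMean s ζ γ n) P := by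
  intro m
  unfold noiseMean
  exact (memLp_finsetSum _ fun k _ => hs.hasMoments_noise hζ k m).const_smul _

theorem IsScoreField.exists_noiseMean_moment_bound [IsProbabilityMeasure P]
    (hs : IsScoreField ρ s H L lam) (hζ : IsDataStream P ρ ζ) {j : ℕ} (hj : j ≠ 0) :
    ∃ K : ℝ, 0 ≤ K ∧ ∀ n : ℕ, n ≠ 0 →
      ∫ ω, ‖noiseMean s ζ γ n ω‖ ^ (2 * j) ∂P ≤ K / (n : ℝ) ^ j := by
  obtain ⟨c, hc⟩ := hs.exists_isSubGaussian_noise hζ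
  obtain ⟨K, hK0, hK⟩ := IsSubGaussian.exists_moment_bound (E := E) c
    (m := 2 * j) (by positivity)
  refine ⟨γ ^ (2 * j) * K, by rw [pow_mul]; positivity, fun n hn => ?_⟩
  have hn' : (0 : ℝ) < n := by exact_mod_cast Nat.pos_of_ne_zero hn
  have hind : iIndepFun (fun k ω => s (ζ k ω) 0) P :=
    hζ.indep.comp (fun _ z => s z 0) fun _ => hs.measurable_zero
  have hsub := IsSubGaussian.normalized_sum (hs.measurable_noise hζ) hind hc hn
  have hmeas : Measurable fun ω => (1 / √(n : ℝ)) • ∑ k ∈ Finset.range n, s (ζ k ω) 0 :=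
    (Finset.measurable_fun_sum _ fun k _ => hs.measurable_noise hζ k).const_smul _
  have heq : ∀ ω, ‖noiseMean s ζ γ n ω‖ ^ (2 * j) = γ ^ (2 * j) / (n : ℝ) ^ j *
      ‖(1 / √(n : ℝ)) • ∑ k ∈ Finset.range n, s (ζ k ω) 0‖ ^ (2 * j) := by
    intro ω
    simp only [noiseMean, norm_smul, mul_pow, Real.norm_eq_abs]
    rw [← mul_assoc]
    congr 1
    rw [pow_mul, pow_mul |1 / √(n : ℝ)|, sq_abs, sq_abs, div_pow, div_pow 1,
      Real.sq_sqrt hn'.le, pow_mul, one_pow, div_pow, div_pow 1, one_pow, ← pow_mul, ← pow_mul]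
    field_simp
    ring
  simp_rw [heq, integral_const_mul]
  have := (hK P _ hmeas hsub).2
  calc _ ≤ γ ^ (2 * j) / (n : ℝ) ^ j * K := by
        have : 0 ≤ γ ^ (2 * j) / (n : ℝ) ^ j := by rw [pow_mul]; positivity
        gcongr
    _ = _ := by ring

end Field

/-! ### Fast decay of a high moment -/

/-- Convexity of the power: raising a contraction with rate `2 x` to the power `m` gives a
contraction with rate of order `m x`, without enlarging the coefficient `x` of the forcing term. -/
theorem pow_convex_combination_le {x a b : ℝ} (hx : 0 ≤ x) (hx1 : x ≤ 1) (ha : 0 ≤ a) (hb : 0 ≤ b)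
    {y : ℝ} (hy : 0 ≤ y) (h : y ≤ (1 - 2 * x) * a + x * b) (m : ℕ) :
    y ^ m ≤ (1 - x) ^ (m + 1) * a ^ m + x * b ^ m := by
  have hx' : 0 ≤ 1 - x := by linarith
  have h1 : y ≤ (1 - x) * ((1 - x) * a) + x * b := by nlinarith [mul_nonneg (sq_nonneg x) ha]
  have h2 := (convexOn_pow (𝕜 := ℝ) m).2 (Set.mem_Ici.2 (mul_nonneg hx' ha)) (Set.mem_Ici.2 hb)
    hx' hx (by ring)
  simp only [smul_eq_mul] at h2
  calc y ^ m ≤ ((1 - x) * ((1 - x) * a) + x * b) ^ m := by gcongr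
    _ ≤ _ := h2
    _ = _ := by rw [mul_pow]; ring

theorem one_sub_pow_le_one_sub {x y : ℝ} {m : ℕ} (hx1 : x ≤ 1) (hy : 0 ≤ y)
    (hy1 : y ≤ 1 / 2) (h : 2 * y ≤ m * x) : (1 - x) ^ m ≤ 1 - y := by
  have h1 : 1 - x ≤ Real.exp (-x) := by have := Real.add_one_le_exp (-x); linarith
  have h2 : (1 - x) ^ m ≤ Real.exp (-(2 * y)) := by
    calc (1 - x) ^ m ≤ Real.exp (-x) ^ m := by gcongr
      _ = Real.exp (-(m * x)) := by rw [← Real.exp_nat_mul]; ring_nf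
      _ ≤ _ := Real.exp_le_exp.2 (by linarith)
  refine h2.trans ?_
  rw [Real.exp_neg]
  have h3 : 1 + 2 * y ≤ Real.exp (2 * y) := by have := Real.add_one_le_exp (2 * y); linarith
  refine (inv_anti₀ (by linarith) h3).trans ?_
  rw [inv_le_iff_one_le_mul₀ (by linarith)]
  nlinarith

theorem integral_le_linear_combination {Ω : Type*} [MeasurableSpace Ω] {P : Measure Ω}
    {f g₁ g₂ g₃ : Ω → ℝ} (hf : Integrable f P) (h₁ : Integrable g₁ P) (h₂ : Integrable g₂ P)
    (h₃ : Integrable g₃ P) {c₁ c₂ c₃ : ℝ} (h : ∀ ω, f ω ≤ c₁ * g₁ ω + c₂ * g₂ ω + c₃ * g₃ ω) :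
    ∫ ω, f ω ∂P ≤ c₁ * ∫ ω, g₁ ω ∂P + c₂ * ∫ ω, g₂ ω ∂P + c₃ * ∫ ω, g₃ ω ∂P := by
  have h12 : Integrable (fun ω => c₁ * g₁ ω + c₂ * g₂ ω) P :=
    (h₁.const_mul c₁).add (h₂.const_mul c₂)
  refine (integral_mono hf (h12.add (h₃.const_mul c₃)) h).trans_eq ?_
  rw [integral_add' h12 (h₃.const_mul c₃), integral_add (h₁.const_mul c₁) (h₂.const_mul c₂),
    integral_const_mul, integral_const_mul, integral_const_mul]

section

variable {E 𝒵 Ω : Type*} [NormedAddCommGroup E] [InnerProductSpace ℝ E] [FiniteDimensional ℝ E]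
  [MeasurableSpace E] [BorelSpace E] [MeasurableSpace 𝒵] [MeasurableSpace Ω]
  {P : Measure Ω} {ρ : Measure 𝒵} {ζ : ℕ → Ω → 𝒵} {s : 𝒵 → E → E} {H : E →L[ℝ] E}
  {L lam γ : ℝ} {e : ℕ → Ω → E}

/-- A short gradient step is a contraction. -/
theorem IsScoreField.norm_add_smul_sub_le (hs : IsScoreField ρ s H L lam) (z : 𝒵) (u v : E) {t : ℝ}
    (ht : 0 ≤ t) (ht1 : t * L ^ 2 ≤ lam) (ht2 : t * lam ≤ 1) :
    ‖(u - v) + t • (s z u - s z v)‖ ≤ (1 - t * lam / 2) * ‖u - v‖ := by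
  have hlam := hs.lam_pos
  refine le_of_sq_le_sq ?_ (mul_nonneg (by linarith) (norm_nonneg _))
  rw [norm_add_sq_real, norm_smul, Real.norm_of_nonneg ht, real_inner_smul_right,
    real_inner_comm, mul_pow, mul_pow]
  have h1 := hs.monotone z u v
  have h2 : ‖s z u - s z v‖ ^ 2 ≤ L ^ 2 * ‖u - v‖ ^ 2 := by
    rw [← mul_pow]; exact pow_le_pow_left₀ (norm_nonneg _) (hs.lipschitz z u v) 2
  have h3 := mul_le_mul_of_nonneg_left h1 ht
  have h4 := mul_le_mul_of_nonneg_left h2 (sq_nonneg t)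
  have h5 := mul_le_mul_of_nonneg_right ht1 (mul_nonneg ht (sq_nonneg ‖u - v‖))
  nlinarith [mul_nonneg (sq_nonneg (t * lam)) (sq_nonneg ‖u - v‖)]

/-- The distance between the recursion and the sample mean of the noise obeys a pathwise
contraction, forced by the sample mean. -/
theorem IsScoreField.exists_pathwise_bound (hs : IsScoreField ρ s H L lam) (hγ : 0 < γ)
    (he : IsPerturbedSGD P ζ s γ e) : ∃ B : ℝ, 0 ≤ B ∧ ∀ᶠ n : ℕ in atTop, ∀ ω,
      ‖e (n + 1) ω - noiseMean s ζ γ (n + 1) ω‖ ≤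
        (1 - 2 * (γ * lam / 8 / (n + 1))) * ‖e n ω - noiseMean s ζ γ n ω‖
        + γ * lam / 8 / (n + 1) * (B * (‖noiseMean s ζ γ n ω‖ + ‖s (ζ n ω) 0‖ / (n + 1))) := by
  obtain ⟨K, hK, hstep⟩ := he.step
  have hlam := hs.lam_pos
  have hL := hs.L_nonneg
  refine ⟨8 / (γ * lam) * (γ * L + 1 + K), by positivity, ?_⟩
  have hlarge : Tendsto (fun n : ℕ => (n : ℝ) + 1) atTop atTop :=
    tendsto_atTop_add_const_right _ _ tendsto_natCast_atTop_atTop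
  filter_upwards [hstep, hlarge.eventually_ge_atTop (γ * L ^ 2 / lam),
    hlarge.eventually_ge_atTop (γ * lam), hlarge.eventually_ge_atTop (4 * K / (γ * lam))]
    with n hn h1 h2 h3 ω
  set N : ℝ := (n : ℝ) + 1
  have hN : 1 ≤ N := by simp [N]
  have hN0 : 0 < N := by linarith
  set l := noiseMean s ζ γ n ω
  set ξ := s (ζ n ω) 0
  have hpath := hn ω
  set rem := e (n + 1) ω - e n ω - (γ / N) • s (ζ n ω) (e n ω)
  have hdec : e (n + 1) ω - noiseMean s ζ γ (n + 1) ω =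
      ((e n ω - l) + (γ / N) • (s (ζ n ω) (e n ω) - s (ζ n ω) l))
      + (γ / N) • (s (ζ n ω) l - ξ) + (1 / N) • l + rem := by
    rw [noiseMean_succ]
    simp only [rem, smul_sub]
    abel
  have hc := hs.norm_add_smul_sub_le (ζ n ω) (e n ω) l (t := γ / N) (by positivity)
    (by rw [div_mul_eq_mul_div, div_le_iff₀ hN0]; rw [div_le_iff₀ hlam] at h1; linarith)
    (by rw [div_mul_eq_mul_div, div_le_one hN0]; exact h2)
  have hl : ‖s (ζ n ω) l - ξ‖ ≤ L * ‖l‖ := by simpa using hs.lipschitz (ζ n ω) l 0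
  have hel : ‖e n ω‖ ≤ ‖e n ω - l‖ + ‖l‖ := by simpa using norm_add_le (e n ω - l) l
  have hKN : K / N ^ 2 ≤ γ * lam / 4 / N := by
    rw [div_le_div_iff₀ (by positivity) hN0]
    rw [div_le_iff₀ (by positivity)] at h3
    nlinarith
  rw [hdec]
  calc _ ≤ ‖(e n ω - l) + (γ / N) • (s (ζ n ω) (e n ω) - s (ζ n ω) l)‖
        + ‖(γ / N) • (s (ζ n ω) l - ξ)‖ + ‖(1 / N) • l‖ + ‖rem‖ := norm_add₄_le
    _ ≤ (1 - γ / N * lam / 2) * ‖e n ω - l‖ + γ / N * (L * ‖l‖) + 1 / N * ‖l‖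
        + (K / N ^ 2 * ‖e n ω - l‖ + (K / N ^ 2 * ‖ξ‖ + K / N ^ 2 * ‖l‖)) := by
      gcongr
      · rw [norm_smul, Real.norm_of_nonneg (by positivity)]; gcongr
      · rw [norm_smul, Real.norm_of_nonneg (by positivity)]
      · refine hpath.trans ?_
        rw [← mul_add, ← mul_add]
        refine mul_le_mul_of_nonneg_left ?_ (by positivity)
        linarith
    _ ≤ (1 - γ / N * lam / 2) * ‖e n ω - l‖ + γ / N * (L * ‖l‖) + 1 / N * ‖l‖
        + (γ * lam / 4 / N * ‖e n ω - l‖ + (K / N ^ 2 * ‖ξ‖ + K / N * ‖l‖)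
          + (γ * L + 1) * ‖ξ‖ / N ^ 2) := by
      have : K / N ^ 2 ≤ K / N := by gcongr; nlinarith
      have h0 : 0 ≤ (γ * L + 1) * ‖ξ‖ / N ^ 2 := by positivity
      have a1 := mul_le_mul_of_nonneg_right this (norm_nonneg l)
      have a2 := mul_le_mul_of_nonneg_right hKN (norm_nonneg (e n ω - l))
      linarith
    _ = _ := by
      field_simp
      ring

/-- Some moment of order larger than two decays faster than `1 / n`. The order grows as the
strong monotonicity constant of the field gets small. -/
theorem IsScoreField.exists_tendsto_moment [IsProbabilityMeasure P]
    (hs : IsScoreField ρ s H L lam) (hγ : 0 < γ) (hζ : IsDataStream P ρ ζ)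
    (he : IsPerturbedSGD P ζ s γ e) : ∃ m : ℕ, 2 < m ∧
      Tendsto (fun n : ℕ => n * ∫ ω, ‖e n ω‖ ^ m ∂P) atTop (𝓝 0) := by
  have hlam := hs.lam_pos
  set κ : ℝ := γ * lam / 8
  have hκ : 0 < κ := by positivity
  -- The rate `(2 j + 1) κ` of the `2 j`-th power has to be at least `4`, to contract by
  -- `1 - 2 / n`.
  obtain ⟨j₀, hj₀⟩ := exists_nat_ge (2 / κ)
  set j := j₀ + 2
  have hj : j ≠ 0 := by simp [j]
  have hjκ : 4 ≤ ((2 * j + 1 : ℕ) : ℝ) * κ := by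
    rw [div_le_iff₀ hκ] at hj₀
    push_cast [j]
    nlinarith
  obtain ⟨B, hB, hpath⟩ := hs.exists_pathwise_bound hγ he
  obtain ⟨K₁, hK₁, hl⟩ := hs.exists_noiseMean_moment_bound (γ := γ) hζ hj
  obtain ⟨K₂, hK₂, hξ⟩ := hs.exists_noise_moment_bound hζ (m := 2 * j) (by positivity)
  have hml : ∀ n, HasMoments (noiseMean s ζ γ n) P := hs.hasMoments_noiseMean hζ
  have hmd : ∀ n, HasMoments (fun ω => e n ω - noiseMean s ζ γ n ω) P :=
    fun n => (he.moments n).sub (hml n)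
  set D : ℕ → ℝ := fun n => ∫ ω, ‖e n ω - noiseMean s ζ γ n ω‖ ^ (2 * j) ∂P
  have hD0 : ∀ n, 0 ≤ D n := fun n => integral_nonneg fun ω => by positivity
  set K₃ : ℝ := κ * (B ^ (2 * j) * (2 ^ (2 * j - 1) * (4 * K₁ + K₂)))
  have hK₃ : 0 ≤ K₃ := by positivity
  have hlarge : Tendsto (fun n : ℕ => (n : ℝ) + 1) atTop atTop :=
    tendsto_atTop_add_const_right _ _ tendsto_natCast_atTop_atTop
  have hrec : ∀ᶠ n : ℕ in atTop,
      D (n + 1) ≤ (1 - 2 / (n + 1)) * D n + K₃ / ((n : ℝ) + 1) ^ 3 := by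
    filter_upwards [hpath, hlarge.eventually_ge_atTop κ, eventually_ge_atTop 4,
      hlarge.eventually_ge_atTop 4] with n hn h1 h2 h3
    set N : ℝ := (n : ℝ) + 1
    have hN0 : 0 < N := by linarith
    have hn0 : (0 : ℝ) < n := by have : (4 : ℝ) ≤ n := (by exact_mod_cast h2); linarith
    have hx1 : κ / N ≤ 1 := (div_le_one hN0).2 h1
    have hpt : ∀ ω, ‖e (n + 1) ω - noiseMean s ζ γ (n + 1) ω‖ ^ (2 * j) ≤
        (1 - 2 / N) * ‖e n ω - noiseMean s ζ γ n ω‖ ^ (2 * j)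
        + κ / N * (B ^ (2 * j) * (2 ^ (2 * j - 1) * (‖noiseMean s ζ γ n ω‖ ^ (2 * j)
          + (1 / N) ^ (2 * j) * ‖s (ζ n ω) 0‖ ^ (2 * j)))) := by
      intro ω
      refine (pow_convex_combination_le (by positivity) hx1 (norm_nonneg _) (by positivity)
        (norm_nonneg _) (hn ω) (2 * j)).trans ?_
      rw [mul_pow B]
      gcongr
      · refine one_sub_pow_le_one_sub hx1 (by positivity) ?_ ?_
        · rw [div_le_div_iff₀ hN0 (by norm_num)]; linarith
        · rw [← mul_div_assoc, ← mul_div_assoc]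
          exact div_le_div_of_nonneg_right (by linarith) hN0.le
      · refine (add_pow_le (norm_nonneg _) (by positivity) _).trans (le_of_eq ?_)
        rw [← mul_pow, div_mul_eq_mul_div, one_mul]
    have i1 := (hmd n).integrable_pow (2 * j)
    have i2 := (hml n).integrable_pow (2 * j)
    have i3 := (hξ n).1
    refine (integral_le_linear_combination ((hmd (n + 1)).integrable_pow (2 * j)) i1 i2 i3
      (c₁ := 1 - 2 / N) (c₂ := κ / N * (B ^ (2 * j) * 2 ^ (2 * j - 1)))
      (c₃ := κ / N * (B ^ (2 * j) * 2 ^ (2 * j - 1)) * (1 / N) ^ (2 * j))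
      fun ω => (hpt ω).trans_eq (by ring)).trans ?_
    rw [add_assoc]
    refine add_le_add le_rfl ?_
    have hl' : ∫ ω, ‖noiseMean s ζ γ n ω‖ ^ (2 * j) ∂P ≤ 4 * K₁ / N ^ 2 := by
      refine (hl n (by omega)).trans ?_
      have : (n : ℝ) ^ 2 ≤ (n : ℝ) ^ j :=
        pow_le_pow_right₀ (by have : (4 : ℝ) ≤ n := (by exact_mod_cast h2); linarith) (by omega)
      calc K₁ / (n : ℝ) ^ j ≤ K₁ / (n : ℝ) ^ 2 := by gcongr
        _ ≤ 4 * K₁ / N ^ 2 := by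
          rw [div_le_div_iff₀ (by positivity) (by positivity)]
          have : N ^ 2 ≤ 4 * (n : ℝ) ^ 2 := by
            have : N ≤ 2 * n := by
              have : (4 : ℝ) ≤ n := (by exact_mod_cast h2)
              simp only [N]; linarith
            nlinarith
          nlinarith
    have hξ' : (1 / N) ^ (2 * j) * ∫ ω, ‖s (ζ n ω) 0‖ ^ (2 * j) ∂P ≤ K₂ / N ^ 2 := by
      have : (1 / N) ^ (2 * j) ≤ (1 / N) ^ 2 :=
        pow_le_pow_of_le_one (by positivity) ((div_le_one hN0).2 (by linarith)) (by omega)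
      calc _ ≤ (1 / N) ^ 2 * K₂ := by
            gcongr
            exact (hξ n).2
        _ = _ := by rw [div_pow]; ring
    calc _ = κ / N * (B ^ (2 * j) * (2 ^ (2 * j - 1) * (∫ ω, ‖noiseMean s ζ γ n ω‖ ^ (2 * j) ∂P
          + (1 / N) ^ (2 * j) * ∫ ω, ‖s (ζ n ω) 0‖ ^ (2 * j) ∂P))) := by ring
      _ ≤ κ / N * (B ^ (2 * j) * (2 ^ (2 * j - 1) * (4 * K₁ / N ^ 2 + K₂ / N ^ 2))) := by
          gcongr
      _ = _ := by simp only [K₃]; field_simp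
  have hDlim : Tendsto (fun n : ℕ => n * D n) atTop (𝓝 0) := by
    refine tendsto_natCast_mul_of_contraction hD0 (a := 2) (by norm_num) fun ε hε => ?_
    filter_upwards [hrec, hlarge.eventually_ge_atTop (K₃ / ε)] with n hn h1
    refine hn.trans ?_
    refine add_le_add le_rfl ?_
    rw [div_le_iff₀ hε] at h1
    rw [div_le_div_iff₀ (by positivity) (by positivity)]
    calc K₃ * ((n : ℝ) + 1) ^ 2 ≤ (((n : ℝ) + 1) * ε) * ((n : ℝ) + 1) ^ 2 := by gcongr
      _ = _ := by ring
  have hllim : Tendsto (fun n : ℕ => n * ∫ ω, ‖noiseMean s ζ γ n ω‖ ^ (2 * j) ∂P)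
      atTop (𝓝 0) := by
    refine squeeze_zero' (Eventually.of_forall fun n => by positivity) ?_
      (tendsto_const_div_atTop_nhds_zero_nat K₁)
    filter_upwards [eventually_ge_atTop 1] with n hn
    have hn0 : (1 : ℝ) ≤ n := by exact_mod_cast hn
    calc _ ≤ (n : ℝ) * (K₁ / (n : ℝ) ^ 2) := by
          gcongr
          refine (hl n (by omega)).trans ?_
          exact div_le_div_of_nonneg_left hK₁ (by positivity)
            (pow_le_pow_right₀ hn0 (by omega))
      _ = _ := by field_simp
  refine ⟨2 * j, by omega, ?_⟩
  refine squeeze_zero (fun n => by positivity) (fun n => ?_)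
    (by simpa using (hDlim.add hllim).const_mul (2 ^ (2 * j - 1)))
  rw [← mul_add, mul_left_comm]
  gcongr
  rw [← integral_add ((hmd n).integrable_pow _) ((hml n).integrable_pow _), ← integral_const_mul]
  refine integral_mono ((he.moments n).integrable_pow _)
    ((((hmd n).integrable_pow _).add ((hml n).integrable_pow _)).const_mul _) fun ω => ?_
  refine (pow_le_pow_left₀ (norm_nonneg _) ?_ _).trans
    (add_pow_le (norm_nonneg (e n ω - noiseMean s ζ γ n ω)) (norm_nonneg _) (2 * j))
  simpa using norm_add_le (e n ω - noiseMean s ζ γ n ω) (noiseMean s ζ γ n ω)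

end

/-! ### The linearized recursion -/

section

variable {E 𝒵 Ω : Type*} [NormedAddCommGroup E] [InnerProductSpace ℝ E] [FiniteDimensional ℝ E]
  [MeasurableSpace E] [BorelSpace E] [MeasurableSpace 𝒵] [MeasurableSpace Ω]
  {P : Measure Ω} {ρ : Measure 𝒵} {ζ : ℕ → Ω → 𝒵} {s : 𝒵 → E → E} {H V : E →L[ℝ] E}
  {L lam γ η : ℝ} {e : ℕ → Ω → E}

/-- The linear recursion `ℓ (n + 1) = (1 - γ / (n + 1) • H) (ℓ n) + γ / (n + 1) • s (ζ n) 0`, driven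
by the noise at the origin and started at the origin. -/
noncomputable def linearSGD (s : 𝒵 → E → E) (ζ : ℕ → Ω → 𝒵) (γ : ℝ) (H : E →L[ℝ] E) : ℕ → Ω → E
  | 0, _ => 0
  | n + 1, ω => (linearSGD s ζ γ H n ω - (γ / ((n : ℝ) + 1)) • H (linearSGD s ζ γ H n ω))
      + (γ / ((n : ℝ) + 1)) • s (ζ n ω) 0

/-- The covariance operators of the linear recursion. -/
noncomputable def linearCov (γ : ℝ) (H : E →L[ℝ] E) : ℕ → (E →L[ℝ] E)
  | 0 => 0
  | n + 1 => (1 - (γ / ((n : ℝ) + 1)) • H) * linearCov γ H n * (1 - (γ / ((n : ℝ) + 1)) • H)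
      + (γ / ((n : ℝ) + 1)) ^ 2 • H

theorem IsScoreField.inner_symm (hs : IsScoreField ρ s H L lam) (a b : E) :
    inner ℝ (H a) b = inner ℝ a (H b) := by
  rw [real_inner_comm, ← hs.second_moment, ← hs.second_moment]
  simp_rw [mul_comm]

theorem eventually_norm_sub_smul_sq_le (hη : 0 < η)
    (hH : ∀ v, (1 + η) * ‖v‖ ^ 2 ≤ 2 * γ * inner ℝ (H v) v) :
    ∀ᶠ n : ℕ in atTop, ∀ v, ‖v - (γ / ((n : ℝ) + 1)) • H v‖ ^ 2
      ≤ (1 - (1 + η / 2) / (n + 1)) * ‖v‖ ^ 2 := by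
  have hlarge : Tendsto (fun n : ℕ => (n : ℝ) + 1) atTop atTop :=
    tendsto_atTop_add_const_right _ _ tendsto_natCast_atTop_atTop
  filter_upwards [hlarge.eventually_ge_atTop (2 * γ ^ 2 * ‖H‖ ^ 2 / η)] with n h1 v
  set N : ℝ := (n : ℝ) + 1
  have hN0 : 0 < N := by positivity
  rw [div_le_iff₀ hη] at h1
  have hHv : ‖H v‖ ^ 2 ≤ ‖H‖ ^ 2 * ‖v‖ ^ 2 := by
    rw [← mul_pow]; exact pow_le_pow_left₀ (norm_nonneg _) (H.le_opNorm v) 2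
  rw [norm_sub_sq_real, real_inner_smul_right, norm_smul, mul_pow, Real.norm_eq_abs, sq_abs,
    real_inner_comm]
  have h2 : 2 * (γ / N * inner ℝ (H v) v) = (2 * γ * inner ℝ (H v) v) / N := by ring
  have h3 : (1 + η) * ‖v‖ ^ 2 / N ≤ (2 * γ * inner ℝ (H v) v) / N :=
    div_le_div_of_nonneg_right (hH v) hN0.le
  have h4 : (γ / N) ^ 2 * ‖H v‖ ^ 2 ≤ (η / 2) * ‖v‖ ^ 2 / N := by
    calc (γ / N) ^ 2 * ‖H v‖ ^ 2 ≤ (γ / N) ^ 2 * (‖H‖ ^ 2 * ‖v‖ ^ 2) := by gcongr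
      _ = (2 * γ ^ 2 * ‖H‖ ^ 2) * ‖v‖ ^ 2 / (2 * N ^ 2) := by field_simp
      _ ≤ (N * η) * ‖v‖ ^ 2 / (2 * N ^ 2) := by gcongr
      _ = _ := by field_simp
  rw [h2]
  have h5 : (1 - (1 + η / 2) / N) * ‖v‖ ^ 2 =
    ‖v‖ ^ 2 - (1 + η) * ‖v‖ ^ 2 / N + (η / 2) * ‖v‖ ^ 2 / N := by field_simp; ring
  linarith

/-- The defect of `V / n` in the recursion for the covariance operators: if `V` solves the Lyapunov
equation, `W - V / n` is conjugated by the contraction, up to an error `O(1 / n³)`. -/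
theorem lyapunov_defect {A : Type*} [Ring A] [Algebra ℝ A] {H V : A}
    (hV : (2 * γ) • (H * V) - V = γ ^ 2 • H) (hcomm : V * H = H * V) {n : ℝ} (hn : 0 < n) (W : A) :
    ((1 - (γ / (n + 1)) • H) * W * (1 - (γ / (n + 1)) • H) + (γ / (n + 1)) ^ 2 • H)
        - (1 / (n + 1)) • V
      = (1 - (γ / (n + 1)) • H) * (W - (1 / n) • V) * (1 - (γ / (n + 1)) • H)
        + (γ ^ 2 / (n * (n + 1) ^ 2)) • (H * V * H - H) := by
  have hV' : V = (2 * γ) • (H * V) - γ ^ 2 • H := by rw [← hV]; abel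
  have key : ((1 : A) - (γ / (n + 1)) • H) * V * (1 - (γ / (n + 1)) • H) =
      V - (2 * γ / (n + 1)) • (H * V) + (γ / (n + 1)) ^ 2 • (H * V * H) := by
    simp only [sub_mul, mul_sub, one_mul, mul_one, smul_mul_assoc, mul_smul_comm, hcomm]
    module
  have hN : n + 1 ≠ 0 := by positivity
  have hn' := hn.ne'
  have split : ∀ T : A, T * (W - (1 / n) • V) * T = T * W * T - (1 / n) • (T * V * T) := fun T => by
    rw [mul_sub, sub_mul, mul_smul_comm, smul_mul_assoc]
  rw [split, key]
  generalize (1 - (γ / (n + 1)) • H) * W * (1 - (γ / (n + 1)) • H) = Q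
  generalize H * V * H = Y
  generalize H * V = X at *
  subst hV'
  match_scalars <;> field_simp <;> ring

/-- The covariance of the linear recursion scales like the solution of the Lyapunov equation. -/
theorem tendsto_smul_linearCov (hη : 0 < η)
    (hH : ∀ v, (1 + η) * ‖v‖ ^ 2 ≤ 2 * γ * inner ℝ (H v) v)
    (hV : (2 * γ) • (H * V) - V = γ ^ 2 • H) (hcomm : V * H = H * V) :
    Tendsto (fun n : ℕ => (n : ℝ) • linearCov γ H n) atTop (𝓝 V) := by
  have hlarge : Tendsto (fun n : ℕ => (n : ℝ) + 1) atTop atTop :=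
    tendsto_atTop_add_const_right _ _ tendsto_natCast_atTop_atTop
  set D : ℕ → ℝ := fun n => ‖linearCov γ H n - (1 / (n : ℝ)) • V‖
  have hD : Tendsto (fun n : ℕ => n * D n) atTop (𝓝 0) := by
    refine tendsto_natCast_mul_of_contraction (fun n => norm_nonneg _)
      (a := 1 + η / 2) (by linarith) fun ε hε => ?_
    filter_upwards [eventually_norm_sub_smul_sq_le hη hH, eventually_ge_atTop 1,
      hlarge.eventually_ge_atTop (1 + η / 2),
      tendsto_natCast_atTop_atTop.eventually_ge_atTop (γ ^ 2 * ‖H * V * H - H‖ / ε)]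
      with n hn hn1 hN1 hn2
    have hn0 : (0 : ℝ) < n := by exact_mod_cast hn1
    set N : ℝ := (n : ℝ) + 1
    have hN0 : 0 < N := by positivity
    set T : E →L[ℝ] E := 1 - (γ / N) • H
    set q : ℝ := 1 - (1 + η / 2) / N
    have hq : 0 ≤ q := by
      have : (1 + η / 2) / N ≤ 1 := (div_le_one hN0).2 hN1
      linarith
    have hT : ‖T‖ ≤ √q := by
      refine T.opNorm_le_bound (Real.sqrt_nonneg _) fun v => ?_
      refine le_of_sq_le_sq ?_ (by positivity)
      rw [mul_pow, Real.sq_sqrt hq]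
      simpa [T] using hn v
    have hrec : linearCov γ H (n + 1) - (1 / ((n + 1 : ℕ) : ℝ)) • V =
        T * (linearCov γ H n - (1 / (n : ℝ)) • V) * T
          + (γ ^ 2 / (n * N ^ 2)) • (H * V * H - H) := by
      rw [linearCov]
      push_cast
      exact lyapunov_defect hV hcomm hn0 _
    calc D (n + 1) = ‖T * (linearCov γ H n - (1 / (n : ℝ)) • V) * T
          + (γ ^ 2 / (n * N ^ 2)) • (H * V * H - H)‖ := by simp only [D]; rw [hrec]
      _ ≤ √q * D n * √q + γ ^ 2 / (n * N ^ 2) * ‖H * V * H - H‖ := by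
        refine (norm_add_le _ _).trans (add_le_add ?_ ?_)
        · refine (norm_mul_le _ _).trans ?_
          gcongr
          refine (norm_mul_le _ _).trans ?_
          gcongr
        · rw [norm_smul, Real.norm_of_nonneg (by positivity)]
      _ = q * D n + (γ ^ 2 * ‖H * V * H - H‖ / n) / N ^ 2 := by
        rw [mul_right_comm, Real.mul_self_sqrt hq]
        field_simp
      _ ≤ q * D n + ε / N ^ 2 := by
        gcongr
        rw [div_le_iff₀ hn0]
        rwa [div_le_iff₀' hε] at hn2
  rw [tendsto_iff_norm_sub_tendsto_zero]
  refine hD.congr' ?_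
  filter_upwards [eventually_ge_atTop 1] with n hn
  have hn0 : (n : ℝ) ≠ 0 := by exact_mod_cast (by omega : n ≠ 0)
  simp only [D]
  rw [← Real.norm_of_nonneg (Nat.cast_nonneg (α := ℝ) n), ← norm_smul, smul_sub, smul_smul]
  simp [hn0]

theorem linearSGD_adapted (hs : IsScoreField ρ s H L lam) (n : ℕ) :
    Measurable[past ζ n] (linearSGD s ζ γ H n) := by
  induction n with
  | zero => exact measurable_const
  | succ n ih =>
    have h1 : Measurable[past ζ (n + 1)] (linearSGD s ζ γ H n) :=
      ih.mono (past_mono ζ n.le_succ) le_rfl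
    have h2 : Measurable[past ζ (n + 1)] fun ω => s (ζ n ω) 0 :=
      hs.measurable_zero.comp (measurable_past_succ ζ n)
    exact (h1.sub ((H.measurable.comp h1).const_smul _)).add (h2.const_smul _)

theorem HasMoments.const_smul {f : Ω → E} (hf : HasMoments f P) (c : ℝ) :
    HasMoments (fun ω => c • f ω) P := fun m => (hf m).const_smul c

theorem HasMoments.clm {f : Ω → E} (hf : HasMoments f P) {F : Type*} [NormedAddCommGroup F]
    [NormedSpace ℝ F] (A : E →L[ℝ] F) :
    HasMoments (fun ω => A (f ω)) P := fun m => A.comp_memLp' (hf m)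

theorem HasMoments.inner {f : Ω → E} (hf : HasMoments f P) (a : E) :
    HasMoments (fun ω => inner ℝ a (f ω)) P := hf.clm (innerSL ℝ a)

theorem linearSGD_hasMoments [IsProbabilityMeasure P] (hs : IsScoreField ρ s H L lam)
    (hζ : IsDataStream P ρ ζ) (n : ℕ) : HasMoments (linearSGD s ζ γ H n) P := by
  induction n with
  | zero => exact hasMoments_const 0
  | succ n ih =>
    exact (ih.sub ((ih.clm H).const_smul _)).add ((hs.hasMoments_noise hζ n).const_smul _)

theorem IsDataStream.isProbabilityMeasure [IsProbabilityMeasure P] (hζ : IsDataStream P ρ ζ) :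
    IsProbabilityMeasure ρ := by
  rw [← hζ.law 0]
  exact Measure.isProbabilityMeasure_map (hζ.measurable 0).aemeasurable

/-- The noise is uncorrelated with the past. -/
theorem IsScoreField.integral_past_mul_noise [IsProbabilityMeasure P]
    (hs : IsScoreField ρ s H L lam) (hζ : IsDataStream P ρ ζ) {n : ℕ} {g : Ω → ℝ}
    (hg : Measurable[past ζ n] g) (hgm : HasMoments g P) (b : E) :
    ∫ ω, g ω * inner ℝ b (s (ζ n ω) 0) ∂P = 0 := by
  have := hζ.isProbabilityMeasure
  have hz := hs.measurable_zero
  rw [hζ.integral_freeze hg (φ := fun x z => x * inner ℝ b (s z 0))]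
  · simp_rw [integral_const_mul, hs.mean_zero]
    simp
  · change Measurable fun q : ℝ × 𝒵 => q.1 * inner ℝ b (s q.2 0)
    fun_prop
  · exact hgm.integrable_mul ((hs.hasMoments_noise hζ n).inner b)

theorem integral_linearSGD [IsProbabilityMeasure P] (hs : IsScoreField ρ s H L lam)
    (hζ : IsDataStream P ρ ζ) (n : ℕ) (a : E) : ∫ ω, inner ℝ a (linearSGD s ζ γ H n ω) ∂P = 0 := by
  induction n generalizing a with
  | zero => simp [linearSGD]
  | succ n ih =>
    have hl := linearSGD_hasMoments (γ := γ) hs hζ n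
    have heq : ∀ ω, inner ℝ a (linearSGD s ζ γ H (n + 1) ω) =
        inner ℝ (a - (γ / ((n : ℝ) + 1)) • H a) (linearSGD s ζ γ H n ω)
          + (γ / ((n : ℝ) + 1)) * inner ℝ a (s (ζ n ω) 0) := by
      intro ω
      simp only [linearSGD, inner_add_right, inner_sub_right, inner_sub_left,
        real_inner_smul_left, real_inner_smul_right, hs.inner_symm]
    have hz : ∫ ω, inner ℝ a (s (ζ n ω) 0) ∂P = 0 := by
      have := hs.measurable_zero
      rw [hζ.integral_comp (φ := fun z => inner ℝ a (s z 0)) (by fun_prop), hs.mean_zero]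
    simp_rw [heq]
    rw [integral_add (hl.inner _).integrable
      (((hs.hasMoments_noise hζ n).inner a).integrable.const_mul _), ih, integral_const_mul, hz]
    simp

/-- `linearCov` is the second moment of the linear recursion. -/
theorem integral_linearSGD_mul [IsProbabilityMeasure P] (hs : IsScoreField ρ s H L lam)
    (hζ : IsDataStream P ρ ζ) (n : ℕ) (a b : E) :
    ∫ ω, inner ℝ a (linearSGD s ζ γ H n ω) * inner ℝ b (linearSGD s ζ γ H n ω) ∂P
      = inner ℝ a (linearCov γ H n b) := by
  induction n generalizing a b with
  | zero => simp [linearSGD, linearCov]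
  | succ n ih =>
    set t : ℝ := γ / ((n : ℝ) + 1)
    set l := linearSGD s ζ γ H n
    have hl : HasMoments l P := linearSGD_hasMoments (γ := γ) hs hζ n
    have hla : Measurable[past ζ n] l := linearSGD_adapted hs n
    have hξ := hs.hasMoments_noise hζ n
    set a' := a - t • H a
    set b' := b - t • H b
    have heq : ∀ ω, inner ℝ a (linearSGD s ζ γ H (n + 1) ω) *
        inner ℝ b (linearSGD s ζ γ H (n + 1) ω) =
        (inner ℝ a' (l ω) * inner ℝ b' (l ω)
          + t * (inner ℝ a' (l ω) * inner ℝ b (s (ζ n ω) 0)))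
        + (t * (inner ℝ b' (l ω) * inner ℝ a (s (ζ n ω) 0))
          + t ^ 2 * (inner ℝ a (s (ζ n ω) 0) * inner ℝ b (s (ζ n ω) 0))) := by
      intro ω
      simp only [linearSGD, inner_add_right, inner_sub_right, inner_sub_left, a', b', l, t,
        real_inner_smul_left, real_inner_smul_right, hs.inner_symm]
      ring
    have hmeas : ∀ c : E, Measurable[past ζ n] fun ω => inner ℝ c (l ω) := fun c =>
      (innerSL ℝ c).measurable.comp hla
    have h1 := hs.integral_past_mul_noise hζ (hmeas a') (hl.inner a') b
    have h2 := hs.integral_past_mul_noise hζ (hmeas b') (hl.inner b') a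
    have h3 : ∫ ω, inner ℝ a (s (ζ n ω) 0) * inner ℝ b (s (ζ n ω) 0) ∂P = inner ℝ a (H b) := by
      have := hs.measurable_zero
      rw [hζ.integral_comp (φ := fun z => inner ℝ a (s z 0) * inner ℝ b (s z 0)) (by fun_prop),
        hs.second_moment]
    have i0 := (hl.inner a').integrable_mul (hl.inner b')
    have i1 := ((hl.inner a').integrable_mul (hξ.inner b)).const_mul t
    have i2 := ((hl.inner b').integrable_mul (hξ.inner a)).const_mul t
    have i3 := ((hξ.inner a).integrable_mul (hξ.inner b)).const_mul (t ^ 2)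
    have i01 : Integrable (fun ω => inner ℝ a' (l ω) * inner ℝ b' (l ω)
        + t * (inner ℝ a' (l ω) * inner ℝ b (s (ζ n ω) 0))) P := i0.add i1
    have i23 : Integrable (fun ω => t * (inner ℝ b' (l ω) * inner ℝ a (s (ζ n ω) 0))
        + t ^ 2 * (inner ℝ a (s (ζ n ω) 0) * inner ℝ b (s (ζ n ω) 0))) P := i2.add i3
    simp_rw [heq]
    rw [integral_add i01 i23, integral_add i0 i1, integral_add i2 i3,
      integral_const_mul, integral_const_mul, integral_const_mul, h1, h2, h3, ih]
    have happ : linearCov γ H (n + 1) b =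
        (linearCov γ H n b' - t • H (linearCov γ H n b')) + t ^ 2 • H b := rfl
    rw [happ]
    simp only [inner_add_right, inner_sub_right, real_inner_smul_right, a', inner_sub_left,
      real_inner_smul_left, hs.inner_symm]
    ring

theorem exists_linearSGD_sq_bound [IsProbabilityMeasure P] (hs : IsScoreField ρ s H L lam)
    (hζ : IsDataStream P ρ ζ) (hV : Tendsto (fun n : ℕ => (n : ℝ) • linearCov γ H n) atTop (𝓝 V)) :
    ∃ Q : ℝ, 0 ≤ Q ∧ ∀ᶠ n : ℕ in atTop, n * ∫ ω, ‖linearSGD s ζ γ H n ω‖ ^ 2 ∂P ≤ Q := by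
  set b := stdOrthonormalBasis ℝ E
  have h1 : ∀ n : ℕ, n * ∫ ω, ‖linearSGD s ζ γ H n ω‖ ^ 2 ∂P =
      ∑ i, inner ℝ (b i) (((n : ℝ) • linearCov γ H n) (b i)) := by
    intro n
    have hl := linearSGD_hasMoments (γ := γ) hs hζ n
    simp_rw [← b.sum_sq_inner_right, sq]
    rw [integral_finsetSum _ fun i _ => (hl.inner (b i)).integrable_mul (hl.inner (b i)),
      Finset.mul_sum]
    refine Finset.sum_congr rfl fun i _ => ?_
    rw [integral_linearSGD_mul hs hζ]
    simp [real_inner_smul_right]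
  have h2 : Tendsto (fun n : ℕ => ∑ i, inner ℝ (b i) (((n : ℝ) • linearCov γ H n) (b i))) atTop
      (𝓝 (∑ i, inner ℝ (b i) (V (b i)))) := by
    refine tendsto_finsetSum _ fun i _ => ?_
    have hc : Continuous fun A : E →L[ℝ] E => inner ℝ (b i) (A (b i)) := by fun_prop
    exact (hc.tendsto V).comp hV
  refine ⟨|∑ i, inner ℝ (b i) (V (b i))| + 1, by positivity, ?_⟩
  filter_upwards [h2.eventually_lt_const (lt_add_one _)] with n hn
  rw [h1]
  linarith [le_abs_self (∑ i, inner ℝ (b i) (V (b i)))]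

end

/-! ### Comparison with the linearized recursion -/

section

variable {E 𝒵 Ω : Type*} [NormedAddCommGroup E] [InnerProductSpace ℝ E] [FiniteDimensional ℝ E]
  [MeasurableSpace E] [BorelSpace E] [MeasurableSpace 𝒵] [MeasurableSpace Ω]
  {P : Measure Ω} {ρ : Measure 𝒵} {ζ : ℕ → Ω → 𝒵} {s : 𝒵 → E → E} {H V : E →L[ℝ] E}
  {L lam γ η : ℝ} {e : ℕ → Ω → E}

/-- The remainder of the mean field after linearization at the origin. -/
noncomputable def meanRemainder (ρ : Measure 𝒵) (s : 𝒵 → E → E) (H : E →L[ℝ] E) (u : E) : E :=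
  (∫ z, s z u ∂ρ) + H u

theorem IsScoreField.norm_le (hs : IsScoreField ρ s H L lam) (z : 𝒵) (u : E) :
    ‖s z u‖ ≤ ‖s z 0‖ + L * ‖u‖ := by
  have h1 := hs.lipschitz z u 0
  have h2 := norm_add_le (s z u - s z 0) (s z 0)
  simp only [sub_add_cancel, sub_zero] at h1 h2
  linarith

theorem IsScoreField.integrable_zero (hs : IsScoreField ρ s H L lam) :
    Integrable (fun z => s z 0) ρ := by
  obtain ⟨c, hc⟩ := hs.subGaussian
  obtain ⟨K, -, hK⟩ := IsSubGaussian.exists_moment_bound (E := E) c (m := 1) (by norm_num)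
  have := (hK ρ _ hs.measurable_zero hc).1
  simp only [pow_one] at this
  exact (integrable_norm_iff hs.measurable_zero.aestronglyMeasurable).1 this

theorem IsScoreField.measurable_apply (hs : IsScoreField ρ s H L lam) (u : E) :
    Measurable fun z => s z u := hs.measurable.comp (by fun_prop : Measurable fun z => (z, u))

theorem IsScoreField.integrable_apply [IsFiniteMeasure ρ] (hs : IsScoreField ρ s H L lam) (u : E) :
    Integrable (fun z => s z u) ρ :=
  (hs.integrable_zero.norm.add (integrable_const (L * ‖u‖))).mono'
    (hs.measurable_apply u).aestronglyMeasurable (Eventually.of_forall fun z => hs.norm_le z u)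

theorem IsScoreField.integral_zero (hs : IsScoreField ρ s H L lam) : ∫ z, s z 0 ∂ρ = 0 := by
  refine ext_inner_left ℝ fun a => ?_
  rw [← integral_inner hs.integrable_zero, hs.mean_zero, inner_zero_right]

theorem IsScoreField.norm_meanRemainder_le [IsProbabilityMeasure ρ]
    (hs : IsScoreField ρ s H L lam) (u : E) :
    ‖meanRemainder ρ s H u‖ ≤ (L + ‖H‖) * ‖u‖ := by
  have h1 : ∫ z, s z u ∂ρ = ∫ z, (s z u - s z 0) ∂ρ := by
    rw [integral_sub (hs.integrable_apply u) hs.integrable_zero, hs.integral_zero, sub_zero]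
  rw [meanRemainder, h1, add_mul]
  refine (norm_add_le _ _).trans (add_le_add ?_ (H.le_opNorm u))
  simpa using norm_integral_le_of_norm_le_const (μ := ρ)
    (Eventually.of_forall fun z => (hs.lipschitz z u 0).trans_eq (by rw [sub_zero]))

theorem IsScoreField.measurable_meanRemainder [SFinite ρ] (hs : IsScoreField ρ s H L lam) :
    Measurable (meanRemainder ρ s H) := by
  refine Measurable.add ?_ H.measurable
  exact (StronglyMeasurable.integral_prod_left' (f := fun q : 𝒵 × E => s q.1 q.2)
    hs.measurable.stronglyMeasurable).measurable

/-- The remainder is quadratically small relative to `‖u‖²` near the origin, and any higher power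
of `‖u‖` dominates it away from the origin. -/
theorem IsScoreField.exists_meanRemainder_sq_le [IsProbabilityMeasure ρ]
    (hs : IsScoreField ρ s H L lam) {m : ℕ} (hm : 2 < m) {ε : ℝ} (hε : 0 < ε) :
    ∃ K : ℝ, 0 ≤ K ∧ ∀ u, ‖meanRemainder ρ s H u‖ ^ 2 ≤ ε * ‖u‖ ^ 2 + K * ‖u‖ ^ m := by
  have h1 := hs.drift.def (c := √ε) (by positivity)
  obtain ⟨r, hr, hball⟩ := Metric.eventually_nhds_iff.1 h1
  have hL := hs.L_nonneg
  set M := L + ‖H‖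
  have hM : 0 ≤ M := by positivity
  refine ⟨M ^ 2 / r ^ (m - 2), by positivity, fun u => ?_⟩
  by_cases hu : ‖u‖ < r
  · have := hball (y := u) (by simpa using hu)
    calc ‖meanRemainder ρ s H u‖ ^ 2 ≤ (√ε * ‖u‖) ^ 2 := by gcongr; exact this
      _ = ε * ‖u‖ ^ 2 := by rw [mul_pow, Real.sq_sqrt hε.le]
      _ ≤ _ := le_add_of_nonneg_right (by positivity)
  · push Not at hu
    calc ‖meanRemainder ρ s H u‖ ^ 2 ≤ (M * ‖u‖) ^ 2 := by
          gcongr; exact hs.norm_meanRemainder_le u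
      _ = M ^ 2 / r ^ (m - 2) * (‖u‖ ^ 2 * r ^ (m - 2)) := by field_simp
      _ ≤ M ^ 2 / r ^ (m - 2) * (‖u‖ ^ 2 * ‖u‖ ^ (m - 2)) := by gcongr
      _ = M ^ 2 / r ^ (m - 2) * ‖u‖ ^ m := by rw [← pow_add]; congr 2; omega
      _ ≤ _ := le_add_of_nonneg_left (by positivity)

/-- Given the past, the linearization error of a step can be replaced by its mean. -/
theorem IsScoreField.integral_inner_linearization [IsProbabilityMeasure P]
    (hs : IsScoreField ρ s H L lam) (hζ : IsDataStream P ρ ζ) {n : ℕ} {g u : Ω → E}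
    (hg : Measurable[past ζ n] g) (hu : Measurable[past ζ n] u)
    (hgm : HasMoments g P) (hum : HasMoments u P) :
    Integrable (fun ω => inner ℝ (g ω) (s (ζ n ω) (u ω) - s (ζ n ω) 0 + H (u ω))) P ∧
    Integrable (fun ω => inner ℝ (g ω) (meanRemainder ρ s H (u ω))) P ∧
    ∫ ω, inner ℝ (g ω) (s (ζ n ω) (u ω) - s (ζ n ω) 0 + H (u ω)) ∂P
      = ∫ ω, inner ℝ (g ω) (meanRemainder ρ s H (u ω)) ∂P := by
  have := hζ.isProbabilityMeasure
  have hgm' : Measurable g := hg.mono (hζ.past_le n) le_rfl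
  have hum' : Measurable u := hu.mono (hζ.past_le n) le_rfl
  have hz := hs.measurable_zero
  have hsm := hs.measurable
  have hdom : Integrable (fun ω => ‖g ω‖ * ((L + ‖H‖) * ‖u ω‖)) P := by
    have := (hgm.norm.integrable_mul hum.norm).const_mul (L + ‖H‖)
    refine this.congr (Eventually.of_forall fun ω => ?_)
    ring
  have hφ : Measurable fun q : (E × E) × 𝒵 =>
      inner ℝ q.1.1 (s q.2 q.1.2 - s q.2 0 + H q.1.2) := by
    have h1 : Measurable fun q : (E × E) × 𝒵 => s q.2 q.1.2 :=
      hsm.comp (by fun_prop : Measurable fun q : (E × E) × 𝒵 => (q.2, q.1.2))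
    fun_prop
  have hint : Integrable
      (fun ω => inner ℝ (g ω) (s (ζ n ω) (u ω) - s (ζ n ω) 0 + H (u ω))) P := by
    refine hdom.mono' ?_ (Eventually.of_forall fun ω => ?_)
    · have := hζ.measurable n
      exact (hφ.comp (by fun_prop : Measurable fun ω => ((g ω, u ω), ζ n ω))).aestronglyMeasurable
    · refine (norm_inner_le_norm _ _).trans ?_
      gcongr
      refine (norm_add_le _ _).trans ?_
      rw [add_mul]
      refine add_le_add ?_ (H.le_opNorm _)
      simpa using hs.lipschitz (ζ n ω) (u ω) 0
  refine ⟨hint, ?_, ?_⟩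
  · refine hdom.mono' ?_ (Eventually.of_forall fun ω => ?_)
    · have := hs.measurable_meanRemainder
      fun_prop
    · refine (norm_inner_le_norm _ _).trans ?_
      gcongr
      exact hs.norm_meanRemainder_le _
  · rw [hζ.integral_freeze (hg.prodMk hu) (φ := fun q z => inner ℝ q.1 (s z q.2 - s z 0 + H q.2))
      hφ hint]
    refine integral_congr_ae (Eventually.of_forall fun ω => ?_)
    simp only
    have i1 : Integrable (fun z => s z (u ω) - s z 0) ρ :=
      (hs.integrable_apply (u ω)).sub hs.integrable_zero
    have i2 : Integrable (fun z => s z (u ω) - s z 0 + H (u ω)) ρ := i1.add (integrable_const _)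
    rw [integral_inner i2, integral_add i1 (integrable_const _)]
    rw [integral_sub (hs.integrable_apply (u ω)) hs.integrable_zero, hs.integral_zero, sub_zero,
      integral_const]
    simp [meanRemainder]

/-- Pathwise estimate for one step of the difference `d = e - ℓ` of the recursion and its
linearization: here `c` is the contracted difference, `g` the linearization error and `r` the
perturbation. -/
theorem norm_sq_step_le {c g r : E} {t x y w M K N τ : ℝ} (hx : ‖c‖ ≤ x) (hg : ‖g‖ ≤ M * y)
    (hw : 0 ≤ w) (hy : 0 ≤ y) (hM : 0 ≤ M) (hK : 0 ≤ K) (ht : 0 ≤ t) (hτ : 0 < τ) (hN : 1 ≤ N)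
    (hr : ‖r‖ ≤ K / N ^ 2 * (w + y)) :
    ‖c + t • g + r‖ ^ 2 ≤ ‖c‖ ^ 2 + 2 * t * inner ℝ c g + τ / N * x ^ 2
      + (2 * t ^ 2 * M ^ 2 + (2 * K ^ 2 / τ + 4 * K ^ 2) / N ^ 2) * y ^ 2
      + (2 * K ^ 2 / τ + 4 * K ^ 2) / N ^ 3 * w ^ 2 := by
  have hN0 : 0 < N := by linarith
  have hx0 : 0 ≤ x := (norm_nonneg c).trans hx
  set R : ℝ := K / N ^ 2 * (w + y)
  have hR : 0 ≤ R := by positivity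
  have e1 : ‖c + t • g‖ ^ 2 = ‖c‖ ^ 2 + 2 * t * inner ℝ c g + t ^ 2 * ‖g‖ ^ 2 := by
    rw [norm_add_sq_real, real_inner_smul_right, norm_smul, mul_pow, Real.norm_eq_abs, sq_abs]
    ring
  have e2 : ‖c + t • g‖ ≤ x + t * (M * y) := by
    refine (norm_add_le _ _).trans (add_le_add hx ?_)
    rw [norm_smul, Real.norm_of_nonneg ht]
    gcongr
  have e3 : ‖c + t • g + r‖ ^ 2 ≤ ‖c + t • g‖ ^ 2 + 2 * ((x + t * (M * y)) * R) + R ^ 2 := by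
    rw [norm_add_sq_real]
    have h1 : inner ℝ (c + t • g) r ≤ (x + t * (M * y)) * R :=
      (real_inner_le_norm _ _).trans (by gcongr)
    have h2 : ‖r‖ ^ 2 ≤ R ^ 2 := by gcongr
    linarith
  have e4 : ‖g‖ ^ 2 ≤ M ^ 2 * y ^ 2 := by rw [← mul_pow]; gcongr
  have e5 : 2 * (x * R) ≤ τ / N * x ^ 2 + N / τ * R ^ 2 := by
    have := sq_nonneg (τ * x - N * R)
    rw [div_mul_eq_mul_div, div_mul_eq_mul_div, div_add_div _ _ hN0.ne' hτ.ne',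
      le_div_iff₀ (by positivity)]
    nlinarith
  have e6 : 2 * (t * (M * y) * R) ≤ t ^ 2 * M ^ 2 * y ^ 2 + R ^ 2 := by
    nlinarith [sq_nonneg (t * M * y - R)]
  have hwy : (w + y) ^ 2 ≤ 2 * w ^ 2 + 2 * y ^ 2 := by nlinarith [sq_nonneg (w - y)]
  have e7 : R ^ 2 ≤ K ^ 2 / N ^ 3 * (2 * w ^ 2 + 2 * y ^ 2) := by
    have : R ^ 2 = K ^ 2 / N ^ 4 * (w + y) ^ 2 := by simp only [R]; rw [mul_pow, div_pow]; ring
    rw [this]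
    gcongr
    norm_num
  have e8 : N / τ * R ^ 2 ≤ K ^ 2 / τ / N ^ 3 * (2 * w ^ 2 + 2 * y ^ 2) := by
    have : N / τ * R ^ 2 = K ^ 2 / τ / N ^ 3 * (w + y) ^ 2 := by
      simp only [R]; field_simp
    rw [this]
    gcongr
  have e9 : 1 / N ^ 3 ≤ 1 / N ^ 2 := by
    gcongr
    norm_num
  have e10 : t ^ 2 * ‖g‖ ^ 2 ≤ t ^ 2 * (M ^ 2 * y ^ 2) := by gcongr
  have e11 : (2 * K ^ 2 / τ + 4 * K ^ 2) * y ^ 2 * (1 / N ^ 3)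
      ≤ (2 * K ^ 2 / τ + 4 * K ^ 2) * y ^ 2 * (1 / N ^ 2) := by gcongr
  calc _ ≤ ‖c‖ ^ 2 + 2 * t * inner ℝ c g + t ^ 2 * (M ^ 2 * y ^ 2) + (τ / N * x ^ 2
        + K ^ 2 / τ / N ^ 3 * (2 * w ^ 2 + 2 * y ^ 2)) + (t ^ 2 * M ^ 2 * y ^ 2)
        + 2 * (K ^ 2 / N ^ 3 * (2 * w ^ 2 + 2 * y ^ 2)) := by
        rw [e1] at e3; linarith
    _ = ‖c‖ ^ 2 + 2 * t * inner ℝ c g + τ / N * x ^ 2 + 2 * t ^ 2 * M ^ 2 * y ^ 2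
        + (2 * K ^ 2 / τ + 4 * K ^ 2) * y ^ 2 * (1 / N ^ 3)
        + (2 * K ^ 2 / τ + 4 * K ^ 2) / N ^ 3 * w ^ 2 := by field_simp; ring
    _ ≤ ‖c‖ ^ 2 + 2 * t * inner ℝ c g + τ / N * x ^ 2 + 2 * t ^ 2 * M ^ 2 * y ^ 2
        + (2 * K ^ 2 / τ + 4 * K ^ 2) * y ^ 2 * (1 / N ^ 2)
        + (2 * K ^ 2 / τ + 4 * K ^ 2) / N ^ 3 * w ^ 2 := by linarith
    _ = _ := by ring

/-- One step of the mean square difference between the recursion and its linearization. -/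
theorem IsScoreField.integral_norm_sub_linearSGD_succ_le [IsProbabilityMeasure P]
    (hs : IsScoreField ρ s H L lam) (hγ : 0 < γ) (hη : 0 < η)
    (hζ : IsDataStream P ρ ζ) (he : IsPerturbedSGD P ζ s γ e) {K N τ σ B : ℝ} (hK : 0 ≤ K)
    (hτ : 0 < τ) {n m : ℕ} (hN : N = (n : ℝ) + 1) (hqN : 1 + η / 2 ≤ N)
    (hstep : ∀ ω, ‖e (n + 1) ω - e n ω - (γ / N) • s (ζ n ω) (e n ω)‖
      ≤ K / N ^ 2 * (‖s (ζ n ω) 0‖ + ‖e n ω‖))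
    (hcontr : ∀ v, ‖v - (γ / N) • H v‖ ^ 2 ≤ (1 - (1 + η / 2) / N) * ‖v‖ ^ 2)
    (hσ : 0 ≤ σ)
    (hrem : ∀ u, ‖meanRemainder ρ s H u‖ ^ 2
      ≤ τ * σ / (2 * γ ^ 2) * ‖u‖ ^ 2 + τ * B / γ ^ 2 * ‖u‖ ^ m)
    (hlarge : 2 * (2 * γ ^ 2 * (L + ‖H‖) ^ 2 + (2 * K ^ 2 / τ + 4 * K ^ 2)) ≤ σ * N) :
    ∫ ω, ‖e (n + 1) ω - linearSGD s ζ γ H (n + 1) ω‖ ^ 2 ∂P ≤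
      (1 - (1 + η / 2) / N + 2 * τ / N + 2 * σ / N) *
        ∫ ω, ‖e n ω - linearSGD s ζ γ H n ω‖ ^ 2 ∂P
      + 2 * σ / N * ∫ ω, ‖linearSGD s ζ γ H n ω‖ ^ 2 ∂P
      + B / N * ∫ ω, ‖e n ω‖ ^ m ∂P
      + (2 * K ^ 2 / τ + 4 * K ^ 2) / N ^ 3 * ∫ ω, ‖s (ζ n ω) 0‖ ^ 2 ∂P := by
  have hL := hs.L_nonneg
  have := hζ.isProbabilityMeasure
  set M := L + ‖H‖
  have hM : 0 ≤ M := by positivity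
  set A := 2 * K ^ 2 / τ + 4 * K ^ 2
  have hA : 0 ≤ A := by positivity
  have hN1 : 1 ≤ N := by linarith
  have hN0 : 0 < N := by linarith
  set l := linearSGD s ζ γ H n with hl
  set d : Ω → E := fun ω => e n ω - l ω with hd
  set c : Ω → E := fun ω => d ω - (γ / N) • H (d ω) with hc
  set q := 1 - (1 + η / 2) / N
  have hq1 : q ≤ 1 := by
    have : 0 ≤ (1 + η / 2) / N := by positivity
    simp only [q]; linarith
  have hlm : HasMoments l P := linearSGD_hasMoments hs hζ n
  have hem : HasMoments (e n) P := he.moments n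
  have hdm : HasMoments d P := hem.sub hlm
  have hcm : HasMoments c P := hdm.sub ((hdm.clm H).const_smul _)
  have hξm := hs.hasMoments_noise hζ n
  have hdad : Measurable[past ζ n] d := (he.adapted n).sub (linearSGD_adapted hs n)
  have hcad : Measurable[past ζ n] c :=
    hdad.sub (((H.measurable.comp hdad)).const_smul (γ / N))
  have hcd : ∀ ω, ‖c ω‖ ≤ ‖d ω‖ := fun ω => by
    refine le_of_sq_le_sq ((hcontr (d ω)).trans ?_) (norm_nonneg _)
    exact mul_le_of_le_one_left (by positivity) hq1
  have hed : ∀ ω, ‖e n ω‖ ^ 2 ≤ 2 * ‖d ω‖ ^ 2 + 2 * ‖l ω‖ ^ 2 := fun ω => by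
    have h1 : ‖e n ω‖ ≤ ‖d ω‖ + ‖l ω‖ := by simpa [hd] using norm_add_le (d ω) (l ω)
    have h2 : ‖e n ω‖ ^ 2 ≤ (‖d ω‖ + ‖l ω‖) ^ 2 := by gcongr
    nlinarith [sq_nonneg (‖d ω‖ - ‖l ω‖)]
  obtain ⟨ig, ir, hfreeze⟩ := hs.integral_inner_linearization hζ hcad (he.adapted n) hcm hem
  have id2 := hdm.integrable_pow 2
  have il2 := hlm.integrable_pow 2
  have iem := hem.integrable_pow m
  have iξ2 := hξm.integrable_pow 2
  have hpt : ∀ ω, ‖e (n + 1) ω - linearSGD s ζ γ H (n + 1) ω‖ ^ 2 ≤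
      1 * ((q + τ / N + σ / N) * ‖d ω‖ ^ 2 + σ / N * ‖l ω‖ ^ 2)
      + 2 * (γ / N) * inner ℝ (c ω) (s (ζ n ω) (e n ω) - s (ζ n ω) 0 + H (e n ω))
      + A / N ^ 3 * ‖s (ζ n ω) 0‖ ^ 2 := by
    intro ω
    have hdec : e (n + 1) ω - linearSGD s ζ γ H (n + 1) ω =
        c ω + (γ / N) • (s (ζ n ω) (e n ω) - s (ζ n ω) 0 + H (e n ω))
          + (e (n + 1) ω - e n ω - (γ / N) • s (ζ n ω) (e n ω)) := by
      simp only [linearSGD, hc, hd, ← hl, map_sub, smul_sub, smul_add, ← hN]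
      abel
    have hg : ‖s (ζ n ω) (e n ω) - s (ζ n ω) 0 + H (e n ω)‖ ≤ M * ‖e n ω‖ := by
      refine (norm_add_le _ _).trans ?_
      rw [add_mul]
      refine add_le_add ?_ (H.le_opNorm _)
      simpa using hs.lipschitz (ζ n ω) (e n ω) 0
    rw [hdec]
    refine (norm_sq_step_le (hcd ω) hg (norm_nonneg _) (norm_nonneg _) hM hK (by positivity) hτ hN1
      (hstep ω)).trans ?_
    have h1 := hcontr (d ω)
    have h2 : (2 * (γ / N) ^ 2 * M ^ 2 + A / N ^ 2) * ‖e n ω‖ ^ 2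
        ≤ σ / N * ‖d ω‖ ^ 2 + σ / N * ‖l ω‖ ^ 2 := by
      calc _ = (2 * (2 * γ ^ 2 * M ^ 2 + A)) / N ^ 2 * (‖e n ω‖ ^ 2 / 2) := by field_simp
        _ ≤ (σ * N) / N ^ 2 * ((2 * ‖d ω‖ ^ 2 + 2 * ‖l ω‖ ^ 2) / 2) := by
          gcongr
          exact hed ω
        _ = _ := by field_simp
    calc _ ≤ q * ‖d ω‖ ^ 2
          + 2 * (γ / N) * inner ℝ (c ω) (s (ζ n ω) (e n ω) - s (ζ n ω) 0 + H (e n ω))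
          + τ / N * ‖d ω‖ ^ 2 + (σ / N * ‖d ω‖ ^ 2 + σ / N * ‖l ω‖ ^ 2)
          + A / N ^ 3 * ‖s (ζ n ω) 0‖ ^ 2 := by
          gcongr
      _ = _ := by ring
  have hint1 := integral_le_linear_combination ((((he.moments (n + 1)).sub
    (linearSGD_hasMoments hs hζ (n + 1)))).integrable_pow 2)
    ((id2.const_mul (q + τ / N + σ / N)).add (il2.const_mul (σ / N))) ig iξ2 hpt
  have hsplit : ∫ ω, ((q + τ / N + σ / N) * ‖d ω‖ ^ 2 + σ / N * ‖l ω‖ ^ 2) ∂P =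
      (q + τ / N + σ / N) * ∫ ω, ‖d ω‖ ^ 2 ∂P + σ / N * ∫ ω, ‖l ω‖ ^ 2 ∂P := by
    rw [integral_add (id2.const_mul _) (il2.const_mul _), integral_const_mul, integral_const_mul]
  have hpt2 : ∀ ω, 2 * (γ / N) * inner ℝ (c ω) (meanRemainder ρ s H (e n ω)) ≤
      (τ / N + σ / N) * ‖d ω‖ ^ 2 + σ / N * ‖l ω‖ ^ 2 + B / N * ‖e n ω‖ ^ m := by
    intro ω
    set r := meanRemainder ρ s H (e n ω)
    have h1 : inner ℝ (c ω) r ≤ ‖d ω‖ * ‖r‖ :=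
      (real_inner_le_norm _ _).trans (by gcongr; exact hcd ω)
    have h2 : 2 * γ * (‖d ω‖ * ‖r‖) ≤ τ * ‖d ω‖ ^ 2 + γ ^ 2 / τ * ‖r‖ ^ 2 := by
      have := sq_nonneg (τ * ‖d ω‖ - γ * ‖r‖)
      rw [div_mul_eq_mul_div, ← sub_le_iff_le_add', le_div_iff₀ hτ]
      nlinarith
    have h3 : γ ^ 2 / τ * ‖r‖ ^ 2 ≤ σ / 2 * ‖e n ω‖ ^ 2 + B * ‖e n ω‖ ^ m := by
      calc _ ≤ γ ^ 2 / τ * (τ * σ / (2 * γ ^ 2) * ‖e n ω‖ ^ 2 + τ * B / γ ^ 2 * ‖e n ω‖ ^ m) := by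
            gcongr; exact hrem _
        _ = _ := by field_simp
    have h4 : σ / 2 * ‖e n ω‖ ^ 2 ≤ σ / 2 * (2 * ‖d ω‖ ^ 2 + 2 * ‖l ω‖ ^ 2) := by
      gcongr; exact hed ω
    calc _ = (2 * γ * inner ℝ (c ω) r) / N := by ring
      _ ≤ (2 * γ * (‖d ω‖ * ‖r‖)) / N := by gcongr
      _ ≤ (τ * ‖d ω‖ ^ 2 + (σ / 2 * (2 * ‖d ω‖ ^ 2 + 2 * ‖l ω‖ ^ 2) + B * ‖e n ω‖ ^ m)) / N := by
        gcongr; linarith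
      _ = _ := by ring
  have hint2 := integral_le_linear_combination (ir.const_mul (2 * (γ / N))) id2 il2 iem hpt2
  rw [integral_const_mul, ← hfreeze] at hint2
  simp only [Pi.add_apply] at hint1
  rw [hsplit] at hint1
  calc _ ≤ _ := hint1
    _ ≤ 1 * ((q + τ / N + σ / N) * ∫ ω, ‖d ω‖ ^ 2 ∂P + σ / N * ∫ ω, ‖l ω‖ ^ 2 ∂P)
        + ((τ / N + σ / N) * ∫ ω, ‖d ω‖ ^ 2 ∂P + σ / N * ∫ ω, ‖l ω‖ ^ 2 ∂P
          + B / N * ∫ ω, ‖e n ω‖ ^ m ∂P)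
        + A / N ^ 3 * ∫ ω, ‖s (ζ n ω) 0‖ ^ 2 ∂P := by gcongr
    _ = _ := by ring

/-- The recursion and its linearization differ by `o(1 / n)` in mean square. -/
theorem IsScoreField.tendsto_norm_sub_linearSGD [IsProbabilityMeasure P]
    (hs : IsScoreField ρ s H L lam) (hγ : 0 < γ) (hη : 0 < η)
    (hH : ∀ v, (1 + η) * ‖v‖ ^ 2 ≤ 2 * γ * inner ℝ (H v) v)
    (hV : Tendsto (fun n : ℕ => (n : ℝ) • linearCov γ H n) atTop (𝓝 V))
    (hζ : IsDataStream P ρ ζ) (he : IsPerturbedSGD P ζ s γ e) :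
    Tendsto (fun n : ℕ => n * ∫ ω, ‖e n ω - linearSGD s ζ γ H n ω‖ ^ 2 ∂P) atTop (𝓝 0) := by
  have := hζ.isProbabilityMeasure
  obtain ⟨K, hK, hstep⟩ := he.step
  obtain ⟨m, hm, hmom⟩ := hs.exists_tendsto_moment hγ hζ he
  obtain ⟨Q, hQ, hlin⟩ := exists_linearSGD_sq_bound hs hζ hV
  obtain ⟨X, hX, hnoise⟩ := hs.exists_noise_moment_bound hζ (m := 2) (by norm_num)
  refine tendsto_natCast_mul_of_contraction (fun n => integral_nonneg fun ω => by positivity)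
    (a := 1 + η / 4) (by linarith) fun ε hε => ?_
  -- The errors `2 τ / n + 2 σ / n` have to fit between the rates `1 + η / 2` and `1 + η / 4`.
  set τ := η / 32 with hτdef
  have hτ : 0 < τ := by positivity
  set σ := min τ (ε / (16 * (Q + 1)))
  have hσ : 0 < σ := by positivity
  have hστ : σ ≤ τ := min_le_left _ _
  have hσQ : 4 * σ * Q ≤ ε / 4 := by
    have : σ ≤ ε / (16 * (Q + 1)) := min_le_right _ _
    rw [le_div_iff₀ (by positivity)] at this
    nlinarith
  obtain ⟨B', hB', hrem⟩ := hs.exists_meanRemainder_sq_le hm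
    (ε := τ * σ / (2 * γ ^ 2)) (by positivity)
  set B := B' * γ ^ 2 / τ
  have hB : 0 ≤ B := by positivity
  have hBB : τ * B / γ ^ 2 = B' := by simp only [B]; field_simp
  have hlarge : Tendsto (fun n : ℕ => (n : ℝ) + 1) atTop atTop :=
    tendsto_atTop_add_const_right _ _ tendsto_natCast_atTop_atTop
  set A := 2 * K ^ 2 / τ + 4 * K ^ 2
  have hA : 0 ≤ A := by positivity
  filter_upwards [hstep, hlin, eventually_norm_sub_smul_sq_le hη hH, eventually_ge_atTop 1,
    hlarge.eventually_ge_atTop (1 + η / 2), hlarge.eventually_ge_atTop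
      (2 * (2 * γ ^ 2 * (L + ‖H‖) ^ 2 + A) / σ),
    hlarge.eventually_ge_atTop (4 * A * X / ε),
    hmom.eventually_le_const (show 0 < ε / (8 * (B + 1)) by positivity)]
    with n h1 h2 h3 h4 h5 h6 h7 h8
  have hn1 : (1 : ℝ) ≤ n := by exact_mod_cast h4
  have hn0 : (0 : ℝ) < n := by linarith
  set N : ℝ := (n : ℝ) + 1 with hN
  have hN0 : 0 < N := by positivity
  have hNn : N ≤ 2 * n := by linarith
  rw [div_le_iff₀ hσ] at h6
  rw [div_le_iff₀ hε] at h7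
  refine (hs.integral_norm_sub_linearSGD_succ_le hγ hη hζ he hK hτ hN h5 h1 h3 hσ.le
    (B := B) (m := m) (by simpa only [hBB] using hrem) (by linarith)).trans ?_
  set D := ∫ ω, ‖e n ω - linearSGD s ζ γ H n ω‖ ^ 2 ∂P
  have hD : 0 ≤ D := integral_nonneg fun ω => by positivity
  set EL := ∫ ω, ‖linearSGD s ζ γ H n ω‖ ^ 2 ∂P
  set EM := ∫ ω, ‖e n ω‖ ^ m ∂P
  have hEL0 : 0 ≤ EL := integral_nonneg fun ω => by positivity
  have hEM0 : 0 ≤ EM := integral_nonneg fun ω => by positivity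
  set EX := ∫ ω, ‖s (ζ n ω) 0‖ ^ 2 ∂P
  have hEX : EX ≤ X := (hnoise n).2
  have hc : 1 - (1 + η / 2) / N + 2 * τ / N + 2 * σ / N ≤ 1 - (1 + η / 4) / N := by
    have : (1 + η / 4) / N + 2 * τ / N + 2 * σ / N ≤ (1 + η / 2) / N := by
      rw [← add_div, ← add_div]
      exact div_le_div_of_nonneg_right (by linarith) hN0.le
    linarith
  have t1 : 2 * σ / N * EL ≤ ε / 4 / N ^ 2 := by
    have hEL : N * EL ≤ 2 * Q := by nlinarith
    calc 2 * σ / N * EL = 2 * σ * (N * EL) / N ^ 2 := by field_simp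
      _ ≤ 2 * σ * (2 * Q) / N ^ 2 := by gcongr
      _ ≤ ε / 4 / N ^ 2 := by gcongr; linarith
  have t2 : B / N * EM ≤ ε / 4 / N ^ 2 := by
    have hEM : N * EM ≤ 2 * (ε / (8 * (B + 1))) := by nlinarith
    calc B / N * EM = B * (N * EM) / N ^ 2 := by field_simp
      _ ≤ B * (2 * (ε / (8 * (B + 1)))) / N ^ 2 := by gcongr
      _ = (B / (B + 1)) * (ε / 4) / N ^ 2 := by field_simp; ring
      _ ≤ 1 * (ε / 4) / N ^ 2 := by
        gcongr
        rw [div_le_one (by positivity)]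
        linarith
      _ = _ := by ring
  have t3 : A / N ^ 3 * EX ≤ ε / 4 / N ^ 2 := by
    calc A / N ^ 3 * EX ≤ A / N ^ 3 * X := by gcongr
      _ = (4 * A * X) / (4 * N) / N ^ 2 := by field_simp
      _ ≤ (N * ε) / (4 * N) / N ^ 2 := by gcongr
      _ = _ := by field_simp
  have t0 := mul_le_mul_of_nonneg_right hc hD
  have t4 : ε / N ^ 2 = 4 * (ε / 4 / N ^ 2) := by ring
  have t5 : 0 ≤ ε / 4 / N ^ 2 := by positivity
  linarith

/-- The asymptotic covariance of a perturbed stochastic gradient recursion: `V` is the solution of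
the Lyapunov equation `γ (H V + V H) - V = γ² H`. -/
theorem IsScoreField.tendsto_covariance [IsProbabilityMeasure P]
    (hs : IsScoreField ρ s H L lam) (hγ : 0 < γ) (hη : 0 < η)
    (hH : ∀ v, (1 + η) * ‖v‖ ^ 2 ≤ 2 * γ * inner ℝ (H v) v)
    (hV : (2 * γ) • (H * V) - V = γ ^ 2 • H) (hcomm : V * H = H * V)
    (hζ : IsDataStream P ρ ζ) (he : IsPerturbedSGD P ζ s γ e) (a b : E) :
    Tendsto (fun n : ℕ => n * cov[fun ω => inner ℝ a (e n ω), fun ω => inner ℝ b (e n ω); P])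
      atTop (𝓝 (inner ℝ a (V b))) := by
  have hV' := tendsto_smul_linearCov hη hH hV hcomm
  have hD := hs.tendsto_norm_sub_linearSGD hγ hη hH hV' hζ he
  obtain ⟨Q, hQ, hlin⟩ := exists_linearSGD_sq_bound hs hζ hV'
  have hlim : Tendsto (fun n : ℕ => n * inner ℝ a (linearCov γ H n b)) atTop
      (𝓝 (inner ℝ a (V b))) := by
    have hc : Continuous fun A : E →L[ℝ] E => inner ℝ a (A b) := by fun_prop
    refine ((hc.tendsto V).comp hV').congr fun n => ?_
    simp [real_inner_smul_right]
  set C := ‖a‖ * ‖b‖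
  have hC : 0 ≤ C := by positivity
  have key : ∀ (n : ℕ) (σ : ℝ), 0 < σ →
      |cov[fun ω => inner ℝ a (e n ω), fun ω => inner ℝ b (e n ω); P]
        - inner ℝ a (linearCov γ H n b)| ≤
      C * ((2 + 1 / σ) * ∫ ω, ‖e n ω - linearSGD s ζ γ H n ω‖ ^ 2 ∂P
        + σ * ∫ ω, ‖linearSGD s ζ γ H n ω‖ ^ 2 ∂P) := by
    intro n σ hσ
    set l := linearSGD s ζ γ H n
    have hl : HasMoments l P := linearSGD_hasMoments hs hζ n
    have hem := he.moments n
    have hd : HasMoments (fun ω => e n ω - l ω) P := hem.sub hl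
    have hmean : ∀ c : E, |∫ ω, inner ℝ c (e n ω) ∂P| ≤ ‖c‖ * ∫ ω, ‖e n ω - l ω‖ ∂P := by
      intro c
      have h1 : ∫ ω, inner ℝ c (e n ω) ∂P = ∫ ω, inner ℝ c (e n ω - l ω) ∂P := by
        simp_rw [inner_sub_right]
        rw [integral_sub (hem.inner c).integrable (hl.inner c).integrable,
          integral_linearSGD hs hζ, sub_zero]
      rw [h1, ← integral_const_mul]
      refine abs_integral_le_integral_abs.trans (integral_mono (hd.inner c).integrable.abs
        (hd.norm.integrable.const_mul _) fun ω => abs_real_inner_le_norm _ _)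
    have hsq : (∫ ω, ‖e n ω - l ω‖ ∂P) ^ 2 ≤ ∫ ω, ‖e n ω - l ω‖ ^ 2 ∂P := by
      have h1 := variance_eq_sub (μ := P) (X := fun ω => ‖e n ω - l ω‖) (by simpa using hd.norm 2)
      have h2 := variance_nonneg (fun ω => ‖e n ω - l ω‖) P
      rw [h1] at h2
      simp only [Pi.pow_apply] at h2
      linarith
    have i1 := (hem.inner a).integrable_mul (hem.inner b)
    have i2 := (hl.inner a).integrable_mul (hl.inner b)
    rw [covariance_eq_sub (by simpa using (hem.inner a) 2) (by simpa using (hem.inner b) 2),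
      ← integral_linearSGD_mul hs hζ]
    simp only [Pi.mul_apply]
    have hdiff : |∫ ω, inner ℝ a (e n ω) * inner ℝ b (e n ω) ∂P
        - ∫ ω, inner ℝ a (l ω) * inner ℝ b (l ω) ∂P| ≤
        C * ((1 + 1 / σ) * ∫ ω, ‖e n ω - l ω‖ ^ 2 ∂P + σ * ∫ ω, ‖l ω‖ ^ 2 ∂P) := by
      have j1 := (hd.integrable_pow 2).const_mul (1 + 1 / σ)
      have j2 := (hl.integrable_pow 2).const_mul σ
      rw [← integral_sub i1 i2, ← integral_const_mul, ← integral_const_mul, ← integral_add j1 j2,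
        ← integral_const_mul]
      refine abs_integral_le_integral_abs.trans (integral_mono (i1.sub i2).abs
        ((j1.add j2).const_mul _) fun ω => ?_)
      set x := e n ω - l ω with hx
      have hex : e n ω = l ω + x := by rw [hx]; abel
      beta_reduce
      rw [hex, inner_add_right, inner_add_right]
      have h1 := abs_real_inner_le_norm a (l ω)
      have h2 := abs_real_inner_le_norm b (l ω)
      have h3 := abs_real_inner_le_norm a x
      have h4 := abs_real_inner_le_norm b x
      have e1 : |inner ℝ a (l ω) * inner ℝ b x| ≤ (‖a‖ * ‖l ω‖) * (‖b‖ * ‖x‖) := by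
        rw [abs_mul]; gcongr
      have e2 : |inner ℝ a x * inner ℝ b (l ω)| ≤ (‖a‖ * ‖x‖) * (‖b‖ * ‖l ω‖) := by
        rw [abs_mul]; gcongr
      have e3 : |inner ℝ a x * inner ℝ b x| ≤ (‖a‖ * ‖x‖) * (‖b‖ * ‖x‖) := by
        rw [abs_mul]; gcongr
      have e4 : 2 * (‖l ω‖ * ‖x‖) ≤ 1 / σ * ‖x‖ ^ 2 + σ * ‖l ω‖ ^ 2 := by
        have := sq_nonneg (σ * ‖l ω‖ - ‖x‖)
        rw [div_mul_eq_mul_div, one_mul, ← sub_le_iff_le_add, le_div_iff₀ hσ]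
        nlinarith
      calc _ = |inner ℝ a (l ω) * inner ℝ b x + inner ℝ a x * inner ℝ b (l ω)
            + inner ℝ a x * inner ℝ b x| := by congr 1; ring
        _ ≤ (‖a‖ * ‖l ω‖) * (‖b‖ * ‖x‖) + (‖a‖ * ‖x‖) * (‖b‖ * ‖l ω‖)
            + (‖a‖ * ‖x‖) * (‖b‖ * ‖x‖) :=
          (abs_add_three _ _ _).trans (add_le_add (add_le_add e1 e2) e3)
        _ = C * (2 * (‖l ω‖ * ‖x‖) + ‖x‖ ^ 2) := by simp only [C]; ring
        _ ≤ C * ((1 / σ * ‖x‖ ^ 2 + σ * ‖l ω‖ ^ 2) + ‖x‖ ^ 2) := by gcongr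
        _ = _ := by ring
    have hprod : |(∫ ω, inner ℝ a (e n ω) ∂P) * ∫ ω, inner ℝ b (e n ω) ∂P| ≤
        C * ∫ ω, ‖e n ω - l ω‖ ^ 2 ∂P := by
      rw [abs_mul]
      calc _ ≤ (‖a‖ * ∫ ω, ‖e n ω - l ω‖ ∂P) * (‖b‖ * ∫ ω, ‖e n ω - l ω‖ ∂P) := by
            gcongr
            · exact hmean a
            · exact hmean b
        _ = C * (∫ ω, ‖e n ω - l ω‖ ∂P) ^ 2 := by simp only [C]; ring
        _ ≤ _ := by gcongr
    rw [sub_right_comm]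
    refine (abs_sub _ _).trans ((add_le_add hdiff hprod).trans_eq ?_)
    ring
  have hzero : Tendsto (fun n : ℕ => n * cov[fun ω => inner ℝ a (e n ω),
      fun ω => inner ℝ b (e n ω); P] - n * inner ℝ a (linearCov γ H n b)) atTop (𝓝 0) := by
    rw [Metric.tendsto_atTop']
    intro ε hε
    set σ := ε / (2 * (C * Q + 1))
    have hσ : 0 < σ := by positivity
    have hlim' := hD.const_mul (C * (2 + 1 / σ))
    rw [mul_zero] at hlim'
    have hev := (hlim'.eventually_lt_const (half_pos hε)).and hlin
    obtain ⟨n₀, hn₀⟩ := eventually_atTop.1 hev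
    refine ⟨n₀, fun n hn => ?_⟩
    obtain ⟨h1, h2⟩ := hn₀ n hn.le
    rw [dist_zero_right, Real.norm_eq_abs, ← mul_sub, abs_mul, Nat.abs_cast]
    have hσ2 : C * (σ * Q) ≤ ε / 2 := by
      have : σ * (2 * (C * Q + 1)) = ε := by simp only [σ]; field_simp
      nlinarith
    calc _ ≤ (n : ℝ) * (C * ((2 + 1 / σ) * ∫ ω, ‖e n ω - linearSGD s ζ γ H n ω‖ ^ 2 ∂P
        + σ * ∫ ω, ‖linearSGD s ζ γ H n ω‖ ^ 2 ∂P)) := by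
          gcongr
          exact key n σ hσ
      _ = C * (2 + 1 / σ) * (n * ∫ ω, ‖e n ω - linearSGD s ζ γ H n ω‖ ^ 2 ∂P)
        + C * (σ * (n * ∫ ω, ‖linearSGD s ζ γ H n ω‖ ^ 2 ∂P)) := by ring
      _ ≤ C * (2 + 1 / σ) * (n * ∫ ω, ‖e n ω - linearSGD s ζ γ H n ω‖ ^ 2 ∂P)
        + C * (σ * Q) := by gcongr
      _ < ε := by linarith
  simpa using hzero.add hlim

end

/-! ### Scores of regular likelihoods -/

section

variable {E 𝒵 : Type*} [NormedAddCommGroup E] [InnerProductSpace ℝ E] [FiniteDimensional ℝ E]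
  [MeasurableSpace E] [BorelSpace E] [MeasurableSpace 𝒵]

theorem IsSubGaussian.integrable_exp_norm {Ω : Type*} [MeasurableSpace Ω] {P : Measure Ω}
    [IsFiniteMeasure P] {W : Ω → E} (hW : Measurable W) {c : ℝ} (h : IsSubGaussian P W c) {R : ℝ}
    (hR : 0 ≤ R) : Integrable (fun ω => Real.exp (R * ‖W ω‖)) P := by
  set b := stdOrthonormalBasis ℝ E
  set k : ℝ := (Module.finrank ℝ E : ℝ)
  have hk : 0 ≤ k := by positivity
  have hint : Integrable (fun ω => 1 + ∑ i, (Real.exp (inner ℝ ((R * k) • b i) (W ω))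
      + Real.exp (inner ℝ (-((R * k) • b i)) (W ω)))) P :=
    (integrable_const _).add (integrable_finsetSum _ fun i _ => (h _).1.add (h _).1)
  refine hint.mono' (by fun_prop) (Eventually.of_forall fun ω => ?_)
  rw [Real.norm_of_nonneg (Real.exp_pos _).le]
  set v := W ω
  have h1 : ‖v‖ ≤ ∑ i, |inner ℝ (b i) v| := by
    refine le_of_sq_le_sq ?_ (Finset.sum_nonneg fun i _ => abs_nonneg _)
    rw [← b.sum_sq_inner_right v]
    simp_rw [← sq_abs (inner ℝ (b _) v)]
    exact Finset.sum_sq_le_sq_sum_of_nonneg fun i _ => abs_nonneg _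
  have hpos : ∀ i, 0 ≤ Real.exp (inner ℝ ((R * k) • b i) v)
      + Real.exp (inner ℝ (-((R * k) • b i)) v) := fun i => by positivity
  rcases isEmpty_or_nonempty (Fin (Module.finrank ℝ E)) with hE | hE
  · simp only [Finset.univ_eq_empty, Finset.sum_empty] at h1
    have : ‖v‖ = 0 := le_antisymm h1 (norm_nonneg _)
    simp [this]
  · obtain ⟨i, -, hi⟩ := Finset.exists_max_image Finset.univ (fun i => |inner ℝ (b i) v|)
      Finset.univ_nonempty
    have h2 : ‖v‖ ≤ k * |inner ℝ (b i) v| := by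
      refine h1.trans ((Finset.sum_le_card_nsmul _ _ _ hi).trans_eq ?_)
      simp [k]
    have h3 : Real.exp (R * ‖v‖) ≤ Real.exp (inner ℝ ((R * k) • b i) v)
        + Real.exp (inner ℝ (-((R * k) • b i)) v) := by
      rw [inner_neg_left, real_inner_smul_left]
      have h4 : R * ‖v‖ ≤ R * k * |inner ℝ (b i) v| := by
        rw [mul_assoc]; gcongr
      refine (Real.exp_le_exp.2 h4).trans ?_
      rcases abs_cases (inner ℝ (b i) v) with ⟨h, _⟩ | ⟨h, _⟩ <;> rw [h]
      · linarith [Real.exp_pos (-(R * k * inner ℝ (b i) v))]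
      · rw [mul_neg]; linarith [Real.exp_pos (R * k * inner ℝ (b i) v)]
    have h5 := Finset.single_le_sum (fun i _ => hpos i) (Finset.mem_univ i)
    linarith

/-- A regular log-likelihood `ℓ z u` with score `S z u`, for data of law `ρ`, the true parameter
being the origin: `exp (ℓ z u - ℓ z 0)` is the density ratio between the parameters `u` and `0`,
whence `integral_ratio`. Regularity is required at every data point. -/
structure IsLogLikelihood (ρ : Measure 𝒵) (ℓ : 𝒵 → E → ℝ) (S : 𝒵 → E → E) (L lam : ℝ) : Prop where
  measurable : ∀ u, Measurable fun z => ℓ z u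
  hasGradientAt : ∀ z u, HasGradientAt (ℓ z) (S z u) u
  differentiable : ∀ z, Differentiable ℝ (S z)
  L_nonneg : 0 ≤ L
  lam_pos : 0 < lam
  lipschitz : ∀ z u v, ‖S z u - S z v‖ ≤ L * ‖u - v‖
  monotone : ∀ z u v, inner ℝ (S z u - S z v) (u - v) ≤ -lam * ‖u - v‖ ^ 2
  integral_ratio : ∀ u, ∫⁻ z, ENNReal.ofReal (Real.exp (ℓ z u - ℓ z 0)) ∂ρ = 1

variable {ρ : Measure 𝒵} {ℓ : 𝒵 → E → ℝ} {S : 𝒵 → E → E} {L lam : ℝ}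

namespace IsLogLikelihood

theorem hasDerivAt_line (h : IsLogLikelihood ρ ℓ S L lam) (z : 𝒵) (u w : E) (t : ℝ) :
    HasDerivAt (fun t : ℝ => ℓ z (u + t • w)) (inner ℝ (S z (u + t • w)) w) t := by
  have h1 : HasDerivAt (fun t : ℝ => u + t • w) w t := by
    simpa using ((hasDerivAt_id t).smul_const w).const_add u
  have h2 := (h.hasGradientAt z (u + t • w)).hasFDerivAt.comp_hasDerivAt t h1
  simpa [Function.comp_def] using! h2

/-- The score is measurable in the data, as a limit of difference quotients. -/
theorem measurable_inner_score (h : IsLogLikelihood ρ ℓ S L lam) (u w : E) :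
    Measurable fun z => inner ℝ (S z u) w := by
  have hlim : ∀ z, Tendsto
      (fun n : ℕ => ((n : ℝ) + 1) * (ℓ z (u + (1 / ((n : ℝ) + 1)) • w) - ℓ z u)) atTop
      (𝓝 (inner ℝ (S z u) w)) := by
    intro z
    have h1 := (h.hasDerivAt_line z u w 0).tendsto_slope_zero
    simp only [zero_add, zero_smul, add_zero, smul_eq_mul] at h1
    have h2 : Tendsto (fun n : ℕ => 1 / ((n : ℝ) + 1)) atTop (𝓝[≠] 0) :=
      tendsto_nhdsWithin_iff.2 ⟨tendsto_one_div_add_atTop_nhds_zero_nat,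
        Eventually.of_forall fun n => by
          simp only [Set.mem_compl_iff, Set.mem_singleton_iff]; positivity⟩
    refine (h1.comp h2).congr fun n => ?_
    simp
  refine measurable_of_tendsto_metrizable (fun n => ?_) (tendsto_pi_nhds.2 hlim)
  have := h.measurable
  fun_prop

theorem measurable_score_apply (h : IsLogLikelihood ρ ℓ S L lam) (u : E) :
    Measurable fun z => S z u := by
  have heq : (fun z => S z u) = fun z => ∑ i, (inner ℝ (S z u) (stdOrthonormalBasis ℝ E i)) •
      stdOrthonormalBasis ℝ E i := by
    ext1 z
    have hc : ∀ i, inner ℝ (S z u) (stdOrthonormalBasis ℝ E i)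
        = inner ℝ (stdOrthonormalBasis ℝ E i) (S z u) := fun i => real_inner_comm _ _
    simp_rw [hc]
    exact ((stdOrthonormalBasis ℝ E).sum_repr' (S z u)).symm
  rw [heq]
  exact Finset.measurable_fun_sum _ fun i _ => (h.measurable_inner_score u _).smul_const _

theorem continuous_score (h : IsLogLikelihood ρ ℓ S L lam) (z : 𝒵) : Continuous (S z) :=
  (h.differentiable z).continuous

theorem measurable_score (h : IsLogLikelihood ρ ℓ S L lam) :
    Measurable (Function.uncurry S) := by
  have := measurable_uncurry_of_continuous_of_measurable (u := fun u z => S z u)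
    h.continuous_score h.measurable_score_apply
  exact this.comp measurable_swap

theorem exists_mean_value (h : IsLogLikelihood ρ ℓ S L lam) (z : 𝒵) (u : E) :
    ∃ t ∈ Set.Ioo (0 : ℝ) 1, ℓ z u - ℓ z 0 = inner ℝ (S z (t • u)) u := by
  obtain ⟨t, ht, hts⟩ := exists_hasDerivAt_eq_slope (fun t : ℝ => ℓ z (0 + t • u))
    (fun t => inner ℝ (S z (0 + t • u)) u) one_pos
    (continuous_iff_continuousAt.2 fun t => (h.hasDerivAt_line z 0 u t).continuousAt).continuousOn
    fun t _ => h.hasDerivAt_line z 0 u t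
  refine ⟨t, ht, ?_⟩
  simpa using hts.symm

theorem sub_le_inner (h : IsLogLikelihood ρ ℓ S L lam) (z : 𝒵) (u : E) :
    ℓ z u - ℓ z 0 ≤ inner ℝ (S z 0) u := by
  obtain ⟨t, ht, hts⟩ := h.exists_mean_value z u
  have h1 := h.monotone z (t • u) 0
  rw [sub_zero, real_inner_smul_right, inner_sub_left] at h1
  have h2 : t * (inner ℝ (S z (t • u)) u - inner ℝ (S z 0) u) ≤ 0 :=
    h1.trans (by have := h.lam_pos; nlinarith [mul_nonneg this.le (sq_nonneg ‖t • u‖)])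
  have h3 : inner ℝ (S z (t • u)) u - inner ℝ (S z 0) u ≤ 0 := by
    by_contra! hcon
    nlinarith [mul_pos ht.1 hcon]
  linarith

theorem inner_sub_le (h : IsLogLikelihood ρ ℓ S L lam) (z : 𝒵) (u : E) :
    inner ℝ (S z 0) u - L * ‖u‖ ^ 2 ≤ ℓ z u - ℓ z 0 := by
  obtain ⟨t, ht, hts⟩ := h.exists_mean_value z u
  have h1 := h.lipschitz z (t • u) 0
  rw [sub_zero, norm_smul, Real.norm_of_nonneg ht.1.le] at h1
  have h2 : |inner ℝ (S z (t • u) - S z 0) u| ≤ L * ‖u‖ ^ 2 := by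
    refine (abs_real_inner_le_norm _ _).trans ?_
    have h3 : L * (t * ‖u‖) ≤ L * (1 * ‖u‖) := by
      have := h.L_nonneg
      gcongr
      exact ht.2.le
    calc _ ≤ L * (t * ‖u‖) * ‖u‖ := by gcongr
      _ ≤ L * (1 * ‖u‖) * ‖u‖ := by gcongr
      _ = _ := by ring
  rw [inner_sub_left] at h2
  have := (abs_le.1 h2).1
  linarith

theorem integrable_ratio (h : IsLogLikelihood ρ ℓ S L lam) (u : E) :
    Integrable (fun z => Real.exp (ℓ z u - ℓ z 0)) ρ := by
  have hm := h.measurable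
  refine ⟨by fun_prop, ?_⟩
  rw [hasFiniteIntegral_iff_ofReal (Eventually.of_forall fun z => (Real.exp_pos _).le),
    h.integral_ratio]
  exact ENNReal.one_lt_top

theorem integral_ratio_eq_one (h : IsLogLikelihood ρ ℓ S L lam) (u : E) :
    ∫ z, Real.exp (ℓ z u - ℓ z 0) ∂ρ = 1 := by
  rw [integral_eq_lintegral_of_nonneg_ae (Eventually.of_forall fun z => (Real.exp_pos _).le)
    (h.integrable_ratio u).1, h.integral_ratio]
  rfl

/-- Lipschitz continuity of the score bounds the density ratio from below by
`exp (⟨S, u⟩ - L ‖u‖²)`; as the ratio integrates to one, the score is sub-Gaussian. -/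
theorem isSubGaussian (h : IsLogLikelihood ρ ℓ S L lam) :
    IsSubGaussian ρ (fun z => S z 0) L := by
  intro a
  have hle : ∀ z, Real.exp (inner ℝ a (S z 0)) ≤
      Real.exp (L * ‖a‖ ^ 2) * Real.exp (ℓ z a - ℓ z 0) := by
    intro z
    rw [← Real.exp_add]
    refine Real.exp_le_exp.2 ?_
    have := h.inner_sub_le z a
    rw [real_inner_comm]
    linarith
  have hint := (h.integrable_ratio a).const_mul (Real.exp (L * ‖a‖ ^ 2))
  have hint' : Integrable (fun z => Real.exp (inner ℝ a (S z 0))) ρ := by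
    refine hint.mono' ?_ (Eventually.of_forall fun z => ?_)
    · have := h.measurable_score_apply 0
      fun_prop
    · rw [Real.norm_of_nonneg (Real.exp_pos _).le]
      exact hle z
  refine ⟨hint', (integral_mono hint' hint hle).trans_eq ?_⟩
  rw [integral_const_mul, h.integral_ratio_eq_one, mul_one]

theorem norm_score_le (h : IsLogLikelihood ρ ℓ S L lam) (z : 𝒵) {u : E} {R : ℝ} (hu : ‖u‖ ≤ R) :
    ‖S z u‖ ≤ (1 + L * R) * Real.exp ‖S z 0‖ := by
  have hL := h.L_nonneg
  have hR : 0 ≤ R := (norm_nonneg u).trans hu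
  have h1 := h.lipschitz z u 0
  have h2 := norm_add_le (S z u - S z 0) (S z 0)
  simp only [sub_add_cancel, sub_zero] at h1 h2
  have h3 : ‖S z 0‖ + 1 ≤ Real.exp ‖S z 0‖ := Real.add_one_le_exp _
  have h4 : L * ‖u‖ ≤ L * R := by gcongr
  have h5 : 0 ≤ L * R := by positivity
  nlinarith [norm_nonneg (S z 0)]

theorem ratio_le (h : IsLogLikelihood ρ ℓ S L lam) (z : 𝒵) {u : E} {R : ℝ} (hu : ‖u‖ ≤ R) :
    Real.exp (ℓ z u - ℓ z 0) ≤ Real.exp (R * ‖S z 0‖) := by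
  refine Real.exp_le_exp.2 ((h.sub_le_inner z u).trans ((real_inner_le_norm _ _).trans ?_))
  rw [mul_comm]
  gcongr

theorem hasDerivAt_ratio (h : IsLogLikelihood ρ ℓ S L lam) (z : 𝒵) (u w : E) (t : ℝ) :
    HasDerivAt (fun t : ℝ => Real.exp (ℓ z (u + t • w) - ℓ z 0))
      (Real.exp (ℓ z (u + t • w) - ℓ z 0) * inner ℝ (S z (u + t • w)) w) t :=
  ((h.hasDerivAt_line z u w t).sub_const _).exp

theorem norm_add_smul_le {u w : E} {t : ℝ} (ht : t ∈ Metric.ball (0 : ℝ) 1) :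
    ‖u + t • w‖ ≤ ‖u‖ + ‖w‖ := by
  have : ‖t‖ ≤ 1 := by simpa using (Metric.mem_ball.1 ht).le
  refine (norm_add_le _ _).trans ?_
  rw [norm_smul]
  nlinarith [norm_nonneg w]

/-- The score identity at the parameter `u`, integrated against the law of the parameter `0`. -/
theorem integral_ratio_mul_score [IsFiniteMeasure ρ] (h : IsLogLikelihood ρ ℓ S L lam) (u w : E) :
    Integrable (fun z => Real.exp (ℓ z u - ℓ z 0) * inner ℝ (S z u) w) ρ ∧
    ∫ z, Real.exp (ℓ z u - ℓ z 0) * inner ℝ (S z u) w ∂ρ = 0 := by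
  set R := ‖u‖ + ‖w‖
  have hR : 0 ≤ R := by positivity
  have hm := h.measurable
  have hbound := (h.isSubGaussian.integrable_exp_norm (h.measurable_score_apply 0)
    (show 0 ≤ R + 1 by positivity)).const_mul ((1 + L * R) * ‖w‖)
  have key := hasDerivAt_integral_of_dominated_loc_of_deriv_le (μ := ρ) (𝕜 := ℝ)
    (F := fun t z => Real.exp (ℓ z (u + t • w) - ℓ z 0))
    (F' := fun t z => Real.exp (ℓ z (u + t • w) - ℓ z 0) * inner ℝ (S z (u + t • w)) w)
    (x₀ := 0) (Metric.ball_mem_nhds 0 one_pos)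
    (Eventually.of_forall fun t => (h.integrable_ratio _).1)
    (h.integrable_ratio _)
    (by have := h.measurable_inner_score (u + (0 : ℝ) • w) w; fun_prop)
    (Eventually.of_forall fun z t ht => by
      have h1 : ‖u + t • w‖ ≤ R := norm_add_smul_le ht
      have h2 := h.ratio_le z h1
      calc ‖Real.exp (ℓ z (u + t • w) - ℓ z 0) * inner ℝ (S z (u + t • w)) w‖
          ≤ Real.exp (R * ‖S z 0‖) * (((1 + L * R) * Real.exp ‖S z 0‖) * ‖w‖) := by
            rw [norm_mul, Real.norm_of_nonneg (Real.exp_pos _).le]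
            gcongr
            exact (norm_inner_le_norm _ _).trans (by gcongr; exact h.norm_score_le z h1)
        _ = (1 + L * R) * ‖w‖ * Real.exp ((R + 1) * ‖S z 0‖) := by
            rw [add_mul R, one_mul, Real.exp_add]; ring)
    hbound (Eventually.of_forall fun z t _ => h.hasDerivAt_ratio z u w t)
  simp only [h.integral_ratio_eq_one, zero_smul, add_zero] at key
  exact ⟨key.1, key.2.unique (hasDerivAt_const _ _)⟩

theorem hasDerivAt_score_line (h : IsLogLikelihood ρ ℓ S L lam) (z : 𝒵) (v : E) (t : ℝ) :
    HasDerivAt (fun t : ℝ => S z (t • v)) (fderiv ℝ (S z) (t • v) v) t := by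
  have h1 : HasDerivAt (fun t : ℝ => t • v) v t := by
    simpa using (hasDerivAt_id t).smul_const v
  exact ((h.differentiable z) (t • v)).hasFDerivAt.comp_hasDerivAt t h1

theorem measurable_fderiv_score (h : IsLogLikelihood ρ ℓ S L lam) (v : E) :
    Measurable fun z => fderiv ℝ (S z) 0 v := by
  have hlim : ∀ z, Tendsto (fun n : ℕ => ((n : ℝ) + 1) • (S z ((1 / ((n : ℝ) + 1)) • v) - S z 0))
      atTop (𝓝 (fderiv ℝ (S z) 0 v)) := by
    intro z
    have h1 := (h.hasDerivAt_score_line z v 0).tendsto_slope_zero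
    simp only [zero_add, zero_smul] at h1
    have h2 : Tendsto (fun n : ℕ => 1 / ((n : ℝ) + 1)) atTop (𝓝[≠] 0) :=
      tendsto_nhdsWithin_iff.2 ⟨tendsto_one_div_add_atTop_nhds_zero_nat,
        Eventually.of_forall fun n => by
          simp only [Set.mem_compl_iff, Set.mem_singleton_iff]; positivity⟩
    refine (h1.comp h2).congr fun n => ?_
    simp
  refine measurable_of_tendsto_metrizable (fun n => ?_) (tendsto_pi_nhds.2 hlim)
  have := h.measurable_score_apply
  fun_prop

theorem norm_fderiv_score_le (h : IsLogLikelihood ρ ℓ S L lam) (z : 𝒵) (u v : E) :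
    ‖fderiv ℝ (S z) u v‖ ≤ L * ‖v‖ := by
  have hlip : LipschitzWith ⟨L, h.L_nonneg⟩ (S z) :=
    LipschitzWith.of_dist_le_mul fun x y => by
      rw [dist_eq_norm, dist_eq_norm]; exact h.lipschitz z x y
  exact (fderiv ℝ (S z) u).le_of_opNorm_le (norm_fderiv_le_of_lipschitz ℝ hlip) v

/-- The Fisher information identity: differentiating the score identity once more shows that the
mean Hessian of the log-likelihood is the opposite of the second moment of the score. -/
theorem integral_fderiv_score [IsFiniteMeasure ρ] (h : IsLogLikelihood ρ ℓ S L lam) (v w : E) :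
    ∫ z, inner ℝ (fderiv ℝ (S z) 0 v) w ∂ρ = -∫ z, inner ℝ v (S z 0) * inner ℝ w (S z 0) ∂ρ := by
  set R := ‖v‖
  have hR : 0 ≤ R := by positivity
  have hL := h.L_nonneg
  have hm := h.measurable
  have hbound := (h.isSubGaussian.integrable_exp_norm (h.measurable_score_apply 0)
    (show 0 ≤ R + 2 by positivity)).const_mul (((1 + L * R) ^ 2 + L) * ‖v‖ * ‖w‖)
  have key := hasDerivAt_integral_of_dominated_loc_of_deriv_le (μ := ρ) (𝕜 := ℝ)
    (F := fun t z => Real.exp (ℓ z (t • v) - ℓ z 0) * inner ℝ (S z (t • v)) w)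
    (F' := fun t z => Real.exp (ℓ z (t • v) - ℓ z 0) * inner ℝ (S z (t • v)) v
        * inner ℝ (S z (t • v)) w
      + Real.exp (ℓ z (t • v) - ℓ z 0) * inner ℝ (fderiv ℝ (S z) (t • v) v) w)
    (x₀ := 0) (Metric.ball_mem_nhds 0 one_pos)
    (Eventually.of_forall fun t => (h.integral_ratio_mul_score _ w).1.1)
    (h.integral_ratio_mul_score _ w).1
    (by
      have h1 := h.measurable_inner_score ((0 : ℝ) • v) w
      have h2 := h.measurable_inner_score ((0 : ℝ) • v) v
      have h3 := h.measurable_fderiv_score v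
      simp only [zero_smul] at *
      fun_prop)
    (Eventually.of_forall fun z t ht => by
      have h1 : ‖t • v‖ ≤ R := by simpa using norm_add_smul_le (u := (0 : E)) (w := v) ht
      have h2 := h.norm_score_le z h1
      have h3 := h.ratio_le z h1
      have h4 : 1 ≤ Real.exp ‖S z 0‖ := Real.one_le_exp (norm_nonneg _)
      set X := Real.exp ‖S z 0‖
      calc ‖Real.exp (ℓ z (t • v) - ℓ z 0) * inner ℝ (S z (t • v)) v
            * inner ℝ (S z (t • v)) w
            + Real.exp (ℓ z (t • v) - ℓ z 0) * inner ℝ (fderiv ℝ (S z) (t • v) v) w‖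
          ≤ Real.exp (R * ‖S z 0‖) * (((1 + L * R) * X) * ‖v‖) * (((1 + L * R) * X) * ‖w‖)
            + Real.exp (R * ‖S z 0‖) * (L * ‖v‖ * ‖w‖) := by
            refine (norm_add_le _ _).trans ?_
            rw [norm_mul, norm_mul, norm_mul, Real.norm_of_nonneg (Real.exp_pos _).le]
            gcongr
            · refine (norm_inner_le_norm _ _).trans ?_
              gcongr
            · refine (norm_inner_le_norm _ _).trans ?_
              gcongr
            · refine (norm_inner_le_norm _ _).trans ?_
              gcongr
              exact h.norm_fderiv_score_le z _ _
        _ ≤ Real.exp (R * ‖S z 0‖) * (((1 + L * R) * X) * ‖v‖) * (((1 + L * R) * X) * ‖w‖)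
            + Real.exp (R * ‖S z 0‖) * (L * ‖v‖ * ‖w‖) * (X * X) := by
            exact add_le_add le_rfl (le_mul_of_one_le_right (by positivity) (by nlinarith))
        _ = ((1 + L * R) ^ 2 + L) * ‖v‖ * ‖w‖ * Real.exp ((R + 2) * ‖S z 0‖) := by
            rw [add_mul R, two_mul, Real.exp_add, Real.exp_add]; ring)
    hbound (Eventually.of_forall fun z t _ => by
      have h1 := h.hasDerivAt_ratio z 0 v t
      simp only [zero_add] at h1
      have h2 : HasDerivAt (fun t : ℝ => inner ℝ (S z (t • v)) w)
          (inner ℝ (fderiv ℝ (S z) (t • v) v) w) t := by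
        simpa using (h.hasDerivAt_score_line z v t).inner ℝ (hasDerivAt_const t w)
      exact h1.mul h2)
  simp only [(h.integral_ratio_mul_score _ w).2, zero_smul, sub_self, Real.exp_zero, one_mul]
    at key
  have h0 := key.2.unique (hasDerivAt_const _ _)
  have hJ : Integrable (fun z => inner ℝ (fderiv ℝ (S z) 0 v) w) ρ := by
    have := h.measurable_fderiv_score v
    refine (integrable_const (L * ‖v‖ * ‖w‖)).mono' (this.inner_const).aestronglyMeasurable
      (Eventually.of_forall fun z => (norm_inner_le_norm _ _).trans ?_)
    gcongr
    exact h.norm_fderiv_score_le z _ _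
  have hS : Integrable (fun z => inner ℝ (S z 0) v * inner ℝ (S z 0) w) ρ := by
    refine (key.1.sub hJ).congr (Eventually.of_forall fun z => ?_)
    simp
  rw [integral_add hS hJ] at h0
  simp_rw [real_inner_comm _ v, real_inner_comm _ w] at h0 ⊢
  linarith

theorem integrable_score [IsFiniteMeasure ρ] (h : IsLogLikelihood ρ ℓ S L lam) (u : E) :
    Integrable (fun z => S z u) ρ := by
  refine ((h.isSubGaussian.integrable_exp_norm (h.measurable_score_apply 0)
    zero_le_one).const_mul (1 + L * ‖u‖)).mono' (h.measurable_score_apply u).aestronglyMeasurable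
    (Eventually.of_forall fun z => ?_)
  rw [one_mul]
  exact h.norm_score_le z le_rfl

theorem integral_score_zero [IsFiniteMeasure ρ] (h : IsLogLikelihood ρ ℓ S L lam) (a : E) :
    ∫ z, inner ℝ a (S z 0) ∂ρ = 0 := by
  have := (h.integral_ratio_mul_score 0 a).2
  simp_rw [real_inner_comm a] at this ⊢
  simpa using this

/-- The mean field has derivative `-H` at the origin, by dominated convergence and the Fisher
information identity. -/
theorem drift_isLittleO [IsFiniteMeasure ρ] (h : IsLogLikelihood ρ ℓ S L lam) {H : E →L[ℝ] E}
    (hH : ∀ a b, ∫ z, inner ℝ a (S z 0) * inner ℝ b (S z 0) ∂ρ = inner ℝ a (H b)) :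
    (fun u => (∫ z, S z u ∂ρ) + H u) =o[𝓝 0] fun u => u := by
  have hJint : ∀ u, Integrable (fun z => fderiv ℝ (S z) 0 u) ρ := fun u =>
    (integrable_const (L * ‖u‖)).mono' (h.measurable_fderiv_score u).aestronglyMeasurable
      (Eventually.of_forall fun z => h.norm_fderiv_score_le z 0 u)
  have hJ : ∀ u, ∫ z, fderiv ℝ (S z) 0 u ∂ρ = -H u := by
    intro u
    refine ext_inner_left ℝ fun a => ?_
    rw [← integral_inner (hJint u), inner_neg_right, ← hH]
    have := h.integral_fderiv_score u a
    simp_rw [real_inner_comm a] at this ⊢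
    rw [this]
    congr 1
    exact integral_congr_ae (Eventually.of_forall fun z => mul_comm _ _)
  have hS0 : ∫ z, S z 0 ∂ρ = 0 := by
    refine ext_inner_left ℝ fun a => ?_
    rw [← integral_inner (h.integrable_score 0), h.integral_score_zero, inner_zero_right]
  have hrep : ∀ u, (∫ z, S z u ∂ρ) + H u = ∫ z, (S z u - S z 0 - fderiv ℝ (S z) 0 u) ∂ρ := by
    intro u
    have i1 : Integrable (fun z => S z u - S z 0) ρ :=
      (h.integrable_score u).sub (h.integrable_score 0)
    rw [integral_sub i1 (hJint u), integral_sub (h.integrable_score u) (h.integrable_score 0),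
      hS0, hJ, sub_zero, sub_neg_eq_add]
  have hbd : ∀ z u, ‖S z u - S z 0 - fderiv ℝ (S z) 0 u‖ ≤ 2 * L * ‖u‖ := by
    intro z u
    have h1 := h.lipschitz z u 0
    have h2 := h.norm_fderiv_score_le z 0 u
    rw [sub_zero] at h1
    linarith [norm_sub_le (S z u - S z 0) (fderiv ℝ (S z) 0 u)]
  have hmeas : ∀ u, Measurable fun z => S z u - S z 0 - fderiv ℝ (S z) 0 u := fun u =>
    ((h.measurable_score_apply u).sub (h.measurable_score_apply 0)).sub
      (h.measurable_fderiv_score u)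
  have hlim : Tendsto (fun u => ∫ z, ‖u‖⁻¹ * ‖S z u - S z 0 - fderiv ℝ (S z) 0 u‖ ∂ρ) (𝓝 0)
      (𝓝 (∫ _, (0 : ℝ) ∂ρ)) := by
    refine tendsto_integral_filter_of_dominated_convergence (fun _ => 2 * L)
      (Eventually.of_forall fun u => ?_) (Eventually.of_forall fun u =>
        Eventually.of_forall fun z => ?_) (integrable_const _) (Eventually.of_forall fun z => ?_)
    · exact ((hmeas u).norm.const_mul _).aestronglyMeasurable
    · rw [norm_mul, norm_inv, norm_norm, norm_norm]
      have hL := h.L_nonneg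
      rcases eq_or_ne u 0 with rfl | hu
      · simpa using hL
      · have : 0 < ‖u‖ := norm_pos_iff.2 hu
        rw [inv_mul_le_iff₀ this, mul_comm]
        exact hbd z u
    · have := (hasFDerivAt_iff_isLittleO_nhds_zero.1
        ((h.differentiable z) 0).hasFDerivAt).norm_norm.tendsto_div_nhds_zero
      refine this.congr fun u => ?_
      rw [zero_add, div_eq_inv_mul]
  rw [integral_zero] at hlim
  refine Asymptotics.isLittleO_iff.2 fun c hc => ?_
  filter_upwards [hlim.eventually_le_const hc] with u hu
  rw [hrep]
  rcases eq_or_ne u 0 with rfl | hu0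
  · simp
  · have hpos : 0 < ‖u‖ := norm_pos_iff.2 hu0
    rw [integral_const_mul, inv_mul_le_iff₀ hpos] at hu
    rw [mul_comm]
    exact (norm_integral_le_integral_norm _).trans hu

theorem isScoreField [IsFiniteMeasure ρ] (h : IsLogLikelihood ρ ℓ S L lam) {H : E →L[ℝ] E}
    (hH : ∀ a b, ∫ z, inner ℝ a (S z 0) * inner ℝ b (S z 0) ∂ρ = inner ℝ a (H b)) :
    IsScoreField ρ S H L lam where
  measurable := h.measurable_score
  L_nonneg := h.L_nonneg
  lam_pos := h.lam_pos
  lipschitz := h.lipschitz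
  monotone := h.monotone
  subGaussian := ⟨L, h.isSubGaussian⟩
  mean_zero := h.integral_score_zero
  second_moment := hH
  drift := h.drift_isLittleO hH

end IsLogLikelihood

end

/-! ### Square roots of positive-definite matrices -/

open scoped MatrixOrder in
/-- A positive-definite matrix has an invertible symmetric square root, which commutes with whatever
commutes with the matrix. -/
theorem Matrix.PosDef.exists_sqrt {p : ℕ} {A : Matrix (Fin p) (Fin p) ℝ} (hA : A.PosDef) :
    ∃ R R' : Matrix (Fin p) (Fin p) ℝ, R.IsHermitian ∧ R * R = A ∧ R * R' = 1 ∧ R' * R = 1 ∧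
      ∀ B, Commute A B → Commute R B := by
  have h0 : 0 ≤ A := hA.posSemidef.nonneg
  have hsq : CFC.sqrt A * CFC.sqrt A = A := CFC.sqrt_mul_sqrt_self A h0
  have hdet : IsUnit (CFC.sqrt A).det := by
    have h1 : IsUnit A.det := (Matrix.isUnit_iff_isUnit_det A).1 hA.isUnit
    rw [← hsq, Matrix.det_mul] at h1
    exact isUnit_of_mul_isUnit_left h1
  refine ⟨CFC.sqrt A, (CFC.sqrt A)⁻¹,
    (Matrix.nonneg_iff_posSemidef.1 (CFC.sqrt_nonneg A)).isHermitian, hsq,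
    Matrix.mul_nonsing_inv _ hdet, Matrix.nonsing_inv_mul _ hdet, fun B hB => ?_⟩
  rw [CFC.sqrt_eq_cfc]
  exact hB.cfc_nnreal _

/-- The continuous linear map of a real matrix. -/
noncomputable abbrev euclCLM {p : ℕ} (A : Matrix (Fin p) (Fin p) ℝ) :
    EuclideanSpace ℝ (Fin p) →L[ℝ] EuclideanSpace ℝ (Fin p) :=
  Matrix.toEuclideanCLM (𝕜 := ℝ) (n := Fin p) A

theorem euclCLM_mul_apply {p : ℕ} (A B : Matrix (Fin p) (Fin p) ℝ) (v : EuclideanSpace ℝ (Fin p)) :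
    euclCLM A (euclCLM B v) = euclCLM (A * B) v :=
  (congrArg (fun T => T v) (map_mul (Matrix.toEuclideanCLM (𝕜 := ℝ) (n := Fin p)) A B)).symm

theorem euclCLM_one_apply {p : ℕ} (v : EuclideanSpace ℝ (Fin p)) :
    euclCLM (1 : Matrix (Fin p) (Fin p) ℝ) v = v :=
  congrArg (fun T => T v) (map_one (Matrix.toEuclideanCLM (𝕜 := ℝ) (n := Fin p)))

theorem inner_euclCLM_symm {p : ℕ} {A : Matrix (Fin p) (Fin p) ℝ} (hA : A.IsHermitian)
    (u v : EuclideanSpace ℝ (Fin p)) : inner ℝ (euclCLM A u) v = inner ℝ u (euclCLM A v) := by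
  have h : IsSelfAdjoint (euclCLM A) := by
    rw [isSelfAdjoint_iff, ← map_star]
    congr 1
  exact ContinuousLinearMap.isSelfAdjoint_iff_isSymmetric.1 h u v

theorem inner_euclCLM_single {p : ℕ} (A : Matrix (Fin p) (Fin p) ℝ) (i j : Fin p) :
    inner ℝ (EuclideanSpace.single i (1 : ℝ)) (euclCLM A (EuclideanSpace.single j 1)) = A i j := by
  rw [Matrix.inner_toEuclideanCLM]
  simp

theorem Matrix.PosDef.exists_mul_norm_sq_le {p : ℕ} {A : Matrix (Fin p) (Fin p) ℝ}
    (hA : A.PosDef) : ∃ η > 0, ∀ v, η * ‖v‖ ^ 2 ≤ inner ℝ (euclCLM A v) v := by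
  obtain ⟨R, R', hR, hRR, -, hR'R, -⟩ := hA.exists_sqrt
  refine ⟨1 / (‖euclCLM R'‖ + 1) ^ 2, by positivity, fun v => ?_⟩
  have h1 : ‖v‖ ≤ (‖euclCLM R'‖ + 1) * ‖euclCLM R v‖ := by
    calc ‖v‖ = ‖euclCLM R' (euclCLM R v)‖ := by
          rw [euclCLM_mul_apply, hR'R, euclCLM_one_apply]
      _ ≤ ‖euclCLM R'‖ * ‖euclCLM R v‖ := (euclCLM R').le_opNorm _
      _ ≤ _ := by gcongr; linarith
  rw [← hRR, ← euclCLM_mul_apply, inner_euclCLM_symm hR, real_inner_self_eq_norm_sq,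
    one_div, inv_mul_le_iff₀ (by positivity), ← mul_pow]
  gcongr

/-! ### From the model to a score field -/

section

variable {p d : ℕ} {μ : Measure (EuclideanSpace ℝ (Fin p))}
  {ν : Measure (EuclideanSpace ℝ (Fin d))}
  {f : EuclideanSpace ℝ (Fin d) → EuclideanSpace ℝ (Fin p) → EuclideanSpace ℝ (Fin p) → ℝ}
  {θstar : EuclideanSpace ℝ (Fin p)} {L₀ : NNReal} {lamf : ℝ}

/-- A data point at which the log-likelihood has all the regularity that is assumed almost
surely. -/
def IsRegularDatum (f : EuclideanSpace ℝ (Fin d) → EuclideanSpace ℝ (Fin p) →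
    EuclideanSpace ℝ (Fin p) → ℝ) (L₀ : NNReal) (lamf : ℝ)
    (z : EuclideanSpace ℝ (Fin p) × EuclideanSpace ℝ (Fin d)) : Prop :=
  (∀ θ, 0 < f z.2 z.1 θ) ∧ Differentiable ℝ (logLik f z.2 z.1) ∧
    Differentiable ℝ (score f z.2 z.1) ∧ LipschitzWith L₀ (score f z.2 z.1) ∧
    ∀ θ v : EuclideanSpace ℝ (Fin p), lamf * ‖v‖ ^ 2 ≤ inner ℝ (observedFisher f z.2 z.1 θ v) v

theorem LikelihoodAssumptions.ae_isRegularDatum (hf : IsDensityFamily ν f)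
    (h : LikelihoodAssumptions μ ν f θstar L₀ lamf) :
    ∀ᵐ z ∂(dataLaw μ ν f θstar), IsRegularDatum f L₀ lamf z := by
  have hpos : ∀ᵐ z ∂(dataLaw μ ν f θstar), 0 < f z.2 z.1 θstar := by
    rw [dataLaw, ae_withDensity_iff (hf.measurable θstar).ennreal_ofReal]
    exact Eventually.of_forall fun z hz => ENNReal.ofReal_pos.1 (pos_iff_ne_zero.2 hz)
  filter_upwards [hpos, h.differentiable, h.differentiable_score, h.lipschitz_score,
    h.observedFisher_ge] with z h1 h2 h3 h4 h5
  exact ⟨fun θ => h.common_support _ _ _ _ h1, h2, h3, h4, h5⟩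

/-- A lower bound on the observed Fisher information makes the score strongly monotone. -/
theorem IsRegularDatum.inner_score_sub_le
    {z : EuclideanSpace ℝ (Fin p) × EuclideanSpace ℝ (Fin d)} (h : IsRegularDatum f L₀ lamf z)
    (a b : EuclideanSpace ℝ (Fin p)) :
    inner ℝ (score f z.2 z.1 a - score f z.2 z.1 b) (a - b) ≤ -lamf * ‖a - b‖ ^ 2 := by
  obtain ⟨-, -, hd, -, hH⟩ := h
  set w := a - b with hw
  have hder : ∀ t : ℝ, HasDerivAt (fun t : ℝ => inner ℝ (score f z.2 z.1 (b + t • w)) w)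
      (inner ℝ (fderiv ℝ (score f z.2 z.1) (b + t • w) w) w) t := by
    intro t
    have h1 : HasDerivAt (fun t : ℝ => b + t • w) w t := by
      simpa using ((hasDerivAt_id t).smul_const w).const_add b
    have h2 := (hd (b + t • w)).hasFDerivAt.comp_hasDerivAt t h1
    simpa using h2.inner ℝ (hasDerivAt_const t w)
  obtain ⟨t, -, ht⟩ := exists_hasDerivAt_eq_slope _ _ one_pos
    (continuous_iff_continuousAt.2 fun t => (hder t).continuousAt).continuousOn fun t _ => hder t
  have h3 := hH (b + t • w) w
  simp only [observedFisher, neg_apply, inner_neg_left] at h3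
  simp only [one_smul, zero_smul, add_zero, sub_zero, div_one] at ht
  rw [inner_sub_left]
  have hab : b + w = a := by rw [hw]; abel
  rw [hab] at ht
  linarith

theorem lintegral_density_ratio [IsProbabilityMeasure μ] [SigmaFinite ν] (hf : IsDensityFamily ν f)
    (h : LikelihoodAssumptions μ ν f θstar L₀ lamf) (θ : EuclideanSpace ℝ (Fin p)) :
    ∫⁻ z, ENNReal.ofReal (f z.2 z.1 θ / f z.2 z.1 θstar) ∂(dataLaw μ ν f θstar) = 1 := by
  have hm := hf.measurable θ
  have hm0 := hf.measurable θstar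
  have hr : Measurable fun z : EuclideanSpace ℝ (Fin p) × EuclideanSpace ℝ (Fin d) =>
      ENNReal.ofReal (f z.2 z.1 θ / f z.2 z.1 θstar) := (hm.div hm0).ennreal_ofReal
  rw [dataLaw, lintegral_withDensity_eq_lintegral_mul _ hm0.ennreal_ofReal hr]
  have heq : ∀ z : EuclideanSpace ℝ (Fin p) × EuclideanSpace ℝ (Fin d),
      ENNReal.ofReal (f z.2 z.1 θstar) * ENNReal.ofReal (f z.2 z.1 θ / f z.2 z.1 θstar)
        = ENNReal.ofReal (f z.2 z.1 θ) := by
    intro z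
    rw [← ENNReal.ofReal_mul (hf.nonneg _ _ _)]
    congr 1
    rcases (hf.nonneg z.2 z.1 θstar).eq_or_lt with h0 | h0
    · have : ¬ 0 < f z.2 z.1 θ := fun hpos =>
        (h.common_support _ _ _ θstar hpos).ne' h0.symm
      rw [← h0, le_antisymm (not_lt.1 this) (hf.nonneg _ _ _), zero_mul]
    · rw [mul_div_cancel₀ _ h0.ne']
  simp only [Pi.mul_apply, heq]
  rw [lintegral_prod _ hm.ennreal_ofReal.aemeasurable]
  simp [hf.lintegral_eq_one]

/-- In the coordinates `θ = θstar + D u`, and after modification on a null set of data points, the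
model has a regular log-likelihood. -/
theorem LikelihoodAssumptions.exists_isLogLikelihood [IsProbabilityMeasure μ] [SigmaFinite ν]
    (hf : IsDensityFamily ν f) (h : LikelihoodAssumptions μ ν f θstar L₀ lamf)
    {D D' : EuclideanSpace ℝ (Fin p) →L[ℝ] EuclideanSpace ℝ (Fin p)}
    (hsymm : ∀ u v, inner ℝ (D u) v = inner ℝ u (D v)) (hD : ∀ u, D' (D u) = u) :
    ∃ ℓ S L lam, IsLogLikelihood (dataLaw μ ν f θstar) ℓ S L lam ∧
      ∀ᵐ z ∂(dataLaw μ ν f θstar), ∀ u, S z u = D (score f z.2 z.1 (θstar + D u)) := by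
  classical
  -- Outside a measurable set `G` of full measure, a quadratic log-likelihood is used.
  obtain ⟨G, hGae, hGm, hG⟩ := (h.ae_isRegularDatum hf).exists_measurable_mem
  set κ : ℝ := lamf * (1 / (‖D'‖ + 1)) ^ 2 with hκdef
  have hlamf := h.lamf_pos
  have hκ : 0 < κ := by positivity
  have hlow : ∀ u, κ * ‖u‖ ^ 2 ≤ lamf * ‖D u‖ ^ 2 := by
    intro u
    have h1 : ‖u‖ ≤ (‖D'‖ + 1) * ‖D u‖ := by
      calc ‖u‖ = ‖D' (D u)‖ := by rw [hD]
        _ ≤ ‖D'‖ * ‖D u‖ := D'.le_opNorm _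
        _ ≤ _ := by gcongr; linarith
    rw [hκdef, mul_assoc, ← mul_pow]
    gcongr
    rw [one_div, inv_mul_le_iff₀ (by positivity)]
    exact h1
  refine ⟨fun z u => if z ∈ G then logLik f z.2 z.1 (θstar + D u) else -(κ / 2) * ‖u‖ ^ 2,
    fun z u => if z ∈ G then D (score f z.2 z.1 (θstar + D u)) else -(κ • u),
    ‖D‖ * (L₀ * ‖D‖) + κ, κ, ⟨?_, ?_, ?_, by positivity, hκ, ?_, ?_, ?_⟩, ?_⟩
  · exact fun u => Measurable.ite hGm (Real.measurable_log.comp (hf.measurable _)) measurable_const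
  · intro z u
    by_cases hz : z ∈ G
    · simp only [hz, if_true]
      obtain ⟨-, hd, -⟩ := hG z hz
      have h1 : HasGradientAt (logLik f z.2 z.1) (score f z.2 z.1 (θstar + D u)) (θstar + D u) :=
        (hd _).hasGradientAt
      have h2 : HasFDerivAt (fun u => θstar + D u) D u := D.hasFDerivAt.const_add θstar
      have h3 := h1.hasFDerivAt.comp u h2
      rw [hasGradientAt_iff_hasFDerivAt]
      have hdual : InnerProductSpace.toDual ℝ _ (D (score f z.2 z.1 (θstar + D u))) =
          (InnerProductSpace.toDual ℝ _ (score f z.2 z.1 (θstar + D u))) ∘SL D := by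
        ext v
        simp [hsymm]
      rw [hdual]
      exact h3
    · simp only [hz, if_false]
      rw [hasGradientAt_iff_hasFDerivAt]
      convert! ((hasStrictFDerivAt_norm_sq u).hasFDerivAt.const_mul (-(κ / 2))) using 1
      ext v
      simp
      ring
  · intro z
    by_cases hz : z ∈ G
    · simp only [hz, if_true]
      obtain ⟨-, -, hd, -⟩ := hG z hz
      fun_prop
    · simp only [hz, if_false]
      fun_prop
  · intro z u v
    by_cases hz : z ∈ G
    · simp only [hz, if_true]
      obtain ⟨-, -, -, hl, -⟩ := hG z hz
      have h1 := hl.dist_le_mul (θstar + D u) (θstar + D v)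
      rw [dist_eq_norm, dist_eq_norm, add_sub_add_left_eq_sub, ← map_sub] at h1
      rw [← map_sub]
      calc _ ≤ ‖D‖ * ‖score f z.2 z.1 (θstar + D u) - score f z.2 z.1 (θstar + D v)‖ :=
            D.le_opNorm _
        _ ≤ ‖D‖ * (L₀ * (‖D‖ * ‖u - v‖)) := by
            gcongr
            exact h1.trans (by gcongr; exact D.le_opNorm _)
        _ ≤ ‖D‖ * (L₀ * (‖D‖ * ‖u - v‖)) + κ * ‖u - v‖ := le_add_of_nonneg_right (by positivity)
        _ = _ := by ring
    · simp only [hz, if_false]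
      rw [neg_sub_neg, ← smul_sub, norm_smul, Real.norm_of_nonneg hκ.le, norm_sub_rev]
      gcongr
      exact le_add_of_nonneg_left (by positivity)
  · intro z u v
    by_cases hz : z ∈ G
    · simp only [hz, if_true]
      have h1 := (hG z hz).inner_score_sub_le (θstar + D u) (θstar + D v)
      rw [add_sub_add_left_eq_sub, ← map_sub] at h1
      rw [← map_sub, hsymm]
      have := hlow (u - v)
      linarith
    · simp only [hz, if_false]
      rw [neg_sub_neg, ← smul_sub, real_inner_smul_left, ← neg_sub u v, inner_neg_left,
        real_inner_self_eq_norm_sq]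
      linarith
  · intro u
    rw [← lintegral_density_ratio hf h (θstar + D u)]
    refine lintegral_congr_ae ?_
    filter_upwards [hGae] with z hz
    simp only [hz, if_true, map_zero, add_zero, logLik]
    have hp := (hG z hz).1
    rw [← Real.log_div (hp _).ne' (hp _).ne', Real.exp_log (div_pos (hp _) (hp _))]
  · filter_upwards [hGae] with z hz u
    simp [hz]

theorem isProbabilityMeasure_dataLaw [IsProbabilityMeasure μ] [SigmaFinite ν]
    (hf : IsDensityFamily ν f) (θ : EuclideanSpace ℝ (Fin p)) :
    IsProbabilityMeasure (dataLaw μ ν f θ) := by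
  refine ⟨?_⟩
  rw [dataLaw, withDensity_apply _ MeasurableSet.univ, Measure.restrict_univ,
    lintegral_prod _ (hf.measurable θ).ennreal_ofReal.aemeasurable]
  simp [hf.lintegral_eq_one]

/-- The Fisher information is the second moment of the score; in particular the integrals that
define it converge. -/
theorem LikelihoodAssumptions.integral_inner_score_mul [IsProbabilityMeasure μ] [SigmaFinite ν]
    (hf : IsDensityFamily ν f) (h : LikelihoodAssumptions μ ν f θstar L₀ lamf)
    (a b : EuclideanSpace ℝ (Fin p)) :
    ∫ z, inner ℝ a (score f z.2 z.1 θstar) * inner ℝ b (score f z.2 z.1 θstar)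
      ∂(dataLaw μ ν f θstar) = inner ℝ a (euclCLM (fisherInformation μ ν f θstar) b) := by
  have := isProbabilityMeasure_dataLaw (μ := μ) hf θstar
  obtain ⟨ℓ, S, L, lam, hS, hae⟩ := h.exists_isLogLikelihood hf
    (D := ContinuousLinearMap.id ℝ _) (D' := ContinuousLinearMap.id ℝ _) (fun _ _ => rfl)
    fun _ => rfl
  have hae0 : (fun z => S z 0) =ᵐ[dataLaw μ ν f θstar] fun z => score f z.2 z.1 θstar := by
    filter_upwards [hae] with z hz
    simpa using hz 0
  have hmom : HasMoments (fun z => score f z.2 z.1 θstar) (dataLaw μ ν f θstar) := by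
    have hm := hS.measurable_score_apply 0
    have := hasMoments_of_integrable_pow (P := dataLaw μ ν f θstar) hm.aestronglyMeasurable
      fun m hm' => by
        obtain ⟨K, -, hK⟩ := IsSubGaussian.exists_moment_bound
          (E := EuclideanSpace ℝ (Fin p)) L hm'
        exact (hK _ _ hm hS.isSubGaussian).1
    exact fun m => (memLp_congr_ae hae0).1 (this m)
  have hcoord : ∀ i, HasMoments (fun z => score f z.2 z.1 θstar i) (dataLaw μ ν f θstar) :=
    fun i => hmom.clm (EuclideanSpace.proj i)
  have hexp : ∀ z : EuclideanSpace ℝ (Fin p) × EuclideanSpace ℝ (Fin d),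
      inner ℝ a (score f z.2 z.1 θstar) * inner ℝ b (score f z.2 z.1 θstar) =
      ∑ i, ∑ j, a i * b j * (score f z.2 z.1 θstar i * score f z.2 z.1 θstar j) := by
    intro z
    simp only [PiLp.inner_apply, RCLike.inner_apply, conj_trivial, Finset.sum_mul_sum]
    refine Finset.sum_congr rfl fun i _ => Finset.sum_congr rfl fun j _ => by ring
  have hint : ∀ i j, Integrable (fun z => a i * b j *
      (score f z.2 z.1 θstar i * score f z.2 z.1 θstar j)) (dataLaw μ ν f θstar) :=
    fun i j => ((hcoord i).integrable_mul (hcoord j)).const_mul _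
  simp_rw [hexp]
  rw [integral_finsetSum _ fun i _ => integrable_finsetSum _ fun j _ => hint i j,
    Matrix.inner_toEuclideanCLM]
  simp only [dotProduct, Matrix.mulVec, fisherInformation, Matrix.of_apply, Finset.mul_sum]
  refine Finset.sum_congr rfl fun i _ => ?_
  rw [integral_finsetSum _ fun j _ => hint i j]
  refine Finset.sum_congr rfl fun j _ => ?_
  rw [integral_const_mul]
  ring

end

/-! ### Explicit and implicit procedures with condition operators -/

section

variable {E 𝒵 Ω : Type*} [NormedAddCommGroup E] [InnerProductSpace ℝ E] [FiniteDimensional ℝ E]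
  [MeasurableSpace E] [BorelSpace E] [MeasurableSpace 𝒵] [MeasurableSpace Ω]
  {P : Measure Ω} {ρ : Measure 𝒵} {ζ : ℕ → Ω → 𝒵} {s : 𝒵 → E → E} {H : E →L[ℝ] E}
  {L lam γ : ℝ}

/-- The process started at `e₀` and updated by `e (n + 1) = Ψ n (e n) (ζ n)`. -/
def streamRecursion (Ψ : ℕ → E → 𝒵 → E) (ζ : ℕ → Ω → 𝒵) (e₀ : E) : ℕ → Ω → E
  | 0, _ => e₀
  | n + 1, ω => Ψ n (streamRecursion Ψ ζ e₀ n ω) (ζ n ω)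

/-- A recursion whose update grows at most linearly and agrees with a gradient step up to
`O(1 / n²)` is a perturbed stochastic gradient recursion. -/
theorem IsScoreField.isPerturbedSGD_streamRecursion [IsProbabilityMeasure P]
    (hs : IsScoreField ρ s H L lam) (hζ : IsDataStream P ρ ζ) {Ψ : ℕ → E → 𝒵 → E}
    (hΨ : ∀ n, Measurable (Function.uncurry (Ψ n)))
    (hbound : ∀ n, ∃ K : ℝ, ∀ w z, ‖Ψ n w z‖ ≤ K * (‖s z 0‖ + ‖w‖))
    (hstep : ∃ K : ℝ, 0 ≤ K ∧ ∀ᶠ n : ℕ in atTop, ∀ w z,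
      ‖Ψ n w z - w - (γ / (n + 1)) • s z w‖ ≤ K / ((n : ℝ) + 1) ^ 2 * (‖s z 0‖ + ‖w‖)) (e₀ : E) :
    IsPerturbedSGD P ζ s γ (streamRecursion Ψ ζ e₀) := by
  have had : ∀ n, Measurable[past ζ n] (streamRecursion Ψ ζ e₀ n) := by
    intro n
    induction n with
    | zero => exact measurable_const
    | succ n ih =>
      exact (hΨ n).comp
        ((ih.mono (past_mono ζ n.le_succ) le_rfl).prodMk (measurable_past_succ ζ n))
  refine ⟨had, fun n => ?_, ?_⟩
  · induction n with
    | zero => exact hasMoments_const e₀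
    | succ n ih =>
      obtain ⟨K, hK⟩ := hbound n
      refine HasMoments.of_le ((hs.hasMoments_noise hζ n).norm.add ih.norm)
        ((had (n + 1)).mono (hζ.past_le _) le_rfl).aestronglyMeasurable (K := K) fun ω => ?_
      rw [Real.norm_of_nonneg (by positivity)]
      exact hK _ _
  · obtain ⟨K, hK0, hK⟩ := hstep
    exact ⟨K, hK0, hK.mono fun n hn ω => hn _ _⟩

/-- The explicit update `w + γ / (n + 1) • B n (s z w)`. -/
noncomputable def explicitUpdate (s : 𝒵 → E → E) (γ : ℝ) (B : ℕ → E →L[ℝ] E) (n : ℕ) (w : E)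
    (z : 𝒵) : E := w + (γ / ((n : ℝ) + 1)) • B n (s z w)

theorem IsScoreField.isPerturbedSGD_explicit [IsProbabilityMeasure P]
    (hs : IsScoreField ρ s H L lam) (hγ : 0 < γ) (hζ : IsDataStream P ρ ζ) {B : ℕ → E →L[ℝ] E}
    (hB : ∃ K : ℝ, ∀ n : ℕ, ‖B n - 1‖ ≤ K / ((n : ℝ) + 1)) (e₀ : E) :
    IsPerturbedSGD P ζ s γ (streamRecursion (explicitUpdate s γ B) ζ e₀) := by
  have hL := hs.L_nonneg
  have hsw : ∀ z w, ‖s z w‖ ≤ (1 + L) * (‖s z 0‖ + ‖w‖) := fun z w => by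
    have := hs.norm_le z w
    have := norm_nonneg w
    have := mul_nonneg hL (norm_nonneg (s z 0))
    linarith
  refine hs.isPerturbedSGD_streamRecursion hζ (fun n => ?_) (fun n => ?_) ?_ e₀
  · have h1 : Measurable fun q : E × 𝒵 => s q.2 q.1 := hs.measurable.comp measurable_swap
    exact measurable_fst.add (((B n).measurable.comp h1).const_smul _)
  · refine ⟨1 + γ / (n + 1) * (‖B n‖ * (1 + L)), fun w z => ?_⟩
    calc ‖explicitUpdate s γ B n w z‖
        ≤ ‖w‖ + ‖(γ / ((n : ℝ) + 1)) • B n (s z w)‖ := norm_add_le _ _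
      _ ≤ ‖w‖ + γ / (n + 1) * (‖B n‖ * ((1 + L) * (‖s z 0‖ + ‖w‖))) := by
          rw [norm_smul, Real.norm_of_nonneg (by positivity)]
          gcongr
          exact ((B n).le_opNorm _).trans (by gcongr; exact hsw z w)
      _ ≤ (‖s z 0‖ + ‖w‖) + γ / (n + 1) * (‖B n‖ * ((1 + L) * (‖s z 0‖ + ‖w‖))) := by
          gcongr
          exact le_add_of_nonneg_left (norm_nonneg _)
      _ = _ := by ring
  · obtain ⟨K, hK⟩ := hB
    have hK0 : 0 ≤ K := by simpa using (norm_nonneg _).trans (hK 0)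
    refine ⟨γ * K * (1 + L), by positivity, Eventually.of_forall fun n w z => ?_⟩
    have heq : explicitUpdate s γ B n w z - w - (γ / (n + 1)) • s z w
        = (γ / ((n : ℝ) + 1)) • (B n - 1) (s z w) := by
      simp only [explicitUpdate, sub_apply, one_apply_eq_self, smul_sub]
      abel
    rw [heq, norm_smul, Real.norm_of_nonneg (by positivity)]
    calc _ ≤ γ / ((n : ℝ) + 1) * (K / ((n : ℝ) + 1) * ((1 + L) * (‖s z 0‖ + ‖w‖))) := by
          gcongr
          exact ((B n - 1).le_opNorm _).trans (by gcongr; exacts [hK n, hsw z w])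
      _ = _ := by field_simp

/-- A Lipschitz and strongly monotone vector field, depending measurably on a parameter, has a zero
that depends measurably on the parameter: `u ↦ u - τ • F a u` is a contraction for small `τ`, and
the zero is the limit of its iterates. -/
theorem exists_measurable_zero_of_strongly_monotone {α : Type*} [MeasurableSpace α]
    {F : α → E → E} (hF : Measurable (Function.uncurry F)) {M m : ℝ} (hm : 0 < m)
    (hlip : ∀ a u v, ‖F a u - F a v‖ ≤ M * ‖u - v‖)
    (hmono : ∀ a u v, m * ‖u - v‖ ^ 2 ≤ inner ℝ (F a u - F a v) (u - v)) :
    ∃ Φ : α → E, Measurable Φ ∧ ∀ a, F a (Φ a) = 0 := by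
  set N : ℝ := |M| + m with hN
  have hN0 : 0 < N := by positivity
  have hlip' : ∀ a u v, ‖F a u - F a v‖ ≤ N * ‖u - v‖ := fun a u v =>
    (hlip a u v).trans (by gcongr; linarith [le_abs_self M])
  set τ : ℝ := m / N ^ 2 with hτ
  have hτ0 : 0 < τ := by positivity
  set q : ℝ := 1 - (m / N) ^ 2 with hq
  have hq0 : 0 ≤ q := by
    have h1 : m / N ≤ 1 := (div_le_one hN0).2 (by linarith [abs_nonneg M])
    have h2 : 0 ≤ m / N := by positivity
    nlinarith
  have hq1 : q < 1 := by
    have : 0 < (m / N) ^ 2 := by positivity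
    linarith
  have hcontr : ∀ a, ContractingWith (√q).toNNReal fun u => u - τ • F a u := by
    intro a
    refine ⟨?_, LipschitzWith.of_dist_le_mul fun u v => ?_⟩
    · rw [← NNReal.coe_lt_coe, Real.coe_toNNReal _ (Real.sqrt_nonneg q)]
      exact (Real.sqrt_lt' one_pos).2 (by simpa using hq1)
    · rw [dist_eq_norm, dist_eq_norm, Real.coe_toNNReal _ (Real.sqrt_nonneg q)]
      refine abs_le_of_sq_le_sq' ?_ (by positivity) |>.2
      have heq : u - τ • F a u - (v - τ • F a v) = (u - v) - τ • (F a u - F a v) := by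
        rw [smul_sub]; abel
      have h1 := hmono a u v
      have h2 : ‖F a u - F a v‖ ^ 2 ≤ (N * ‖u - v‖) ^ 2 := by
        gcongr; exact hlip' a u v
      rw [heq, norm_sub_sq_real, norm_smul, real_inner_smul_right, real_inner_comm, mul_pow,
        mul_pow, Real.sq_sqrt hq0, Real.norm_of_nonneg hτ0.le]
      calc _ ≤ ‖u - v‖ ^ 2 - 2 * (τ * (m * ‖u - v‖ ^ 2)) + τ ^ 2 * (N * ‖u - v‖) ^ 2 := by
            gcongr
        _ = q * ‖u - v‖ ^ 2 := by
            rw [hq, hτ]; field_simp; ring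
  refine ⟨fun a => ContractingWith.fixedPoint _ (hcontr a), ?_, fun a => ?_⟩
  · have hT : Measurable fun q : α × E => q.2 - τ • F q.1 q.2 :=
      measurable_snd.sub (hF.const_smul _)
    have hiter : ∀ n : ℕ, Measurable fun a => (fun u => u - τ • F a u)^[n] 0 := by
      intro n
      induction n with
      | zero => exact measurable_const
      | succ n ih =>
        simp only [Function.iterate_succ_apply']
        exact hT.comp (measurable_id.prodMk ih)
    exact measurable_of_tendsto_metrizable hiter
      (tendsto_pi_nhds.2 fun a => (hcontr a).tendsto_iterate_fixedPoint 0)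
  · have h := (hcontr a).fixedPoint_isFixedPt
    have h' : τ • F a (ContractingWith.fixedPoint _ (hcontr a)) = 0 := by
      have := h.eq
      simpa using this
    exact (smul_eq_zero.1 h').resolve_left hτ0.ne'

/-- The implicit update is unique. -/
theorem IsScoreField.implicit_unique (hs : IsScoreField ρ s H L lam) {B : E →L[ℝ] E}
    (hB : ∀ v, 0 ≤ inner ℝ (B v) v) {t : ℝ} (ht : 0 ≤ t) {w u v : E} {z : 𝒵}
    (hu : u = w + t • B (s z u)) (hv : v = w + t • B (s z v)) : u = v := by
  have h1 : u - v = t • B (s z u - s z v) := by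
    rw [map_sub, smul_sub]
    nth_rewrite 1 [hu, hv]
    abel
  have h2 := hs.monotone z u v
  have h3 : 0 ≤ inner ℝ (s z u - s z v) (u - v) := by
    nth_rewrite 1 [h1]
    rw [real_inner_smul_right, real_inner_comm]
    exact mul_nonneg ht (hB _)
  have h4 : ‖u - v‖ ^ 2 ≤ 0 := by nlinarith [hs.lam_pos]
  exact sub_eq_zero.1 (norm_eq_zero.1 (pow_eq_zero_iff two_ne_zero |>.1
    (le_antisymm h4 (by positivity))))

/-- The implicit update exists, is measurable, and grows at most linearly. -/
theorem IsScoreField.exists_implicit_update (hs : IsScoreField ρ s H L lam) {B : E →L[ℝ] E}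
    (hB : ∀ v, v ≠ 0 → 0 < inner ℝ (B v) v) {t : ℝ} (ht : 0 < t) :
    ∃ Ψ : E → 𝒵 → E, Measurable (Function.uncurry Ψ) ∧
      (∃ K : ℝ, ∀ w z, ‖Ψ w z‖ ≤ K * (‖s z 0‖ + ‖w‖)) ∧
      ∀ w z, Ψ w z = w + t • B (s z (Ψ w z)) := by
  have hlam := hs.lam_pos
  have hinj : Function.Injective (B : E →ₗ[ℝ] E) := by
    rw [injective_iff_map_eq_zero]
    intro v hv
    by_contra hne
    have h1 : B v = 0 := hv
    have := hB v hne
    simp [h1] at this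
  set A : E →L[ℝ] E := LinearMap.toContinuousLinearMap
    ((LinearEquiv.ofInjectiveEndo (B : E →ₗ[ℝ] E) hinj).symm : E →ₗ[ℝ] E) with hA
  have hBA : ∀ v, B (A v) = v := fun v =>
    (LinearEquiv.ofInjectiveEndo (B : E →ₗ[ℝ] E) hinj).apply_symm_apply v
  have hApos : ∀ v, 0 ≤ inner ℝ (A v) v := by
    intro v
    rcases eq_or_ne (A v) 0 with h | h
    · simp [h]
    · have := hB _ h
      rw [hBA, real_inner_comm] at this
      exact this.le
  set F : E × 𝒵 → E → E := fun a u => A u - t • s a.2 u - A a.1 with hFdef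
  have hFm : Measurable (Function.uncurry F) := by
    have h1 : Measurable fun q : (E × 𝒵) × E => s q.1.2 q.2 :=
      hs.measurable.comp ((measurable_snd.comp measurable_fst).prodMk measurable_snd)
    exact ((A.measurable.comp measurable_snd).sub (h1.const_smul t)).sub
      (A.measurable.comp (measurable_fst.comp measurable_fst))
  have hFsub : ∀ a u v, F a u - F a v = A (u - v) - t • (s a.2 u - s a.2 v) := by
    intro a u v
    simp only [hFdef, map_sub, smul_sub]
    abel
  have hmono : ∀ a u v, (t * lam) * ‖u - v‖ ^ 2 ≤ inner ℝ (F a u - F a v) (u - v) := by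
    intro a u v
    have h1 := hs.monotone a.2 u v
    rw [hFsub, inner_sub_left, real_inner_smul_left]
    have := hApos (u - v)
    nlinarith
  obtain ⟨Φ, hΦ, hzero⟩ := exists_measurable_zero_of_strongly_monotone hFm
    (M := ‖A‖ + t * L) (m := t * lam) (by positivity) (fun a u v => by
      rw [hFsub, add_mul]
      refine (norm_sub_le _ _).trans (add_le_add (A.le_opNorm _) ?_)
      rw [norm_smul, Real.norm_of_nonneg ht.le, mul_assoc]
      gcongr
      exact hs.lipschitz _ _ _) hmono
  refine ⟨fun w z => Φ (w, z), hΦ, ⟨(t + ‖A‖) / (t * lam), fun w z => ?_⟩, fun w z => ?_⟩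
  · have h1 := hmono (w, z) (Φ (w, z)) 0
    have h2 : ‖F (w, z) 0‖ ≤ (t + ‖A‖) * (‖s z 0‖ + ‖w‖) := by
      simp only [hFdef, map_zero, zero_sub]
      calc _ ≤ ‖-(t • s z 0)‖ + ‖A w‖ := norm_sub_le _ _
        _ ≤ t * ‖s z 0‖ + ‖A‖ * ‖w‖ := by
            rw [norm_neg, norm_smul, Real.norm_of_nonneg ht.le]
            gcongr
            exact A.le_opNorm _
        _ ≤ _ := by
            have := mul_nonneg ht.le (norm_nonneg w)
            have := mul_nonneg (norm_nonneg A) (norm_nonneg (s z 0))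
            linarith
    rw [hzero, zero_sub, sub_zero, inner_neg_left, ← inner_neg_right] at h1
    have h3 := real_inner_le_norm (F (w, z) 0) (-Φ (w, z))
    rw [norm_neg] at h3
    rw [div_mul_eq_mul_div, le_div_iff₀ (by positivity)]
    rcases (norm_nonneg (Φ (w, z))).eq_or_lt with h0 | h0
    · rw [← h0, zero_mul]; positivity
    · refine le_trans ?_ h2
      refine le_of_mul_le_mul_right ?_ h0
      linarith
  · have h1 : A (Φ (w, z)) = A w + t • s z (Φ (w, z)) := by
      have := hzero (w, z)
      simp only [hFdef] at this
      rw [sub_sub, sub_eq_zero] at this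
      rw [this]; abel
    have h2 := congrArg B h1
    rwa [map_add, map_smul, hBA, hBA] at h2

/-- The implicit procedure is a perturbed stochastic gradient recursion: the implicit update solves
`u = w + t • B (s z u)` with `t = γ / (n + 1)`, hence `u - w = O(t)` and `u` differs from the
explicit update by `O(t²)`. -/
theorem IsScoreField.exists_isPerturbedSGD_implicit [IsProbabilityMeasure P]
    (hs : IsScoreField ρ s H L lam) (hγ : 0 < γ) (hζ : IsDataStream P ρ ζ) {B : ℕ → E →L[ℝ] E}
    (hBpos : ∀ n v, v ≠ 0 → 0 < inner ℝ (B n v) v)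
    (hB : ∃ K : ℝ, ∀ n : ℕ, ‖B n - 1‖ ≤ K / ((n : ℝ) + 1)) (e₀ : E) :
    ∃ e : ℕ → Ω → E, IsPerturbedSGD P ζ s γ e ∧ (∀ ω, e 0 ω = e₀) ∧
      ∀ n ω, e (n + 1) ω = e n ω + (γ / ((n : ℝ) + 1)) • B n (s (ζ n ω) (e (n + 1) ω)) := by
  have hL := hs.L_nonneg
  choose Ψ hΨm hΨb hΨ using fun n : ℕ =>
    hs.exists_implicit_update (hBpos n) (t := γ / ((n : ℝ) + 1)) (by positivity)
  refine ⟨streamRecursion Ψ ζ e₀, ?_, fun _ => rfl, fun n ω => hΨ n _ _⟩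
  refine hs.isPerturbedSGD_streamRecursion hζ hΨm hΨb ?_ e₀
  obtain ⟨K, hK⟩ := hB
  have hK0 : 0 ≤ K := by simpa using (norm_nonneg _).trans (hK 0)
  refine ⟨γ * (1 + 2 * L) * (K + 2 * γ * L), by positivity, ?_⟩
  have hlarge : ∀ c : ℝ, ∀ᶠ n : ℕ in atTop, c / ((n : ℝ) + 1) ≤ 1 := fun c => by
    filter_upwards [eventually_ge_atTop ⌈c⌉₊] with n hn
    rw [div_le_one (by positivity)]
    have := (Nat.le_ceil c).trans (Nat.cast_le.2 hn)
    linarith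
  filter_upwards [hlarge K, hlarge (4 * γ * L), hlarge (2 * γ)] with n h1 h2 h3 w z
  set t : ℝ := γ / ((n : ℝ) + 1) with ht
  have ht0 : 0 < t := by positivity
  set u := Ψ n w z with hu
  have hstep : u - w = t • B n (s z u) := sub_eq_iff_eq_add'.2 (hΨ n w z)
  set Q := ‖s z 0‖ + ‖w‖ with hQ
  have hBv : ∀ v, ‖B n v‖ ≤ 2 * ‖v‖ := fun v => by
    have h4 : B n v = (B n - 1) v + v := by simp
    have h5 : ‖(B n - 1) v‖ ≤ 1 * ‖v‖ := (B n - 1).le_of_opNorm_le ((hK n).trans h1) v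
    have := norm_add_le ((B n - 1) v) v
    rw [h4]
    linarith
  have hsu := hs.norm_le z u
  have hdiff : ‖u - w‖ ≤ t * (2 * ‖s z u‖) := by
    rw [hstep, norm_smul, Real.norm_of_nonneg ht0.le]
    gcongr
    exact hBv _
  have hu2 : ‖u‖ ≤ 2 * Q := by
    have h4 : ‖u‖ ≤ ‖u - w‖ + ‖w‖ := by simpa using norm_add_le (u - w) w
    have h5 : t * (2 * ‖s z u‖) ≤ t * (2 * (‖s z 0‖ + L * ‖u‖)) := by gcongr
    have h6 : 4 * γ * L / ((n : ℝ) + 1) = 4 * (t * L) := by rw [ht]; ring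
    have h7 : 2 * γ / ((n : ℝ) + 1) = 2 * t := by rw [ht]; ring
    rw [h6] at h2
    rw [h7] at h3
    have h8 := mul_le_mul_of_nonneg_right h2 (norm_nonneg u)
    have h9 := mul_le_mul_of_nonneg_right h3 (norm_nonneg (s z 0))
    rw [hQ]
    linarith
  have hsu2 : ‖s z u‖ ≤ (1 + 2 * L) * Q := by
    have h4 : ‖s z 0‖ ≤ Q := le_add_of_nonneg_right (norm_nonneg _)
    have h5 := mul_le_mul_of_nonneg_left hu2 hL
    linarith
  have heq : u - w - t • s z w = t • (B n - 1) (s z u) + t • (s z u - s z w) := by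
    rw [hstep]
    simp only [sub_apply, one_apply_eq_self, smul_sub]
    abel
  rw [heq]
  calc _ ≤ ‖t • (B n - 1) (s z u)‖ + ‖t • (s z u - s z w)‖ := norm_add_le _ _
    _ ≤ t * (K / ((n : ℝ) + 1) * ((1 + 2 * L) * Q)) + t * (L * (t * (2 * ((1 + 2 * L) * Q)))) := by
        rw [norm_smul, norm_smul, Real.norm_of_nonneg ht0.le]
        gcongr
        · exact ((B n - 1).le_opNorm _).trans (by gcongr; exact hK n)
        · exact (hs.lipschitz z u w).trans (by gcongr; exact hdiff.trans (by gcongr))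
    _ = _ := by rw [ht]; field_simp

end

/-! ### Matrix identities for the limiting covariance -/

theorem exists_norm_euclCLM_le (p : ℕ) : ∃ c : ℝ, 0 ≤ c ∧
    ∀ (A : Matrix (Fin p) (Fin p) ℝ) (ε : ℝ), (∀ i j, |A i j| ≤ ε) → ‖euclCLM A‖ ≤ ε * c := by
  refine ⟨∑ i, ∑ j, ‖euclCLM (Matrix.single i j (1 : ℝ) : Matrix (Fin p) (Fin p) ℝ)‖,
    by positivity, fun A ε hA => ?_⟩
  have h1 : euclCLM A = ∑ i, ∑ j, A i j • euclCLM (Matrix.single i j (1 : ℝ)) := by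
    conv_lhs => rw [Matrix.matrix_eq_sum_single A]
    simp only [euclCLM, map_sum, ← map_smul, Matrix.smul_single, smul_eq_mul, mul_one]
  rw [h1, Finset.mul_sum]
  refine (norm_sum_le _ _).trans (Finset.sum_le_sum fun i _ => ?_)
  rw [Finset.mul_sum]
  refine (norm_sum_le _ _).trans (Finset.sum_le_sum fun j _ => ?_)
  rw [norm_smul]
  gcongr
  exact hA i j

section

variable {p : ℕ} {C I R R' : Matrix (Fin p) (Fin p) ℝ} {γ : ℝ}

theorem Matrix.commute_nonsing_inv {M K : Matrix (Fin p) (Fin p) ℝ} (hM : IsUnit M.det)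
    (h : Commute M K) : Commute M⁻¹ K := by
  have h1 := Matrix.nonsing_inv_mul M hM
  have h2 := Matrix.mul_nonsing_inv M hM
  calc M⁻¹ * K = M⁻¹ * (K * M) * M⁻¹ := by rw [mul_assoc, mul_assoc, h2, mul_one]
    _ = K * M⁻¹ := by rw [← h.eq, ← mul_assoc, h1, one_mul]

/-- The matrix `γ² (2 γ C I - 1)⁻¹ C I` solves the Lyapunov equation of the recursion. -/
theorem lyapunov_matrix (hM : IsUnit ((2 * γ) • (C * I) - 1).det) :
    (2 * γ) • (C * I * (γ ^ 2 • (((2 * γ) • (C * I) - 1)⁻¹ * (C * I))))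
        - γ ^ 2 • (((2 * γ) • (C * I) - 1)⁻¹ * (C * I)) = γ ^ 2 • (C * I) := by
  set M := (2 * γ) • (C * I) - 1 with hMdef
  have h2 := Matrix.mul_nonsing_inv M hM
  have h3 : M * (γ ^ 2 • (M⁻¹ * (C * I))) = γ ^ 2 • (C * I) := by
    rw [mul_smul_comm, ← mul_assoc, h2, one_mul]
  rw [← h3]
  nth_rewrite 3 [hMdef]
  rw [sub_mul, one_mul, smul_mul_assoc]

/-- In the original coordinates the limiting covariance is the asymptotic variance. -/
theorem asymptoticVariance_eq_conj (hM : IsUnit ((2 * γ) • (C * I) - 1).det) (hRR : R * R = C)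
    (hRI : Commute R I) :
    R * (γ ^ 2 • (((2 * γ) • (C * I) - 1)⁻¹ * (C * I))) * R = asymptoticVariance γ C I := by
  have hRC : Commute R C := by rw [← hRR]; exact (Commute.refl R).mul_right (Commute.refl R)
  have hRM : Commute ((2 * γ) • (C * I) - 1) R :=
    (((hRC.mul_right hRI).smul_right _).sub_right (Commute.one_right R)).symm
  have hinv := Matrix.commute_nonsing_inv hM hRM
  unfold asymptoticVariance
  set N := ((2 * γ) • (C * I) - 1)⁻¹
  rw [mul_smul_comm, smul_mul_assoc]
  congr 1
  calc R * (N * (C * I)) * R = (R * N) * (C * I) * R := by simp only [mul_assoc]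
    _ = N * (R * (C * I)) * R := by rw [← hinv.eq]; simp only [mul_assoc]
    _ = N * (C * I) * (R * R) := by rw [(hRC.mul_right hRI).eq]; simp only [mul_assoc]
    _ = N * C * I * C := by rw [hRR]; simp only [mul_assoc]

end

/-! ### Covariance matrices of affine images -/

section

variable {p : ℕ} {Ω : Type*} [MeasurableSpace Ω] {P : Measure Ω} [IsProbabilityMeasure P]

theorem varianceMatrix_apply_of_ae_eq {R : Matrix (Fin p) (Fin p) ℝ} (hR : R.IsHermitian)
    {c : EuclideanSpace ℝ (Fin p)} {e θ : Ω → EuclideanSpace ℝ (Fin p)} (he : HasMoments e P)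
    (hθ : ∀ᵐ ω ∂P, θ ω = c + euclCLM R (e ω)) (i j : Fin p) :
    varianceMatrix P θ i j =
      cov[fun ω => inner ℝ (euclCLM R (EuclideanSpace.single i 1)) (e ω),
        fun ω => inner ℝ (euclCLM R (EuclideanSpace.single j 1)) (e ω); P] := by
  have hco : ∀ k, (fun ω => θ ω k) =ᵐ[P]
      fun ω => c k + inner ℝ (euclCLM R (EuclideanSpace.single k 1)) (e ω) := fun k => by
    filter_upwards [hθ] with ω hω
    rw [hω, inner_euclCLM_symm hR, EuclideanSpace.inner_single_left]
    simp
  have hcongr : ∀ {f f' g g' : Ω → ℝ}, f =ᵐ[P] f' → g =ᵐ[P] g' → cov[f, g; P] = cov[f', g'; P] := by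
    intro f f' g g' hf hg
    rw [covariance, covariance, integral_congr_ae hf, integral_congr_ae hg]
    refine integral_congr_ae ?_
    filter_upwards [hf, hg] with ω h1 h2
    rw [h1, h2]
  rw [varianceMatrix, Matrix.of_apply, hcongr (hco i) (hco j),
    covariance_const_add_left (he.inner _).integrable,
    covariance_const_add_right (he.inner _).integrable]

theorem memLp_two_of_ae_eq {R : Matrix (Fin p) (Fin p) ℝ}
    {c : EuclideanSpace ℝ (Fin p)} {e θ : Ω → EuclideanSpace ℝ (Fin p)} (he : HasMoments e P)
    (hθ : ∀ᵐ ω ∂P, θ ω = c + euclCLM R (e ω)) : MemLp θ 2 P := by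
  have h := ((hasMoments_const c).add (he.clm (euclCLM R))) 2
  exact (memLp_congr_ae (hθ.mono fun _ h => h.symm)).1 (by simpa using h)

end

theorem theorem2 {p d : ℕ} {Ω : Type*} [MeasurableSpace Ω] (P : Measure Ω) [IsProbabilityMeasure P]
    (μ : Measure (EuclideanSpace ℝ (Fin p))) [IsProbabilityMeasure μ]
    (ν : Measure (EuclideanSpace ℝ (Fin d))) [SigmaFinite ν]
    (f : EuclideanSpace ℝ (Fin d) → EuclideanSpace ℝ (Fin p) → EuclideanSpace ℝ (Fin p) → ℝ)
    (hf : IsDensityFamily ν f)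
    (θstar : EuclideanSpace ℝ (Fin p)) (L₀ : NNReal) (lamf : ℝ)
    (hlik : LikelihoodAssumptions μ ν f θstar L₀ lamf)
    -- the i.i.d. data stream, indexed by n ≥ 1
    (X : ℕ → Ω → EuclideanSpace ℝ (Fin p)) (Y : ℕ → Ω → EuclideanSpace ℝ (Fin d))
    (hX : ∀ n, 1 ≤ n → Measurable (X n)) (hY : ∀ n, 1 ≤ n → Measurable (Y n))
    (hindep : iIndepFun (fun (n : ℕ) (ω : Ω) => (X (n + 1) ω, Y (n + 1) ω)) P)
    (hlaw : ∀ n, 1 ≤ n → P.map (fun ω => (X n ω, Y n ω)) = dataLaw μ ν f θstar)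
    -- the learning rate parameter and the condition matrices
    (γ₁ : ℝ) (hγ₁ : 0 < γ₁)
    (Cn : ℕ → Matrix (Fin p) (Fin p) ℝ) (C : Matrix (Fin p) (Fin p) ℝ) (lamc Lamc : ℝ)
    (hC : ConditionMatrixAssumptions γ₁ Cn C (fisherInformation μ ν f θstar) lamc Lamc)
    (hpos : ((2 * γ₁) • (C * fisherInformation μ ν f θstar) - 1).PosDef) :
    -- explicit SGD, from any starting point
    (∀ θ₀ : EuclideanSpace ℝ (Fin p),
      (∀ n, MemLp (explicitSGD f X Y γ₁ Cn θ₀ n) 2 P) ∧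
      Tendsto (fun n : ℕ => (n : ℝ) • varianceMatrix P (explicitSGD f X Y γ₁ Cn θ₀ n)) atTop
        (𝓝 (asymptoticVariance γ₁ C (fisherInformation μ ν f θstar)))) ∧
    -- implicit SGD, from any starting point
    (∀ (θ₀ : EuclideanSpace ℝ (Fin p)) (θim : ℕ → Ω → EuclideanSpace ℝ (Fin p)),
      IsImplicitSGD P f X Y γ₁ Cn θ₀ θim →
      (∀ n, MemLp (θim n) 2 P) ∧
      Tendsto (fun n : ℕ => (n : ℝ) • varianceMatrix P (θim n)) atTop
        (𝓝 (asymptoticVariance γ₁ C (fisherInformation μ ν f θstar)))) := by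
  have := isProbabilityMeasure_dataLaw (μ := μ) hf θstar
  set I := fisherInformation μ ν f θstar with hI
  -- Coordinates `θ = θstar + R e` with `R = √C` turn the limit of the condition matrices into `1`.
  obtain ⟨R, R', hR, hRR, hRR', hR'R, hRcomm⟩ := hC.posDef_limit.exists_sqrt
  have hRI : Commute R I := hRcomm I hC.commute
  have hR' : R'.IsHermitian := by
    have h1 : R'.conjTranspose * R = 1 := by
      have := congrArg Matrix.conjTranspose hRR'
      rwa [Matrix.conjTranspose_mul, hR.eq, Matrix.conjTranspose_one] at this
    calc R'.conjTranspose = R'.conjTranspose * (R * R') := by rw [hRR', mul_one]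
      _ = R' := by rw [← mul_assoc, h1, one_mul]
  have hDD' : ∀ v, euclCLM R (euclCLM R' v) = v := fun v => by
    rw [euclCLM_mul_apply, hRR', euclCLM_one_apply]
  have hD'D : ∀ v, euclCLM R' (euclCLM R v) = v := fun v => by
    rw [euclCLM_mul_apply, hR'R, euclCLM_one_apply]
  have hRIR : R * I * R = C * I := by rw [mul_assoc, ← hRI.eq, ← mul_assoc, hRR]
  obtain ⟨ℓ, S, L, lam, hℓ, hSae⟩ := hlik.exists_isLogLikelihood hf (inner_euclCLM_symm hR) hD'D
  have hS : IsScoreField (dataLaw μ ν f θstar) S (euclCLM (C * I)) L lam := by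
    refine hℓ.isScoreField fun a b => ?_
    have h1 : ∀ᵐ z ∂(dataLaw μ ν f θstar), inner ℝ a (S z 0) * inner ℝ b (S z 0) =
        inner ℝ (euclCLM R a) (score f z.2 z.1 θstar) *
          inner ℝ (euclCLM R b) (score f z.2 z.1 θstar) := by
      filter_upwards [hSae] with z hz
      rw [hz 0, map_zero, add_zero, inner_euclCLM_symm hR, inner_euclCLM_symm hR]
    rw [integral_congr_ae h1, hlik.integral_inner_score_mul hf, inner_euclCLM_symm hR,
      euclCLM_mul_apply, euclCLM_mul_apply, ← hI, hRIR]
  -- The limiting covariance in these coordinates.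
  have hdet : IsUnit ((2 * γ₁) • (C * I) - 1).det :=
    (Matrix.isUnit_iff_isUnit_det _).1 hpos.isUnit
  set V : Matrix (Fin p) (Fin p) ℝ := γ₁ ^ 2 • (((2 * γ₁) • (C * I) - 1)⁻¹ * (C * I)) with hVdef
  obtain ⟨η, hη, hηle⟩ := hpos.exists_mul_norm_sq_le
  have hH : ∀ v, (1 + η) * ‖v‖ ^ 2 ≤ 2 * γ₁ * inner ℝ (euclCLM (C * I) v) v := by
    intro v
    have h1 := hηle v
    have h2 : euclCLM ((2 * γ₁) • (C * I) - 1) v = (2 * γ₁) • euclCLM (C * I) v - v := by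
      nth_rewrite 3 [← euclCLM_one_apply v]
      simp only [euclCLM, map_sub, map_smul]
      rfl
    rw [h2, inner_sub_left, real_inner_smul_left, real_inner_self_eq_norm_sq] at h1
    linarith
  have hV : (2 * γ₁) • (euclCLM (C * I) * euclCLM V) - euclCLM V = γ₁ ^ 2 • euclCLM (C * I) := by
    simp only [euclCLM, ← map_mul, ← map_smul, ← map_sub]
    rw [hVdef, lyapunov_matrix hdet]
  have hVcomm : euclCLM V * euclCLM (C * I) = euclCLM (C * I) * euclCLM V := by
    simp only [euclCLM, ← map_mul]
    have h1 : Commute ((2 * γ₁) • (C * I) - 1) (C * I) :=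
      ((Commute.refl (C * I)).smul_left _).sub_left (Commute.one_left _)
    have h2 : Commute V (C * I) :=
      ((Matrix.commute_nonsing_inv hdet h1).mul_left (Commute.refl _)).smul_left _
    rw [h2.eq]
  -- The data stream, reindexed to start at `0`.
  set ζ : ℕ → Ω → EuclideanSpace ℝ (Fin p) × EuclideanSpace ℝ (Fin d) :=
    fun n ω => (X (n + 1) ω, Y (n + 1) ω) with hζdef
  have hζ : IsDataStream P (dataLaw μ ν f θstar) ζ :=
    ⟨fun n => (hX _ (by omega)).prodMk (hY _ (by omega)), hindep, fun n => hlaw _ (by omega)⟩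
  have hSζ : ∀ n, ∀ᵐ ω ∂P, ∀ u, S (ζ n ω) u =
      euclCLM R (score f (Y (n + 1) ω) (X (n + 1) ω) (θstar + euclCLM R u)) := by
    intro n
    have h1 := hSae
    rw [← hζ.law n] at h1
    exact ae_of_ae_map (hζ.measurable n).aemeasurable h1
  -- The condition matrices in these coordinates.
  set B : ℕ → EuclideanSpace ℝ (Fin p) →L[ℝ] EuclideanSpace ℝ (Fin p) :=
    fun n => euclCLM (R' * Cn (n + 1) * R') with hBdef
  have hBapp : ∀ n v, B n v = euclCLM R' (euclCLM (Cn (n + 1)) (euclCLM R' v)) := fun n v => by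
    simp only [hBdef, euclCLM_mul_apply, mul_assoc]
  have hBpos : ∀ n v, v ≠ 0 → 0 < inner ℝ (B n v) v := by
    intro n v hv
    rw [hBapp, inner_euclCLM_symm hR', real_inner_comm, Matrix.inner_toEuclideanCLM]
    refine hC.pos (n + 1) (by omega) _ fun h => hv ?_
    have h1 : euclCLM R' v = 0 := by ext i; exact congrFun h i
    rw [← hDD' v, h1, map_zero]
  have hB : ∃ K : ℝ, ∀ n : ℕ, ‖B n - 1‖ ≤ K / ((n : ℝ) + 1) := by
    obtain ⟨K, hK⟩ := hC.bigO
    obtain ⟨c, hc0, hc⟩ := exists_norm_euclCLM_le p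
    refine ⟨‖euclCLM R'‖ * (K * γ₁ * c) * ‖euclCLM R'‖, fun n => ?_⟩
    have h1 : B n - 1 = euclCLM R' * euclCLM (Cn (n + 1) - C) * euclCLM R' := by
      have h2 : R' * C * R' = 1 := by rw [← hRR, ← mul_assoc, hR'R, one_mul, hRR']
      simp only [hBdef, euclCLM, ← map_mul, sub_mul, mul_sub, h2, map_sub, map_one]
    have h3 : ‖euclCLM (Cn (n + 1) - C)‖ ≤ K * γ₁ * c / ((n : ℝ) + 1) := by
      refine (hc _ _ fun i j => hK (n + 1) (by omega) i j).trans_eq ?_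
      simp only [learningRate]
      push_cast
      ring
    rw [h1]
    calc _ ≤ ‖euclCLM R'‖ * ‖euclCLM (Cn (n + 1) - C)‖ * ‖euclCLM R'‖ :=
          (norm_mul_le _ _).trans (by gcongr; exact norm_mul_le _ _)
      _ ≤ ‖euclCLM R'‖ * (K * γ₁ * c / ((n : ℝ) + 1)) * ‖euclCLM R'‖ := by gcongr
      _ = _ := by ring
  -- Transfer of the conclusions from the recursion in these coordinates to the iterates.
  have transfer : ∀ (e θ : ℕ → Ω → EuclideanSpace ℝ (Fin p)), IsPerturbedSGD P ζ S γ₁ e →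
      (∀ n, ∀ᵐ ω ∂P, θ n ω = θstar + euclCLM R (e n ω)) →
      (∀ n, MemLp (θ n) 2 P) ∧ Tendsto (fun n : ℕ => (n : ℝ) • varianceMatrix P (θ n)) atTop
        (𝓝 (asymptoticVariance γ₁ C I)) := by
    intro e θ he hθ
    refine ⟨fun n => memLp_two_of_ae_eq (he.moments n) (hθ n), ?_⟩
    refine tendsto_pi_nhds.2 fun i => tendsto_pi_nhds.2 fun j => ?_
    have h1 := hS.tendsto_covariance hγ₁ hη hH hV hVcomm hζ he
      (euclCLM R (EuclideanSpace.single i 1)) (euclCLM R (EuclideanSpace.single j 1))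
    have h2 : inner ℝ (euclCLM R (EuclideanSpace.single i 1))
        (euclCLM V (euclCLM R (EuclideanSpace.single j 1))) = asymptoticVariance γ₁ C I i j := by
      rw [inner_euclCLM_symm hR, euclCLM_mul_apply, euclCLM_mul_apply, inner_euclCLM_single,
        ← asymptoticVariance_eq_conj hdet hRR hRI, mul_assoc]
    rw [h2] at h1
    refine h1.congr fun n => ?_
    rw [Matrix.smul_apply, smul_eq_mul, varianceMatrix_apply_of_ae_eq hR (he.moments n) (hθ n)]
  have hrate : ∀ n : ℕ, learningRate γ₁ (n + 1) = γ₁ / ((n : ℝ) + 1) := fun n => by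
    simp [learningRate]
  refine ⟨fun θ₀ => ?_, fun θ₀ θim him => ?_⟩
  · refine transfer _ _ (hS.isPerturbedSGD_explicit hγ₁ hζ hB (euclCLM R' (θ₀ - θstar)))
      fun n => ?_
    induction n with
    | zero => exact Eventually.of_forall fun ω => by simp [explicitSGD, streamRecursion, hDD']
    | succ n ih =>
      filter_upwards [ih, hSζ n] with ω h1 h2
      simp only [explicitSGD, streamRecursion, explicitUpdate]
      rw [h2, hBapp, hD'D, map_add, map_smul, hDD', ← add_assoc, ← h1, hrate]
      rfl
  · obtain ⟨e, he, he0, hestep⟩ := hS.exists_isPerturbedSGD_implicit hγ₁ hζ hBpos hB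
      (euclCLM R' (θ₀ - θstar))
    refine transfer e θim he fun n => ?_
    induction n with
    | zero =>
      filter_upwards [him.init] with ω h1
      rw [h1, he0, hDD']
      abel
    | succ n ih =>
      filter_upwards [ih, hSζ n, him.step n] with ω h1 h2 h3
      -- In these coordinates `θim (n + 1)` solves the same implicit equation as `e (n + 1)`.
      set u := euclCLM R' (θim (n + 1) ω - θstar) with hu
      have hθu : θim (n + 1) ω = θstar + euclCLM R u := by rw [hu, hDD']; abel
      have hueq : u = e n ω + (γ₁ / ((n : ℝ) + 1)) • B n (S (ζ n ω) u) := by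
        rw [h2, ← hθu, hBapp, hD'D, ← hrate, hu]
        nth_rewrite 1 [h3]
        rw [h1, add_assoc, add_sub_cancel_left, map_add, hD'D, map_smul]
        rfl
      have hBnn : ∀ v, 0 ≤ inner ℝ (B n v) v := fun v => by
        rcases eq_or_ne v 0 with rfl | hv
        · simp
        · exact (hBpos n v hv).le
      rw [hθu, hS.implicit_unique hBnn (by positivity) hueq (hestep n ω)]
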